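/- Let $d\ge 1$, $1<\alpha\le 2$, $\sigma>0$, $b\in[-1,1]$, $d<\beta<\alpha d$ and $\gamma=\beta/d$. Write $B(x,r)$ for the closed Euclidean ball of $\mathbb R^d$, $v_d$ for the volume of the unit ball, and $\epsilon(t)\in\{-1,0,1\}$ for the sign of $t$. Let $G$ be a probability measure on $\mathbb R$ in the normal domain of attraction of the stable law $S_\alpha(\sigma,b,0)$, whose characteristic function is $\exp\big(-\sigma^\alpha|t|^\alpha(1-i\,b\,\epsilon(t)\tan(\pi\alpha/2))\big)$; that is, if $X_1,X_2,\dots$ are i.i.d. of law $G$, then for some real constants $a_m$ the variables $m^{-1/\alpha}(X_1+\dots+X_m)+a_m$ converge in law to $S_\alpha(\sigma,b,0)$. Put $\psi(u)=e^{iu}-1-iu$ and $\psi_G(u)=\int_{\mathbb R}\psi(mu)\,G(dm)$. Let $f$ be a probability density on $(0,\infty)$ with $f(r)\sim C_\beta r^{-\beta-1}$ as $r\to\infty$ and $f(r)\le C_0r^{-\beta-1}$ for all $r>0$, where $0<C_\beta,C_0<\infty$. Let $k:\mathbb R^d\times\mathbb R^d\to[0,\infty)$ be measurable and bounded. For $\rho\in(0,1)$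 let $\lambda(\rho)>0$ and let $k_\rho\ge 0$ be measurable on $\mathbb R^d\times\mathbb R^d$, with $k_\rho(x,y)\sim\lambda(\rho)k(x,y)$ as $\rho\to0$ for all $x,y$, and $k_\rho(x,y)\le C_1\lambda(\rho)k(x,y)$ for all $x,y,\rho$, with a constant $C_1$. Let $\mathcal M_{\alpha,\beta}$ be the set of signed measures $\mu$ of finite total variation on $\mathbb R^d$ for which there are $0<p<\beta<q\le 2d$ and $C_\mu>0$ with $\int_{\mathbb R^d}|\mu(B(x,r))|^\alpha dx\le C_\mu\min(r^p,r^q)$ for all $r>0$. For $n(\rho)>0$ on $(0,1)$, $\theta\in\mathbb R$ and $y\in\mathbb R^d$ put $$I_\rho=\int_{\mathbb R^d\times\mathbb R_+}\psi_G\Big(\frac{\theta\mu(B(x,r))}{n(\rho)}\Big)k_\rho(x,y)\,dx\,f\Big(\frac r\rho\Big)\frac{dr}\rho .$$ Here $u(\rho)\sim v(\rho)$ means $u(\rho)-v(\rho)=o(v(\rho))$ as $\rho\to0^+$. All the integrals below, and $I_\rho$ for each $\rho\in(0,1)$, converge absolutely, and for all $\theta\in\mathbb R$ and $y\in\mathbb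 R^d$ the following hold. 1. Suppose $n(\rho)\to+\infty$, $\mu\in\mathcal M_{\alpha,\beta}$ and, if $\alpha=2$, that $G$ has mean $0$. Then $$I_\rho\sim-\sigma^\alpha|\theta|^\alpha\frac{\lambda(\rho)\rho^\beta}{n(\rho)^\alpha}\int_{\mathbb R^d\times\mathbb R_+}|\mu(B(x,r))|^\alpha\Big(1-i\,\epsilon(\theta\mu(B(x,r)))\tan(\pi\alpha/2)\,b\Big)k(x,y)\,dx\,C_\beta r^{-\beta-1}dr.$$ 2. Suppose $n(\rho)=1$ and $\mu\in\mathcal M_{\alpha,\beta}$. Then $$I_\rho\sim\lambda(\rho)\rho^\beta\int_{\mathbb R^d\times\mathbb R_+}\psi_G\big(\theta\mu(B(x,r))\big)k(x,y)\,dx\,C_\beta r^{-\beta-1}dr.$$ 3. Suppose $n(\rho)\to0$, $\rho^d=o(n(\rho))$ and $\mu(dx)=\varphi(x)\,dx$ with $\varphi\in L^1(\mathbb R^d)\cap L^\alpha(\mathbb R^d)$. Put $J=\int_{\mathbb R^d\times\mathbb R_+}\psi_G(\theta\varphi(x)r^d)\,k(x,y)\,dx\,v_d^\gamma C_\beta r^{-\beta-1}dr$.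 Then $\frac{n(\rho)^\gamma}{\lambda(\rho)\rho^\beta}I_\rho\to J$, and $$I_\rho\sim\frac{\lambda(\rho)\rho^\beta}{n(\rho)^\gamma}\,J$$ whenever $J\ne0$ or $k(x,y)>0$ for all $x$. -/

import Mathlib

open MeasureTheory Set Filter Topology Asymptotics

namespace CoxBalls

noncomputable section

/-- The Euclidean space `ℝ^d`. -/
abbrev Space (d : ℕ) : Type := EuclideanSpace ℝ (Fin d)

/-- `S` is the stable law `S_α(σ, b, 0)`, for an index `α ≠ 1` (the only case used is
`1 < α ≤ 2`), given by its characteristic function. -/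
def IsStableLaw (α σ b : ℝ) (S : Measure ℝ) : Prop :=
  ∀ t : ℝ, charFun S t =
    Complex.exp (-((σ ^ α * |t| ^ α : ℝ) : ℂ) *
      (1 - Complex.I * ((b * Real.sign t * Real.tan (Real.pi * α / 2) : ℝ) : ℂ)))

/-- `G` is in the normal domain of attraction of `S_α(σ, b, 0)`: for i.i.d. variables
`X_1, X_2, …` of law `G` and some centering constants `a_n`, the variables
`n^{-1/α} (X_1 + ⋯ + X_n) + a_n` converge in distribution to `S_α(σ, b, 0)`. -/
def NormalDomainOfAttraction (α σ b : ℝ) (G : Measure ℝ) [IsProbabilityMeasure G] : Prop :=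
  ∃ (S : Measure ℝ) (_ : IsProbabilityMeasure S), IsStableLaw α σ b S ∧
    ∃ a : ℕ → ℝ,
      TendstoInDistribution
        (fun (n : ℕ) (X : Fin n → ℝ) => (∑ i, X i) / (n : ℝ) ^ (1 / α) + a n)
        atTop (fun s : ℝ => s)
        (fun n => Measure.pi (fun _ : Fin n => G)) S

/-- `ψ(u) = e^{iu} - 1 - iu`. -/
def psi (u : ℝ) : ℂ := Complex.exp (Complex.I * u) - 1 - Complex.I * u

/-- `ψ_G(u) = ∫ ψ(m u) G(dm)`. -/
def psiG (G : Measure ℝ) (u : ℝ) : ℂ := ∫ m, psi (m * u) ∂G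

/-- The class `M_{α,β}` of signed measures (a `SignedMeasure` has finite total variation). -/
def MClass {d : ℕ} (α β : ℝ) (μ : SignedMeasure (Space d)) : Prop :=
  ∃ p q C : ℝ, 0 < p ∧ p < β ∧ β < q ∧ q ≤ 2 * d ∧ 0 < C ∧
    ∀ r : ℝ, 0 < r →
      ∫⁻ x, ENNReal.ofReal (|μ (Metric.closedBall x r)| ^ α) ≤
        ENNReal.ofReal (C * min (r ^ p) (r ^ q))

/-- The measure `dx dr` on `ℝ^d × (0, ∞)`. -/
def dxdr (d : ℕ) : Measure (Space d × ℝ) :=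
  (volume : Measure (Space d)).prod (volume.restrict (Ioi (0 : ℝ)))

/-- The volume of the unit Euclidean ball of `ℝ^d`. -/
def unitBallVol (d : ℕ) : ℝ := (volume : Measure (Space d)).real (Metric.closedBall 0 1)

/-- `ψ_G(θ μ(B(x,r)) / n) κ(x,y) f(r/ρ) / ρ`, as a function of `(x, r)`, where `κ` is the kernel
at scale `ρ` and `n` the normalization. -/
def scaledIntegrand {d : ℕ} (G : Measure ℝ) (μ : SignedMeasure (Space d))
    (κ : Space d → Space d → ℝ) (f : ℝ → ℝ) (ρ n θ : ℝ) (y : Space d) (z : Space d × ℝ) : ℂ :=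
  psiG G (θ * μ (Metric.closedBall z.1 z.2) / n) * ((κ z.1 y * (f (z.2 / ρ) / ρ) : ℝ) : ℂ)

/-- `|μ(B(x,r))|^α (1 - i ε(θ μ(B(x,r))) tan(πα/2) b) k(x,y) C_β r^{-β-1}`. -/
def stableIntegrand {d : ℕ} (α β b Cβ : ℝ) (μ : SignedMeasure (Space d))
    (k : Space d → Space d → ℝ) (θ : ℝ) (y : Space d) (z : Space d × ℝ) : ℂ :=
  ((|μ (Metric.closedBall z.1 z.2)| ^ α : ℝ) : ℂ) *
    (1 - Complex.I * ((Real.sign (θ * μ (Metric.closedBall z.1 z.2)) *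
      Real.tan (Real.pi * α / 2) * b : ℝ) : ℂ)) *
    ((k z.1 y * (Cβ * z.2 ^ (-β - 1)) : ℝ) : ℂ)

/-- `ψ_G(θ μ(B(x,r))) k(x,y) C_β r^{-β-1}`. -/
def poissonIntegrand {d : ℕ} (β Cβ : ℝ) (G : Measure ℝ) (μ : SignedMeasure (Space d))
    (k : Space d → Space d → ℝ) (θ : ℝ) (y : Space d) (z : Space d × ℝ) : ℂ :=
  psiG G (θ * μ (Metric.closedBall z.1 z.2)) * ((k z.1 y * (Cβ * z.2 ^ (-β - 1)) : ℝ) : ℂ)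

/-- `ψ_G(θ φ(x) r^d) k(x,y) v_d^γ C_β r^{-β-1}`, with `γ = β / d`. -/
def smallBallIntegrand {d : ℕ} (β Cβ : ℝ) (G : Measure ℝ) (φ : Space d → ℝ)
    (k : Space d → Space d → ℝ) (θ : ℝ) (y : Space d) (z : Space d × ℝ) : ℂ :=
  psiG G (θ * φ z.1 * z.2 ^ d) *
    ((k z.1 y * (unitBallVol d ^ (β / d) * (Cβ * z.2 ^ (-β - 1))) : ℝ) : ℂ)

end

end CoxBalls

/-!
The integrals are normalized by `lam ρ * ρ ^ β / n(ρ)^…`, and the resulting integrands converge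
pointwise under an integrable majorant. The work lies in the majorants, which need sharp information
on `ψ_G`, and in showing that a vanishing limit forces the integrals themselves to vanish, since
`I ~ J` with `J = 0` means that `I` is eventually `0`.

**Bounds for `ψ_G`.** Convergence in law of the normalized sums gives tightness, hence
`‖charFun G (t n^{-1/α})‖ ^ n ≥ 1/2` for all `n` and all small `t`, and so
`1 - ‖charFun G u‖² = O(|u|^α)`. Integrating this over frequencies bounds
`E min ((u X)², |u X|)` by a multiple of `|u|^α`, first for the symmetrized law and then for `G`
(`NormalDomainOfAttraction.exists_lintegral_truncSq_le`). As `‖ψ v‖ ≤ 2 min (v², |v|)`, it follows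
that `G` has a mean, that `‖ψ_G u‖ = O(|u|^α)` and `‖ψ_G u‖ = O(|u|)`, and that `ψ_G` is Lipschitz.

**Expansion of `ψ_G` at `0`.** After centring the summands at their mean, the centering constants of
the normalized sums tend to `0`: they are bounded by tightness, and a nonzero limit would contribute
a term linear in `t` where everything else is `O(|t|^α)` (`tendsto_zero_of_centering`). Taking
logarithms, `n ψ_G(t n^{-1/α})` converges to the exponent of the stable law, and the Lipschitz bound
passes from integers to reals (`tendsto_rpow_mul_psiG_div`). For `α = 2` the centering itself
produces a term of order `u²`, which is why the mean has to be `0`.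

**Measures of the class `M_{α,β}`.** By definition of the class, `|μ(B(x,r))|^α r^{-β-1}` is
integrable on `ℝ^d × (0, ∞)`, and it dominates the integrands of the first two limits
(`tendsto_integral_scaled`). If the first limit is `0`, the real part of its integrand shows that
`θ μ(B(x,r)) k(x,y) = 0` almost everywhere. If the second limit is `0`, then `Re ψ_G ≤ 0` shows that
`Re ψ_G(θ μ(B(x,r))) = 0` almost everywhere on `k ≠ 0`; since `Re ψ_G < 0` on a punctured
neighbourhood of `0`, the values `μ(B(x,r))` avoid such a neighbourhood. But `μ` has no atoms, so for
almost every `x` all spheres around `x` are null, `r ↦ μ(B(x,r))` is continuous with value `0` at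
`r = 0`, and by the intermediate value theorem it vanishes identically
(`ae_apply_closedBall_eq_zero_of_gap`). In both cases `I_ρ = 0`.

**Densities.** If `μ = φ dx`, Young's inequality for the ball averages places `μ` in the class
`M_{α,β}` with `p = d` and `q = α d`. The substitution `r = (n/v_d)^{1/d} s` turns `μ(B(x,r))/n`
into `s^d` times a ball average of `φ`, which tends to `φ` in `L¹`
(`tendsto_integral_ball_average_sub`). By the Lipschitz bound the integral over `x` converges for
each `s`, and it is `O(min (s^d) (s^{α d}))`, which is integrable against `s^{-β-1} ds` because
`d < β < α d` (`tendsto_mul_integral_scaledIntegrand_zero`). For a positive kernel the limit vanishes only if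
`θ φ = 0` almost everywhere, because `θ φ(x) r^d` takes all small values of the sign of `θ φ(x)`.
-/

namespace CoxBalls

section

/-! ### The truncated quadratic function -/

/-- The truncated quadratic function `min (v ^ 2) |v|`, comparable with `‖ψ‖`. -/
def truncSq (v : ℝ) : ℝ := min (v ^ 2) |v|

lemma truncSq_nonneg (v : ℝ) : 0 ≤ truncSq v := le_min (sq_nonneg v) (abs_nonneg v)

lemma measurable_truncSq : Measurable truncSq :=
  (Measurable.min (by fun_prop) (by fun_prop : Measurable fun v : ℝ => |v|))

lemma abs_le_one_add_truncSq (x : ℝ) : |x| ≤ 1 + truncSq x := by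
  rcases le_or_gt |x| 1 with hx | hx
  · linarith [truncSq_nonneg x]
  · rw [truncSq, min_eq_right (by rw [← sq_abs]; nlinarith)]; linarith

lemma sq_le_abs_rpow {α u : ℝ} (hα : 0 < α) (hα2 : α ≤ 2) (hu : |u| ≤ 1) : u ^ 2 ≤ |u| ^ α := by
  rw [← sq_abs, ← Real.rpow_two]
  rcases eq_or_ne u 0 with rfl | hu0
  · simp [Real.zero_rpow hα.ne']
  · exact Real.rpow_le_rpow_of_exponent_ge (abs_pos.2 hu0) hu hα2

lemma truncSq_le_four_mul_add (a b : ℝ) : truncSq (a + b) ≤ 4 * (truncSq a + truncSq b) := by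
  wlog h : |b| ≤ |a| generalizing a b
  · rw [add_comm a b, add_comm (truncSq a)]
    exact this b a (not_le.1 h).le
  have h1 : |a + b| ≤ 2 * |a| := (abs_add_le a b).trans (by linarith)
  have h2 : (a + b) ^ 2 ≤ 4 * a ^ 2 := by
    rw [← sq_abs (a + b), ← sq_abs a]
    nlinarith [abs_nonneg (a + b), abs_nonneg a]
  have h3 : truncSq (a + b) ≤ 4 * truncSq a := by
    unfold truncSq
    rw [mul_min_of_nonneg _ _ (by norm_num : (0 : ℝ) ≤ 4)]
    exact min_le_min h2 (h1.trans (by linarith [abs_nonneg a]))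
  linarith [truncSq_nonneg b]

/-- The truncated quadratic function is dominated by a weighted integral of `1 - cos (s v)` over frequencies
`s`; integrating in `v` converts bounds on a characteristic function into moment bounds. -/
lemma truncSq_le_lintegral_one_sub_cos (v : ℝ) :
    ENNReal.ofReal (truncSq v) ≤
      5 * ∫⁻ s in Ioc (0 : ℝ) 1, ENNReal.ofReal ((1 - Real.cos (s * v)) / s ^ 2) := by
  rcases eq_or_ne v 0 with rfl | hv
  · simp [truncSq]
  have hv' : 0 < |v| := abs_pos.2 hv
  -- on `(0, c]` the argument `s v` stays in `[-1, 1]`, where `1 - cos` is at least quadratic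
  set c : ℝ := min 1 (1 / |v|) with hc
  have hc0 : 0 < c := lt_min one_pos (by positivity)
  have hpi : (1 : ℝ) / 5 ≤ 2 / Real.pi ^ 2 := by
    rw [div_le_div_iff₀ (by norm_num) (by positivity)]
    nlinarith [Real.pi_lt_d2, Real.pi_pos]
  have h1 : ∫⁻ s in Ioc (0 : ℝ) c, ENNReal.ofReal (1 / 5 * v ^ 2) ≤
      ∫⁻ s in Ioc (0 : ℝ) 1, ENNReal.ofReal ((1 - Real.cos (s * v)) / s ^ 2) := by
    refine (setLIntegral_mono' measurableSet_Ioc fun s hs => ?_).trans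
      (lintegral_mono_set (Ioc_subset_Ioc_right (min_le_left _ _)))
    apply ENNReal.ofReal_le_ofReal
    have hs1 : s * |v| ≤ 1 := by
      have := hs.2.trans (min_le_right _ _)
      rwa [le_div_iff₀ hv'] at this
    have hsv : |s * v| ≤ Real.pi := by
      rw [abs_mul, abs_of_pos hs.1]
      linarith [Real.pi_gt_three]
    have := Real.cos_le_one_sub_mul_cos_sq hsv
    rw [le_div_iff₀ (pow_pos hs.1 2)]
    have h5 : 1 / 5 * (s * v) ^ 2 ≤ 2 / Real.pi ^ 2 * (s * v) ^ 2 := by gcongr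
    nlinarith
  have h2 : truncSq v = 5 * (1 / 5 * v ^ 2 * c) := by
    rw [hc, mul_min_of_nonneg _ _ (by positivity), mul_min_of_nonneg _ _ (by norm_num), truncSq]
    congr 1
    · ring
    · field_simp
      exact sq_abs v
  rw [h2, ENNReal.ofReal_mul (by norm_num)]
  gcongr ?_ * ?_
  · simp
  · refine le_trans (le_of_eq ?_) h1
    rw [setLIntegral_const, Real.volume_Ioc, ← ENNReal.ofReal_mul (by positivity), sub_zero]

/-! ### Elementary bounds for `ψ` -/

lemma hasDerivAt_psi (v : ℝ) :
    HasDerivAt psi (Complex.I * (Complex.exp (Complex.I * v) - 1)) v := by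
  have h1 : HasDerivAt (fun u : ℝ => Complex.I * (u : ℂ)) Complex.I v := by
    simpa using (Complex.ofRealCLM.hasDerivAt (x := v)).const_mul Complex.I
  have := (h1.cexp.sub_const 1).sub h1
  convert! this using 1
  ring

lemma continuous_psi : Continuous psi := by
  unfold psi; fun_prop

@[simp] lemma psi_zero : psi 0 = 0 := by simp [psi]

lemma norm_psi_sub_le {v w m : ℝ} (hv : |v| ≤ m) (hw : |w| ≤ m) :
    ‖psi v - psi w‖ ≤ min m 2 * |v - w| := by
  have := Convex.norm_image_sub_le_of_norm_hasDerivWithin_le (f := psi) (s := Icc (-m) m)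
    (C := min m 2) (fun x _ => (hasDerivAt_psi x).hasDerivWithinAt) (fun x hx => ?_)
    (convex_Icc _ _) (abs_le.1 hw) (abs_le.1 hv)
  · simpa using this
  · rw [norm_mul, Complex.norm_I, one_mul]
    refine le_min (Real.norm_exp_I_mul_ofReal_sub_one_le.trans (abs_le.2 hx)) ?_
    refine (norm_sub_le _ _).trans ?_
    rw [mul_comm, Complex.norm_exp_ofReal_mul_I]
    norm_num

lemma norm_psi_sub_le_two_mul (v w : ℝ) : ‖psi v - psi w‖ ≤ 2 * |v - w| :=
  (norm_psi_sub_le (le_max_left |v| |w|) (le_max_right _ _)).trans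
    (mul_le_mul_of_nonneg_right (min_le_right _ _) (abs_nonneg _))

lemma norm_psi_le (v : ℝ) : ‖psi v‖ ≤ 2 * truncSq v := by
  have := norm_psi_sub_le (v := v) (w := 0) le_rfl (by simp)
  simp only [psi_zero, sub_zero] at this
  refine this.trans ?_
  rw [truncSq, mul_min_of_nonneg _ _ (by norm_num), min_mul_of_nonneg _ _ (abs_nonneg v)]
  refine min_le_min ?_ le_rfl
  rw [← sq_abs]; nlinarith [sq_nonneg |v|]

lemma norm_psi_le_two_mul_sq (v : ℝ) : ‖psi v‖ ≤ 2 * v ^ 2 :=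
  (norm_psi_le v).trans (mul_le_mul_of_nonneg_left (min_le_left _ _) (by norm_num))

lemma psi_re (v : ℝ) : (psi v).re = -(1 - Real.cos v) := by
  simp [psi, Complex.exp_re]

/-! ### Characteristic functions of the normalized sums -/

lemma charFun_map_sum_div_add (G : Measure ℝ) [IsProbabilityMeasure G] (n : ℕ) (c a t : ℝ) :
    charFun ((Measure.pi fun _ : Fin n => G).map (fun X => (∑ i, X i) / c + a)) t =
      charFun G (t / c) ^ n * Complex.exp (a * t * Complex.I) := by
  rw [charFun_apply_real, integral_map (by fun_prop) (by fun_prop), charFun_apply_real]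
  have : ∀ X : Fin n → ℝ, Complex.exp (t * ((∑ i, X i) / c + a : ℝ) * Complex.I) =
      (∏ i, Complex.exp (((t / c : ℝ) : ℂ) * X i * Complex.I)) *
        Complex.exp (a * t * Complex.I) := by
    intro X
    rw [← Complex.exp_sum, ← Complex.exp_add]
    congr 1
    push_cast
    rw [← Finset.sum_mul, ← Finset.mul_sum]
    ring
  simp_rw [this]
  rw [integral_mul_const, integral_fintype_prod_eq_prod (μ := fun _ : Fin n => G)
    (f := fun _ (x : ℝ) => Complex.exp (((t / c : ℝ) : ℂ) * x * Complex.I))]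
  simp

/-- The exponent `σ^α |t|^α (1 - i b ε(t) tan (π α / 2))` of the stable characteristic function. -/
noncomputable def stableExponent (α σ b t : ℝ) : ℂ :=
  ((σ ^ α * |t| ^ α : ℝ) : ℂ) *
    (1 - Complex.I * ((b * Real.sign t * Real.tan (Real.pi * α / 2) : ℝ) : ℂ))

lemma norm_stableExponent_le {α σ b t : ℝ} (hσ : 0 < σ) (hb : b ∈ Icc (-1 : ℝ) 1) :
    ‖stableExponent α σ b t‖ ≤ σ ^ α * (1 + |Real.tan (Real.pi * α / 2)|) * |t| ^ α := by
  have h0 : 0 ≤ σ ^ α * |t| ^ α := by positivity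
  rw [stableExponent, norm_mul, Complex.norm_real, Real.norm_of_nonneg h0]
  have : ‖(1 : ℂ) - Complex.I * ((b * Real.sign t * Real.tan (Real.pi * α / 2) : ℝ) : ℂ)‖ ≤
      1 + |Real.tan (Real.pi * α / 2)| := by
    refine (norm_sub_le _ _).trans ?_
    rw [norm_one, norm_mul, Complex.norm_I, one_mul, Complex.norm_real, Real.norm_eq_abs, abs_mul,
      abs_mul]
    have h1 : |b| ≤ 1 := abs_le.2 hb
    have h2 : |Real.sign t| ≤ 1 := by
      rcases Real.sign_apply_eq t with h | h | h <;> simp [h]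
    have h3 : |b| * |Real.sign t| ≤ 1 := mul_le_one₀ h1 (abs_nonneg _) h2
    nlinarith [abs_nonneg (Real.tan (Real.pi * α / 2))]
  calc _ ≤ σ ^ α * |t| ^ α * (1 + |Real.tan (Real.pi * α / 2)|) := by gcongr
    _ = _ := by ring

/-- Convergence of the normalized sums, together with its tightness, expressed through the
characteristic function of a single summand. -/
lemma NormalDomainOfAttraction.exists_charFun {α σ b : ℝ} {G : Measure ℝ} [IsProbabilityMeasure G]
    (hα : 1 < α) (hσ : 0 < σ) (hb : b ∈ Icc (-1 : ℝ) 1)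
    (hG : NormalDomainOfAttraction α σ b G) :
    ∃ (a : ℕ → ℝ) (t₀ : ℝ), 0 < t₀ ∧
      (∀ n : ℕ, ∀ t : ℝ, |t| ≤ t₀ →
        ‖1 - charFun G (t / (n : ℝ) ^ (1 / α)) ^ n * Complex.exp (a n * t * Complex.I)‖ ≤ 1 / 2) ∧
      ∀ t : ℝ, Tendsto (fun n : ℕ =>
        charFun G (t / (n : ℝ) ^ (1 / α)) ^ n * Complex.exp (a n * t * Complex.I))
        atTop (𝓝 (Complex.exp (-stableExponent α σ b t))) := by
  obtain ⟨S, hSp, hS, a, hlim⟩ := hG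
  set ν : ℕ → Measure ℝ := fun n => (Measure.pi fun _ : Fin n => G).map
    (fun X => (∑ i, X i) / (n : ℝ) ^ (1 / α) + a n) with hν
  have hνp : ∀ n, IsProbabilityMeasure (ν n) :=
    fun n => Measure.isProbabilityMeasure_map (by fun_prop)
  have hcf : ∀ n t, charFun (ν n) t =
      charFun G (t / (n : ℝ) ^ (1 / α)) ^ n * Complex.exp (a n * t * Complex.I) :=
    fun n t => charFun_map_sum_div_add G n _ _ t
  have hconv : ∀ t, Tendsto (fun n => charFun (ν n) t) atTop
      (𝓝 (Complex.exp (-stableExponent α σ b t))) := by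
    intro t
    have := ProbabilityMeasure.tendsto_iff_tendsto_charFun.1 hlim.tendsto t
    have h2 : charFun S t = Complex.exp (-stableExponent α σ b t) := by
      rw [hS t, stableExponent, neg_mul]
    simpa [Measure.map_id', h2, hν] using this
  have htight : IsTightMeasureSet (range ν) := by
    refine isTightMeasureSet_of_tendsto_charFun
      (f := fun t => Complex.exp (-stableExponent α σ b t)) ?_ hconv
    have h0 : stableExponent α σ b 0 = 0 := by
      simp [stableExponent, Real.zero_rpow (by linarith : α ≠ 0)]
    have : Tendsto (fun t => stableExponent α σ b t) (𝓝 0) (𝓝 0) := by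
      refine squeeze_zero_norm (fun t => norm_stableExponent_le hσ hb) ?_
      have : ContinuousAt (fun t : ℝ =>
          σ ^ α * (1 + |Real.tan (Real.pi * α / 2)|) * |t| ^ α) 0 :=
        (continuousAt_const.mul
          (continuous_abs.continuousAt.rpow_const (Or.inr (by linarith))))
      have h := this.tendsto
      simpa [Real.zero_rpow (by linarith : α ≠ 0)] using h
    have hc : ContinuousAt (fun t => stableExponent α σ b t) 0 := by
      rw [ContinuousAt, h0]; exact this
    exact hc.neg.cexp
  rw [isTightMeasureSet_iff_tendsto_measure_norm_gt] at htight
  obtain ⟨M, hM, hM0⟩ := ((htight.eventually (gt_mem_nhds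
    (show (0 : ENNReal) < ENNReal.ofReal (1 / 8) by simp))).and (eventually_gt_atTop 0)).exists
  -- for `|t| ≤ 1 / (4 M)` the integrand is at most `1 / 4` on `[-M, M]`, and `2` elsewhere
  refine ⟨a, 1 / (4 * M), by positivity, fun n t ht => ?_, fun t => by simpa only [hcf] using hconv t⟩
  rw [← hcf]
  have hmass : (ν n).real {x | M < ‖x‖} ≤ 1 / 8 := by
    have h1 : ν n {x | M < ‖x‖} ≤ ENNReal.ofReal (1 / 8) :=
      (le_iSup₂ (f := fun μ (_ : μ ∈ range ν) => μ {x : ℝ | M < ‖x‖}) (ν n)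
        (mem_range_self n)).trans hM.le
    exact ENNReal.toReal_le_of_le_ofReal (by norm_num) h1
  have hbd : ∀ x : ℝ, ‖(1 : ℂ) - Complex.exp (t * x * Complex.I)‖ ≤
      1 / 4 + {x : ℝ | M < ‖x‖}.indicator (fun _ => 2) x := by
    intro x
    by_cases hx : M < ‖x‖
    · rw [indicator_of_mem (by exact hx)]
      refine (norm_sub_le _ _).trans ?_
      rw [← Complex.ofReal_mul, Complex.norm_exp_ofReal_mul_I]
      norm_num
    · rw [indicator_of_notMem (by exact hx), norm_sub_rev, ← Complex.ofReal_mul,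
        mul_comm _ Complex.I]
      refine Real.norm_exp_I_mul_ofReal_sub_one_le.trans ?_
      rw [norm_mul, add_zero, Real.norm_eq_abs]
      calc |t| * ‖x‖ ≤ 1 / (4 * M) * M := by gcongr; exact not_lt.1 hx
        _ = 1 / 4 := by field_simp
  have hms : MeasurableSet {x : ℝ | M < ‖x‖} := measurableSet_lt measurable_const measurable_norm
  calc ‖1 - charFun (ν n) t‖ = ‖∫ x, (1 - Complex.exp (t * x * Complex.I)) ∂(ν n)‖ := by
        rw [integral_sub (by simp), integral_const, charFun_apply_real]
        · simp
        · refine Integrable.of_bound (by fun_prop) 1 (ae_of_all _ fun x => ?_)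
          rw [← Complex.ofReal_mul, Complex.norm_exp_ofReal_mul_I]
    _ ≤ ∫ x, (1 / 4 + {x : ℝ | M < ‖x‖}.indicator (fun _ => (2 : ℝ)) x) ∂(ν n) :=
        norm_integral_le_of_norm_le
          ((integrable_const _).add ((integrable_const _).indicator hms)) (ae_of_all _ hbd)
    _ = 1 / 4 + (ν n).real {x | M < ‖x‖} * 2 := by
        rw [integral_add (by simp) ((integrable_const _).indicator hms), integral_const,
          integral_indicator_const _ hms]
        simp
    _ ≤ 1 / 2 := by linarith

end

section

/-! ### Moment bounds for the normal domain of attraction -/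

lemma one_sub_norm_charFun_sq (G : Measure ℝ) [IsProbabilityMeasure G] (u : ℝ) :
    1 - ‖charFun G u‖ ^ 2 = ∫ z : ℝ × ℝ, (1 - Real.cos (u * (z.1 - z.2))) ∂(G.prod G) := by
  have hint : Integrable (fun z : ℝ × ℝ =>
      Complex.exp (u * z.1 * Complex.I) * Complex.exp (-(u * z.2 * Complex.I))) (G.prod G) := by
    refine Integrable.of_bound (by fun_prop) 1 (ae_of_all _ fun z => ?_)
    rw [← Complex.exp_add]
    have : (u * z.1 * Complex.I + -(u * z.2 * Complex.I) : ℂ) =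
        ((u * (z.1 - z.2) : ℝ) : ℂ) * Complex.I := by push_cast; ring
    rw [this, Complex.norm_exp_ofReal_mul_I]
  have h1 : ((‖charFun G u‖ ^ 2 : ℝ) : ℂ) = ∫ z : ℝ × ℝ,
      Complex.exp (u * z.1 * Complex.I) * Complex.exp (-(u * z.2 * Complex.I)) ∂(G.prod G) := by
    rw [integral_prod_mul (fun x : ℝ => Complex.exp (u * x * Complex.I))
      (fun y : ℝ => Complex.exp (-(u * y * Complex.I)))]
    have h2 : ∫ y : ℝ, Complex.exp (-(u * y * Complex.I)) ∂G = charFun G (-u) := by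
      rw [charFun_apply_real]; congr with y; push_cast; ring_nf
    rw [h2, charFun_neg, ← charFun_apply_real, Complex.mul_conj, Complex.normSq_eq_norm_sq]
  have h3 : ‖charFun G u‖ ^ 2 = ∫ z : ℝ × ℝ, Real.cos (u * (z.1 - z.2)) ∂(G.prod G) := by
    rw [← Complex.ofReal_re (‖charFun G u‖ ^ 2), h1, ← RCLike.re_eq_complex_re, ← integral_re hint]
    congr with z
    rw [← Complex.exp_add, RCLike.re_eq_complex_re,
      show (u * z.1 * Complex.I + -(u * z.2 * Complex.I) : ℂ) =
        ((u * (z.1 - z.2) : ℝ) : ℂ) * Complex.I by push_cast; ring,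
      Complex.exp_ofReal_mul_I_re]
  rw [h3, integral_sub (by simp)]
  · simp
  · exact Integrable.of_bound (by fun_prop) 1 (ae_of_all _ fun z => Real.abs_cos_le_one _)

/-- For `0 < u ≤ t₀` the integer `n = ⌊(t₀ / u)^α⌋` satisfies `u ≤ t₀ n^{-1/α}` with
`n` comparable to `(t₀ / u)^α`. -/
lemma floor_rpow_spec {α u t₀ : ℝ} (hα : 0 < α) (hu : 0 < u) (hut : u ≤ t₀) :
    1 ≤ ⌊(t₀ / u) ^ α⌋₊ ∧ u * (⌊(t₀ / u) ^ α⌋₊ : ℝ) ^ (1 / α) ≤ t₀ ∧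
      (t₀ / u) ^ α ≤ 2 * ⌊(t₀ / u) ^ α⌋₊ := by
  have h1 : (1 : ℝ) ≤ (t₀ / u) ^ α := Real.one_le_rpow ((one_le_div hu).2 hut) hα.le
  have h2 : 1 ≤ ⌊(t₀ / u) ^ α⌋₊ := Nat.le_floor (by simpa using h1)
  refine ⟨h2, ?_, ?_⟩
  · have h0 : 0 ≤ t₀ / u := by have := hu.trans_le hut; positivity
    have h3 : (⌊(t₀ / u) ^ α⌋₊ : ℝ) ^ (1 / α) ≤ t₀ / u := by
      calc _ ≤ ((t₀ / u) ^ α) ^ (1 / α) := by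
            gcongr; exact Nat.floor_le (by positivity)
        _ = t₀ / u := by rw [one_div, Real.rpow_rpow_inv h0 hα.ne']
    calc _ ≤ u * (t₀ / u) := by gcongr
      _ = t₀ := by field_simp
  · have h3 := (Nat.lt_floor_add_one ((t₀ / u) ^ α)).le
    have h4 : (1 : ℝ) ≤ (⌊(t₀ / u) ^ α⌋₊ : ℝ) := by exact_mod_cast h2
    linarith

/-- The modulus of the characteristic function is `1 - O(|u|^α)`. The lower bound
`‖φ(t n^{-1/α})‖ ^ n ≥ 1/2` on a fixed interval of `t`, valid for every `n` by tightness, is read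
at the integer `n` for which `u` falls in that interval. -/
lemma exists_one_sub_norm_charFun_sq_le {α σ b : ℝ} {G : Measure ℝ} [IsProbabilityMeasure G]
    (hα : 1 < α) (hσ : 0 < σ) (hb : b ∈ Icc (-1 : ℝ) 1)
    (hG : NormalDomainOfAttraction α σ b G) :
    ∃ C : ℝ, 0 < C ∧ ∀ u : ℝ, 1 - ‖charFun G u‖ ^ 2 ≤ C * |u| ^ α := by
  obtain ⟨a, t₀, ht₀, hbd, -⟩ := hG.exists_charFun hα hσ hb
  have hpos : ∀ u, 0 < u → 1 - ‖charFun G u‖ ^ 2 ≤ 4 / t₀ ^ α * u ^ α := by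
    intro u hu
    rcases le_or_gt u t₀ with hut | hut
    · obtain ⟨hn1, hn2, hn3⟩ := floor_rpow_spec (α := α) (by linarith) hu hut
      set n := ⌊(t₀ / u) ^ α⌋₊
      have hn0 : (0 : ℝ) < n := by exact_mod_cast hn1
      have hnp : (0 : ℝ) < (n : ℝ) ^ (1 / α) := by positivity
      have hb1 := hbd n (u * (n : ℝ) ^ (1 / α)) (by rw [abs_of_pos (by positivity)]; exact hn2)
      rw [mul_div_cancel_right₀ _ hnp.ne'] at hb1
      set z := charFun G u
      have hz : 1 / 2 ≤ ‖z‖ ^ n := by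
        have h1 : ‖z ^ n * Complex.exp (a n * (u * (n : ℝ) ^ (1 / α) : ℝ) * Complex.I)‖ = ‖z‖ ^ n := by
          rw [norm_mul, ← Complex.ofReal_mul, Complex.norm_exp_ofReal_mul_I, norm_pow, mul_one]
        have h2 := norm_sub_norm_le (1 : ℂ)
          (z ^ n * Complex.exp (a n * (u * (n : ℝ) ^ (1 / α) : ℝ) * Complex.I))
        rw [norm_one, h1] at h2
        linarith
      -- `‖z‖ ^ (2 n) ≤ exp (- n (1 - ‖z‖²))` bounds `n (1 - ‖z‖²)`
      have h4 : (1 : ℝ) / 4 ≤ (‖z‖ ^ 2) ^ n := by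
        rw [← pow_mul, mul_comm, pow_mul]; nlinarith
      have h5 : (‖z‖ ^ 2) ^ n ≤ Real.exp (-(n * (1 - ‖z‖ ^ 2))) := by
        rw [show -(n * (1 - ‖z‖ ^ 2)) = n * (‖z‖ ^ 2 - 1) by ring, Real.exp_nat_mul]
        gcongr
        linarith [Real.add_one_le_exp (‖z‖ ^ 2 - 1)]
      have h6 : n * (1 - ‖z‖ ^ 2) ≤ 2 := by
        by_contra! hcon
        have : Real.exp (-(n * (1 - ‖z‖ ^ 2))) < Real.exp (-2) := Real.exp_lt_exp.2 (by linarith)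
        have h7 : Real.exp (-2) < 1 / 4 := by
          rw [Real.exp_neg, show (2 : ℝ) = 1 + 1 by norm_num, Real.exp_add, inv_eq_one_div]
          gcongr
          nlinarith [Real.exp_one_gt_d9]
        linarith
      have h8 : 1 - ‖z‖ ^ 2 ≤ 2 / n := by rw [le_div_iff₀ hn0]; linarith
      refine h8.trans ?_
      rw [Real.div_rpow ht₀.le hu.le] at hn3
      have hu' : 0 < u ^ α := by positivity
      have ht' : 0 < t₀ ^ α := by positivity
      rw [div_le_iff₀ hu'] at hn3
      rw [div_mul_eq_mul_div, div_le_div_iff₀ hn0 ht']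
      linarith
    · have h1 : t₀ ^ α ≤ u ^ α := Real.rpow_le_rpow ht₀.le hut.le (by linarith)
      have ht' : 0 < t₀ ^ α := by positivity
      have h2 : 1 ≤ 4 / t₀ ^ α * u ^ α := by
        rw [div_mul_eq_mul_div, le_div_iff₀ ht']; linarith
      linarith [sq_nonneg ‖charFun G u‖]
  refine ⟨4 / t₀ ^ α, by positivity, fun u => ?_⟩
  rcases lt_trichotomy u 0 with hu | rfl | hu
  · have := hpos (-u) (by linarith)
    rw [charFun_neg, RCLike.norm_conj] at this
    rwa [abs_of_neg hu]
  · simp [Real.zero_rpow (by linarith : α ≠ 0)]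
  · rw [abs_of_pos hu]; exact hpos u hu

/-- For independent `X`, `X'` of law `G`, `E (1 - cos (s u (X - X')))` is `O((s |u|)^α)`, and
`s^{α-2}` is integrable on `(0, 1]`. -/
lemma exists_lintegral_truncSq_sub_le {α : ℝ} {G : Measure ℝ} [IsProbabilityMeasure G]
    (hα : 1 < α) (hG : ∃ C : ℝ, 0 < C ∧ ∀ u : ℝ, 1 - ‖charFun G u‖ ^ 2 ≤ C * |u| ^ α) :
    ∃ C : ℝ, 0 < C ∧ ∀ u : ℝ, ∫⁻ z : ℝ × ℝ, ENNReal.ofReal (truncSq (u * (z.1 - z.2)))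
      ∂(G.prod G) ≤ ENNReal.ofReal (C * |u| ^ α) := by
  obtain ⟨C, hC, hbd⟩ := hG
  have hα1 : 0 < α - 1 := by linarith
  refine ⟨5 * (C * (1 / (α - 1))), by positivity, fun u => ?_⟩
  have hpow : ∫⁻ s in Ioc (0 : ℝ) 1, ENNReal.ofReal (s ^ (α - 2)) =
      ENNReal.ofReal (1 / (α - 1)) := by
    rw [← ofReal_integral_eq_lintegral_ofReal]
    · rw [← intervalIntegral.integral_of_le zero_le_one, integral_rpow (Or.inl (by linarith))]
      rw [Real.zero_rpow (by linarith)]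
      simp; ring_nf
    · exact (intervalIntegrable_iff_integrableOn_Ioc_of_le zero_le_one).1
        (intervalIntegral.intervalIntegrable_rpow' (by linarith))
    · exact (ae_restrict_iff' measurableSet_Ioc).2 (ae_of_all _ fun s hs => by
        have := hs.1; positivity)
  calc ∫⁻ z : ℝ × ℝ, ENNReal.ofReal (truncSq (u * (z.1 - z.2))) ∂(G.prod G)
      ≤ ∫⁻ z : ℝ × ℝ, (5 * ∫⁻ s in Ioc (0 : ℝ) 1,
          ENNReal.ofReal ((1 - Real.cos (s * (u * (z.1 - z.2)))) / s ^ 2)) ∂(G.prod G) :=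
        lintegral_mono fun z => truncSq_le_lintegral_one_sub_cos _
    _ = 5 * ∫⁻ s in Ioc (0 : ℝ) 1, ∫⁻ z : ℝ × ℝ,
          ENNReal.ofReal ((1 - Real.cos (s * (u * (z.1 - z.2)))) / s ^ 2) ∂(G.prod G) := by
        rw [lintegral_const_mul' _ _ (by simp), lintegral_lintegral_swap]
        exact Measurable.aemeasurable (by fun_prop)
    _ ≤ 5 * ∫⁻ s in Ioc (0 : ℝ) 1, ENNReal.ofReal (C * |u| ^ α) * ENNReal.ofReal (s ^ (α - 2)) := by
        gcongr 5 * ?_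
        refine setLIntegral_mono' measurableSet_Ioc fun s hs => ?_
        have hs0 := hs.1
        rw [← ENNReal.ofReal_mul (by positivity), ← ofReal_integral_eq_lintegral_ofReal]
        · apply ENNReal.ofReal_le_ofReal
          have h1 := one_sub_norm_charFun_sq G (s * u)
          simp_rw [← mul_assoc]
          rw [integral_div, ← h1]
          have h2 := hbd (s * u)
          rw [abs_mul, abs_of_pos hs0, Real.mul_rpow hs0.le (abs_nonneg u)] at h2
          rw [div_le_iff₀ (by positivity), Real.rpow_sub hs0, Real.rpow_two]
          calc _ ≤ _ := h2
            _ = _ := by field_simp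
        · refine Integrable.div_const (Integrable.of_bound (by fun_prop) 2
            (ae_of_all _ fun z => ?_)) _
          rw [Real.norm_eq_abs, abs_le]
          constructor <;>
            linarith [Real.cos_le_one (s * (u * (z.1 - z.2))),
              Real.neg_one_le_cos (s * (u * (z.1 - z.2)))]
        · exact ae_of_all _ fun z => div_nonneg (by linarith [Real.cos_le_one (s * (u * (z.1 - z.2)))])
            (sq_nonneg s)
    _ = ENNReal.ofReal (5 * (C * (1 / (α - 1))) * |u| ^ α) := by
        rw [lintegral_const_mul' _ _ (by simp), hpow, ← ENNReal.ofReal_mul (by positivity),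
          show (5 : ENNReal) = ENNReal.ofReal 5 by simp, ← ENNReal.ofReal_mul (by norm_num)]
        congr 1; ring

/-- Desymmetrization: since the second copy is bounded by some `M` with probability at least
`1 / 2`, moment bounds for `X - X'` pass to `X`. -/
lemma exists_lintegral_truncSq_le_of_sub {α : ℝ} {G : Measure ℝ} [IsProbabilityMeasure G]
    (hα : 1 < α) (hα2 : α ≤ 2)
    (hG : ∃ C : ℝ, 0 < C ∧ ∀ u : ℝ, ∫⁻ z : ℝ × ℝ, ENNReal.ofReal (truncSq (u * (z.1 - z.2)))
      ∂(G.prod G) ≤ ENNReal.ofReal (C * |u| ^ α)) :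
    ∃ C : ℝ, 0 < C ∧ ∀ u : ℝ, ∫⁻ x, ENNReal.ofReal (truncSq (x * u)) ∂G ≤
      ENNReal.ofReal (C * |u| ^ α) := by
  obtain ⟨C, hC, hbd⟩ := hG
  have hmeas : ∀ u : ℝ, Measurable fun x : ℝ => ENNReal.ofReal (truncSq (x * u)) := fun u =>
    (measurable_truncSq.comp (measurable_id.mul_const u)).ennreal_ofReal
  have hmeas2 : ∀ u : ℝ, Measurable fun z : ℝ × ℝ => ENNReal.ofReal (truncSq (u * (z.1 - z.2))) :=
    fun u => (measurable_truncSq.comp (by fun_prop)).ennreal_ofReal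
  obtain ⟨M, hM1, hM⟩ : ∃ M : ℝ, 1 ≤ M ∧ 1 / 2 ≤ G {y | |y| ≤ M} := by
    have hmono : Monotone fun n : ℕ => {y : ℝ | |y| ≤ n} := by
      intro m n hmn y hy
      exact le_trans (show |y| ≤ m from hy) (by exact_mod_cast hmn)
    have h := tendsto_measure_iUnion_atTop (μ := G) hmono
    have hu : (⋃ n : ℕ, {y : ℝ | |y| ≤ n}) = univ := by
      ext y; simpa using exists_nat_ge |y|
    rw [hu, measure_univ] at h
    obtain ⟨n, hn, hn1⟩ := ((h.eventually (lt_mem_nhds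
      (show (1 / 2 : ENNReal) < 1 by simp))).and (eventually_ge_atTop 1)).exists
    exact ⟨n, by exact_mod_cast hn1, hn.le⟩
  have hsmall : ∀ u : ℝ, |u| ≤ 1 → ∫⁻ x, ENNReal.ofReal (truncSq (x * u)) ∂G ≤
      ENNReal.ofReal (8 * (C + M ^ 2) * |u| ^ α) := by
    intro u hu
    set A : Set ℝ := {y | |y| ≤ M}
    have hA : MeasurableSet A := measurableSet_le measurable_norm measurable_const
    have hu2 : u ^ 2 ≤ |u| ^ α := sq_le_abs_rpow (by linarith) hα2 hu
    have h1 : G A * ∫⁻ x, ENNReal.ofReal (truncSq (x * u)) ∂G ≤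
        ENNReal.ofReal (4 * (C + M ^ 2) * |u| ^ α) := by
      calc G A * ∫⁻ x, ENNReal.ofReal (truncSq (x * u)) ∂G
          = ∫⁻ _ in A, ∫⁻ x, ENNReal.ofReal (truncSq (x * u)) ∂G ∂G := by
            rw [setLIntegral_const, mul_comm]
        _ ≤ ∫⁻ y in A, ∫⁻ x, (4 * ENNReal.ofReal (truncSq (u * (x - y))) +
              ENNReal.ofReal (4 * M ^ 2 * |u| ^ α)) ∂G ∂G := by
            refine setLIntegral_mono' hA fun y hy => lintegral_mono fun x => ?_
            rw [show (4 : ENNReal) = ENNReal.ofReal 4 by simp, ← ENNReal.ofReal_mul (by norm_num),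
              ← ENNReal.ofReal_add (mul_nonneg (by norm_num) (truncSq_nonneg _)) (by positivity)]
            apply ENNReal.ofReal_le_ofReal
            have h2 := truncSq_le_four_mul_add (u * (x - y)) (u * y)
            rw [show u * (x - y) + u * y = x * u by ring] at h2
            have h3 : truncSq (u * y) ≤ M ^ 2 * |u| ^ α := by
              refine (min_le_left _ _).trans ?_
              rw [mul_pow, mul_comm, ← sq_abs y]
              gcongr
              exact hy
            linarith
        _ ≤ ∫⁻ y, ∫⁻ x, (4 * ENNReal.ofReal (truncSq (u * (x - y))) +
              ENNReal.ofReal (4 * M ^ 2 * |u| ^ α)) ∂G ∂G := setLIntegral_le_lintegral _ _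
        _ = 4 * (∫⁻ z : ℝ × ℝ, ENNReal.ofReal (truncSq (u * (z.1 - z.2))) ∂(G.prod G)) +
              ENNReal.ofReal (4 * M ^ 2 * |u| ^ α) := by
            rw [lintegral_prod_symm _ (hmeas2 u).aemeasurable]
            have : ∀ y, ∫⁻ x, (4 * ENNReal.ofReal (truncSq (u * (x - y))) +
                ENNReal.ofReal (4 * M ^ 2 * |u| ^ α)) ∂G =
                4 * (∫⁻ x, ENNReal.ofReal (truncSq (u * (x - y))) ∂G) +
                  ENNReal.ofReal (4 * M ^ 2 * |u| ^ α) := by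
              intro y
              rw [lintegral_add_right _ measurable_const, lintegral_const_mul' _ _ (by simp)]
              simp
            simp_rw [this]
            rw [lintegral_add_right _ measurable_const, lintegral_const_mul' _ _ (by simp)]
            simp
        _ ≤ 4 * ENNReal.ofReal (C * |u| ^ α) + ENNReal.ofReal (4 * M ^ 2 * |u| ^ α) := by
            gcongr; exact hbd u
        _ = _ := by
            rw [show (4 : ENNReal) = ENNReal.ofReal 4 by simp, ← ENNReal.ofReal_mul (by norm_num),
              ← ENNReal.ofReal_add (by positivity) (by positivity)]
            congr 1; ring
    calc ∫⁻ x, ENNReal.ofReal (truncSq (x * u)) ∂G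
        = 2 * ((1 / 2) * ∫⁻ x, ENNReal.ofReal (truncSq (x * u)) ∂G) := by
          rw [← mul_assoc, one_div, ENNReal.mul_inv_cancel (by simp) (by simp), one_mul]
      _ ≤ 2 * (G A * ∫⁻ x, ENNReal.ofReal (truncSq (x * u)) ∂G) := by gcongr
      _ ≤ 2 * ENNReal.ofReal (4 * (C + M ^ 2) * |u| ^ α) := by gcongr
      _ = _ := by
          rw [show (2 : ENNReal) = ENNReal.ofReal 2 by simp, ← ENNReal.ofReal_mul (by norm_num)]
          congr 1; ring
  refine ⟨1 + 8 * (C + M ^ 2), by positivity, fun u => ?_⟩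
  rcases le_or_gt |u| 1 with hu | hu
  · refine (hsmall u hu).trans (ENNReal.ofReal_le_ofReal ?_)
    gcongr; linarith
  · -- for large `u` compare with `u = 1` through `|x u| ≤ |u|^α (1 + truncSq x)`
    have h1 := hsmall 1 (by simp)
    simp only [abs_one, Real.one_rpow, mul_one] at h1
    have hu1 : |u| ≤ |u| ^ α := Real.self_le_rpow_of_one_le hu.le hα.le
    calc ∫⁻ x, ENNReal.ofReal (truncSq (x * u)) ∂G
        ≤ ∫⁻ x, ENNReal.ofReal (|u| ^ α) * (1 + ENNReal.ofReal (truncSq x)) ∂G := by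
          refine lintegral_mono fun x => ?_
          rw [← ENNReal.ofReal_one, ← ENNReal.ofReal_add zero_le_one (truncSq_nonneg x),
            ← ENNReal.ofReal_mul (by positivity)]
          apply ENNReal.ofReal_le_ofReal
          refine (min_le_right _ _).trans ?_
          rw [abs_mul, mul_comm]
          have hx := abs_le_one_add_truncSq x
          gcongr
      _ = ENNReal.ofReal (|u| ^ α) * (1 + ∫⁻ x, ENNReal.ofReal (truncSq x) ∂G) := by
          rw [lintegral_const_mul' _ _ (by simp),
            lintegral_add_left measurable_const]
          simp
      _ ≤ ENNReal.ofReal (|u| ^ α) * (1 + ENNReal.ofReal (8 * (C + M ^ 2))) := by gcongr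
      _ = _ := by
          rw [← ENNReal.ofReal_one, ← ENNReal.ofReal_add zero_le_one (by positivity),
            ← ENNReal.ofReal_mul (by positivity)]
          congr 1; ring

lemma NormalDomainOfAttraction.exists_lintegral_truncSq_le {α σ b : ℝ} {G : Measure ℝ}
    [IsProbabilityMeasure G] (hα : 1 < α) (hα2 : α ≤ 2) (hσ : 0 < σ) (hb : b ∈ Icc (-1 : ℝ) 1)
    (hG : NormalDomainOfAttraction α σ b G) :
    ∃ C : ℝ, 0 < C ∧ ∀ u : ℝ, ∫⁻ x, ENNReal.ofReal (truncSq (x * u)) ∂G ≤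
      ENNReal.ofReal (C * |u| ^ α) :=
  exists_lintegral_truncSq_le_of_sub hα hα2 (exists_lintegral_truncSq_sub_le hα
    (exists_one_sub_norm_charFun_sq_le hα hσ hb hG))

end

section

/-! ### Bounds for `ψ_G` -/

/-- The law `G` satisfies `E min ((u X)², |u X|) ≤ C |u|^α` for all `u`. -/
def TruncSqBound (α C : ℝ) (G : Measure ℝ) : Prop :=
  0 < C ∧ ∀ u : ℝ, ∫⁻ x, ENNReal.ofReal (truncSq (x * u)) ∂G ≤ ENNReal.ofReal (C * |u| ^ α)

section TruncSqBound

variable {α C : ℝ} {G : Measure ℝ}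

lemma TruncSqBound.integrable (h : TruncSqBound α C G) (u : ℝ) :
    Integrable (fun x => truncSq (x * u)) G := by
  refine ⟨(measurable_truncSq.comp (measurable_id.mul_const u)).aestronglyMeasurable, ?_⟩
  rw [hasFiniteIntegral_iff_ofReal (ae_of_all _ fun x => truncSq_nonneg _)]
  exact (h.2 u).trans_lt ENNReal.ofReal_lt_top

lemma TruncSqBound.integral_le (h : TruncSqBound α C G) (u : ℝ) :
    ∫ x, truncSq (x * u) ∂G ≤ C * |u| ^ α := by
  rw [integral_eq_lintegral_of_nonneg_ae (ae_of_all _ fun x => truncSq_nonneg _)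
    (h.integrable u).aestronglyMeasurable]
  have := h.1
  exact ENNReal.toReal_le_of_le_ofReal (by positivity) (h.2 u)

lemma TruncSqBound.integrable_id [IsProbabilityMeasure G] (h : TruncSqBound α C G) :
    Integrable (fun x : ℝ => x) G := by
  refine ((integrable_const (1 : ℝ)).add (h.integrable 1)).mono' (by fun_prop)
    (ae_of_all _ fun x => ?_)
  simpa only [mul_one, Pi.add_apply, Real.norm_eq_abs] using abs_le_one_add_truncSq x

lemma TruncSqBound.integrable_psi (h : TruncSqBound α C G) (u : ℝ) :
    Integrable (fun x : ℝ => psi (x * u)) G := by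
  refine ((h.integrable u).const_mul 2).mono'
    (continuous_psi.comp (by fun_prop)).aestronglyMeasurable (ae_of_all _ fun x => norm_psi_le _)

lemma TruncSqBound.norm_psiG_le (h : TruncSqBound α C G) (u : ℝ) :
    ‖psiG G u‖ ≤ 2 * C * |u| ^ α := by
  calc ‖psiG G u‖ ≤ ∫ x, 2 * truncSq (x * u) ∂G :=
        norm_integral_le_of_norm_le ((h.integrable u).const_mul 2) (ae_of_all _ fun x => norm_psi_le _)
    _ ≤ _ := by
      rw [integral_const_mul, mul_assoc]
      exact mul_le_mul_of_nonneg_left (h.integral_le u) (by norm_num)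

variable [IsProbabilityMeasure G]

lemma TruncSqBound.norm_psiG_sub_le (h : TruncSqBound α C G) (u v : ℝ) :
    ‖psiG G u - psiG G v‖ ≤ 2 * (∫ x, |x| ∂G) * |u - v| := by
  rw [psiG, psiG, ← integral_sub (h.integrable_psi u) (h.integrable_psi v)]
  calc _ ≤ ∫ x, 2 * |x| * |u - v| ∂G :=
        norm_integral_le_of_norm_le ((h.integrable_id.abs.const_mul 2).mul_const _)
          (ae_of_all _ fun x => by
            refine (norm_psi_sub_le_two_mul _ _).trans (le_of_eq ?_)
            rw [← mul_sub, abs_mul, mul_assoc])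
    _ = _ := by rw [integral_mul_const, integral_const_mul]

omit [IsProbabilityMeasure G] in
/-- `ψ_G` has Lipschitz constant `O(w^{α-1})` on `[-w, w]`. -/
lemma TruncSqBound.norm_psiG_sub_le_of_abs_le (h : TruncSqBound α C G) {u v w : ℝ} (hw : 0 < w)
    (hu : |u| ≤ w) (hv : |v| ≤ w) :
    ‖psiG G u - psiG G v‖ ≤ 2 * C * w ^ (α - 1) * |u - v| := by
  rw [psiG, psiG, ← integral_sub (h.integrable_psi u) (h.integrable_psi v)]
  calc _ ≤ ∫ x, 2 * (|u - v| / w) * truncSq (x * w) ∂G :=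
        norm_integral_le_of_norm_le ((h.integrable w).const_mul _)
          (ae_of_all _ fun x => by
            have hxw : 0 ≤ |x| * w := by positivity
            refine (norm_psi_sub_le (m := |x| * w) (by rw [abs_mul]; gcongr)
              (by rw [abs_mul]; gcongr)).trans ?_
            have h1 : min (|x| * w) 2 * (|x| * w) ≤ 2 * truncSq (x * w) := by
              rw [truncSq, mul_min_of_nonneg _ _ (by norm_num), min_mul_of_nonneg _ _ hxw,
                abs_mul, abs_of_pos hw]
              refine min_le_min ?_ le_rfl
              rw [mul_pow, ← sq_abs x]
              nlinarith [mul_nonneg hxw hxw]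
            rw [← mul_sub, abs_mul]
            calc _ = (|u - v| / w) * (min (|x| * w) 2 * (|x| * w)) := by field_simp
              _ ≤ (|u - v| / w) * (2 * truncSq (x * w)) := by gcongr
              _ = _ := by ring)
    _ ≤ 2 * (|u - v| / w) * (C * w ^ α) := by
        rw [integral_const_mul]
        have := h.integral_le w
        rw [abs_of_pos hw] at this
        gcongr
    _ = _ := by rw [Real.rpow_sub_one hw.ne']; field_simp

@[simp] lemma psiG_zero (G : Measure ℝ) : psiG G 0 = 0 := by simp [psiG]

lemma TruncSqBound.continuous_psiG (h : TruncSqBound α C G) : Continuous (psiG G) := by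
  refine (LipschitzWith.of_dist_le_mul (K := (2 * ∫ x, |x| ∂G).toNNReal) fun u v => ?_).continuous
  rw [Real.coe_toNNReal _ (mul_nonneg (by norm_num) (integral_nonneg fun x => abs_nonneg x)),
    dist_eq_norm, Real.dist_eq]
  exact h.norm_psiG_sub_le u v

lemma TruncSqBound.norm_psiG_le_linear (h : TruncSqBound α C G) (u : ℝ) :
    ‖psiG G u‖ ≤ 2 * (∫ x, |x| ∂G) * |u| := by
  simpa using h.norm_psiG_sub_le u 0

omit [IsProbabilityMeasure G] in
lemma TruncSqBound.psiG_re (h : TruncSqBound α C G) (u : ℝ) :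
    (psiG G u).re = -∫ x, (1 - Real.cos (x * u)) ∂G := by
  rw [psiG, ← RCLike.re_eq_complex_re, ← integral_re (h.integrable_psi u), ← integral_neg]
  congr with x
  exact psi_re _

omit [IsProbabilityMeasure G] in
lemma TruncSqBound.psiG_re_nonpos (h : TruncSqBound α C G) (u : ℝ) : (psiG G u).re ≤ 0 := by
  rw [h.psiG_re, neg_nonpos]
  exact integral_nonneg fun x => by simpa using Real.cos_le_one (x * u)

/-- Unless `G` is the Dirac mass at `0`, the real part of `ψ_G` is negative near `0`, except
at `0`. -/
lemma TruncSqBound.exists_psiG_re_neg (h : TruncSqBound α C G) (hG : G {x | x ≠ 0} ≠ 0) :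
    ∃ δ : ℝ, 0 < δ ∧ ∀ u, u ≠ 0 → |u| < δ → (psiG G u).re < 0 := by
  obtain ⟨M, hM⟩ : ∃ M : ℕ, G {x | x ≠ 0 ∧ |x| ≤ M} ≠ 0 := by
    by_contra! hcon
    apply hG
    have : {x : ℝ | x ≠ 0} ⊆ ⋃ M : ℕ, {x | x ≠ 0 ∧ |x| ≤ M} := by
      intro x hx
      obtain ⟨M, hM⟩ := exists_nat_ge |x|
      exact mem_iUnion.2 ⟨M, hx, hM⟩
    exact measure_mono_null this (measure_iUnion_null hcon)
  refine ⟨1 / (M + 1), by positivity, fun u hu hud => lt_of_le_of_ne (h.psiG_re_nonpos u) ?_⟩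
  intro h0
  rw [h.psiG_re, neg_eq_zero, integral_eq_zero_iff_of_nonneg] at h0
  · apply hM
    refine measure_mono_null (fun x hx => ?_) h0
    simp only [Pi.zero_apply, mem_compl_iff, mem_ofPred_eq]
    intro hcos
    have hxu : |x * u| < 1 := by
      rw [abs_mul]
      rw [lt_div_iff₀ (by positivity)] at hud
      have := hx.2
      nlinarith [abs_nonneg x, abs_nonneg u, abs_pos.2 hu]
    rw [abs_lt] at hxu
    have := (Real.cos_eq_one_iff_of_lt_of_lt (by linarith [Real.pi_gt_three])
      (by linarith [Real.pi_gt_three])).1 (sub_eq_zero.1 hcos).symm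
    exact (mul_ne_zero hx.1 hu) this
  · intro x
    simpa using Real.cos_le_one (x * u)
  · exact (integrable_const 1).sub
      (Integrable.of_bound (by fun_prop) 1 (ae_of_all _ fun x => Real.abs_cos_le_one _))

/-! ### Centred characteristic functions -/

/-- The characteristic function of `G` centred at its mean. -/
noncomputable def centeredCharFun (G : Measure ℝ) (u : ℝ) : ℂ :=
  Complex.exp (-((u * ∫ x, x ∂G : ℝ) : ℂ) * Complex.I) * charFun G u

lemma norm_centeredCharFun_le_one (G : Measure ℝ) [IsProbabilityMeasure G] (u : ℝ) :
    ‖centeredCharFun G u‖ ≤ 1 := by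
  rw [centeredCharFun, norm_mul, ← Complex.ofReal_neg, Complex.norm_exp_ofReal_mul_I, one_mul]
  exact norm_charFun_le_one u

lemma TruncSqBound.psiG_eq (h : TruncSqBound α C G) (u : ℝ) :
    psiG G u = charFun G u - 1 - Complex.I * ((u * ∫ x, x ∂G : ℝ) : ℂ) := by
  have h1 : Integrable (fun x : ℝ => Complex.exp (u * x * Complex.I)) G := by
    refine Integrable.of_bound (by fun_prop) 1 (ae_of_all _ fun x => ?_)
    rw [← Complex.ofReal_mul, Complex.norm_exp_ofReal_mul_I]
  have h2 : Integrable (fun x : ℝ => Complex.I * ((u * x : ℝ) : ℂ)) G :=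
    ((h.integrable_id.const_mul u).ofReal).const_mul _
  have h3 : ∀ x : ℝ, psi (x * u) =
      Complex.exp (u * x * Complex.I) - 1 - Complex.I * ((u * x : ℝ) : ℂ) := by
    intro x
    rw [psi]; push_cast
    rw [show Complex.I * (x * u : ℂ) = u * x * Complex.I by ring]
    ring
  simp_rw [psiG, h3]
  have h4 : Integrable (fun x : ℝ => Complex.exp (u * x * Complex.I) - 1) G :=
    h1.sub (integrable_const 1)
  rw [integral_sub h4 h2, integral_sub h1 (integrable_const 1),
    ← charFun_apply_real, integral_const_mul, integral_complex_ofReal, integral_const_mul]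
  simp

lemma TruncSqBound.centeredCharFun_sub_one (h : TruncSqBound α C G) (u : ℝ) :
    centeredCharFun G u - 1 = Complex.exp (-((u * ∫ x, x ∂G : ℝ) : ℂ) * Complex.I) *
      (psiG G u - psi (u * ∫ x, x ∂G)) := by
  rw [h.psiG_eq, psi, centeredCharFun]
  set m : ℂ := ((u * ∫ x, x ∂G : ℝ) : ℂ)
  have : Complex.exp (-m * Complex.I) * Complex.exp (Complex.I * m) = 1 := by
    rw [← Complex.exp_add, show -m * Complex.I + Complex.I * m = 0 by ring, Complex.exp_zero]
  linear_combination this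

lemma TruncSqBound.exists_norm_centeredCharFun_sub_one_le (h : TruncSqBound α C G)
    (hα : 1 < α) (hα2 : α ≤ 2) :
    ∃ K : ℝ, 0 < K ∧ ∀ u, |u| ≤ 1 → ‖centeredCharFun G u - 1‖ ≤ K * |u| ^ α := by
  have hC := h.1
  refine ⟨2 * C + 2 * (∫ x, x ∂G) ^ 2, by positivity, fun u hu => ?_⟩
  rw [h.centeredCharFun_sub_one, norm_mul, ← Complex.ofReal_neg, Complex.norm_exp_ofReal_mul_I,
    one_mul]
  refine (norm_sub_le _ _).trans ?_
  have h1 := h.norm_psiG_le u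
  have h2 := norm_psi_le_two_mul_sq (u * ∫ x, x ∂G)
  have hu2 : u ^ 2 ≤ |u| ^ α := sq_le_abs_rpow (by linarith) hα2 hu
  have h3 : 2 * (u * ∫ x, x ∂G) ^ 2 ≤ 2 * (∫ x, x ∂G) ^ 2 * |u| ^ α := by
    rw [mul_pow]
    nlinarith [sq_nonneg (∫ x, x ∂G)]
  linarith

lemma norm_pow_sub_one_le {z : ℂ} (hz : ‖z‖ ≤ 1) (n : ℕ) : ‖z ^ n - 1‖ ≤ n * ‖z - 1‖ := by
  induction n with
  | zero => simp
  | succ n ih =>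
    have : z ^ (n + 1) - 1 = z ^ n * (z - 1) + (z ^ n - 1) := by ring
    rw [this]
    refine (norm_add_le _ _).trans ?_
    have h1 : ‖z ^ n‖ ≤ 1 := by rw [norm_pow]; exact pow_le_one₀ (norm_nonneg _) hz
    rw [norm_mul]; push_cast
    nlinarith [norm_nonneg (z - 1)]

lemma abs_div_rpow_inv {α : ℝ} (hα : 1 < α) {n : ℕ} (hn : 1 ≤ n) (t : ℝ) :
    |t / (n : ℝ) ^ (1 / α)| ≤ |t| ∧ (n : ℝ) * |t / (n : ℝ) ^ (1 / α)| ^ α = |t| ^ α := by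
  have hn0 : (0 : ℝ) < n := by exact_mod_cast hn
  have hp : (0 : ℝ) < (n : ℝ) ^ (1 / α) := by positivity
  rw [abs_div, abs_of_pos hp]
  constructor
  · refine div_le_self (abs_nonneg t) (Real.one_le_rpow (by exact_mod_cast hn) (by positivity))
  · rw [Real.div_rpow (abs_nonneg t) hp.le, one_div, Real.rpow_inv_rpow hn0.le (by linarith)]
    field_simp

/-- The centering constants `c n` are negligible once the summands are centred at their mean.
Boundedness of `c n` comes from tightness; then `|exp (i c n t) - 1| = O(|t|^α)` up to `o(1)` with
`α > 1` leaves no room for a nonzero limit point. -/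
lemma tendsto_zero_of_centering {α K T t₀ : ℝ} (hα : 1 < α) (hK : 0 < K)
    (ht₀ : 0 < t₀)
    {z : ℝ → ℕ → ℂ} {c : ℕ → ℝ} {ω : ℝ → ℂ} (hω : ∀ t, ‖ω t‖ ≤ T * |t| ^ α)
    (hz : ∀ n : ℕ, 1 ≤ n → ∀ t, |t| ≤ 1 → ‖z t n - 1‖ ≤ K * |t| ^ α)
    (hbd : ∀ n : ℕ, ∀ t, |t| ≤ t₀ → ‖1 - z t n * Complex.exp (Complex.I * (c n * t : ℝ))‖ ≤ 1 / 2)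
    (hlim : ∀ t, Tendsto (fun n => z t n * Complex.exp (Complex.I * (c n * t : ℝ))) atTop
      (𝓝 (Complex.exp (-ω t)))) :
    Tendsto c atTop (𝓝 0) := by
  have hnorm : ∀ n t, ‖Complex.exp (Complex.I * (c n * t : ℝ))‖ = 1 := fun n t => by
    rw [mul_comm, Complex.norm_exp_ofReal_mul_I]
  have htri : ∀ n t, ‖Complex.exp (Complex.I * (c n * t : ℝ)) - 1‖ ≤
      ‖z t n - 1‖ + ‖z t n * Complex.exp (Complex.I * (c n * t : ℝ)) - 1‖ := by
    intro n t
    have : Complex.exp (Complex.I * (c n * t : ℝ)) - 1 =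
        -((z t n - 1) * Complex.exp (Complex.I * (c n * t : ℝ))) +
          (z t n * Complex.exp (Complex.I * (c n * t : ℝ)) - 1) := by ring
    rw [this]
    refine (norm_add_le _ _).trans ?_
    rw [norm_neg, norm_mul, hnorm, mul_one]
  have hpow : Tendsto (fun t : ℝ => |t| ^ α) (𝓝[>] 0) (𝓝 0) := by
    have : ContinuousAt (fun t : ℝ => |t| ^ α) 0 :=
      continuous_abs.continuousAt.rpow_const (Or.inr (by linarith))
    simpa [Real.zero_rpow (by linarith : α ≠ 0)] using this.tendsto.mono_left nhdsWithin_le_nhds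
  have hpow1 : Tendsto (fun t : ℝ => t ^ (α - 1)) (𝓝[>] 0) (𝓝 0) := by
    have : ContinuousAt (fun t : ℝ => t ^ (α - 1)) 0 :=
      Real.continuousAt_rpow_const _ _ (Or.inr (by linarith))
    simpa [Real.zero_rpow (by linarith : α - 1 ≠ 0)] using
      this.tendsto.mono_left nhdsWithin_le_nhds
  -- if `|c n|` is large then `t = π / c n` is small, and there the exponential equals `-1`
  obtain ⟨R, hR0, hR⟩ : ∃ R : ℝ, 0 < R ∧ ∀ n : ℕ, 1 ≤ n → |c n| ≤ R := by
    have hlt : Tendsto (fun t : ℝ => K * |t| ^ α) (𝓝[>] 0) (𝓝 0) := by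
      simpa using hpow.const_mul K
    obtain ⟨t₁, ⟨ht₁K, ht₁0⟩, ht₁1⟩ := (((hlt.eventually (gt_mem_nhds
      (show (0 : ℝ) < 1 / 4 by norm_num))).and self_mem_nhdsWithin).and
      (nhdsWithin_le_nhds (gt_mem_nhds (show (0 : ℝ) < min 1 t₀ by positivity)))).exists
    refine ⟨Real.pi / t₁, by positivity, fun n hn => ?_⟩
    by_contra! hcon
    rw [div_lt_iff₀ ht₁0] at hcon
    have hc0 : c n ≠ 0 := by
      intro h0; rw [h0] at hcon; simp at hcon; linarith [Real.pi_pos]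
    have hc1 : 0 < |c n| := abs_pos.2 hc0
    have ht : |Real.pi / c n| ≤ t₁ := by
      rw [abs_div, abs_of_pos Real.pi_pos, div_le_iff₀ hc1]; linarith
    have h1 := htri n (Real.pi / c n)
    rw [mul_div_cancel₀ _ hc0, mul_comm, Complex.exp_pi_mul_I] at h1
    have h2 := hz n hn (Real.pi / c n) (ht.trans (ht₁1.le.trans (min_le_left _ _)))
    have h3 := hbd n (Real.pi / c n) (ht.trans (ht₁1.le.trans (min_le_right _ _)))
    rw [mul_div_cancel₀ _ hc0, mul_comm Complex.I, Complex.exp_pi_mul_I, norm_sub_rev] at h3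
    have h4 : K * |Real.pi / c n| ^ α ≤ K * |t₁| ^ α := by
      gcongr K * ?_
      refine Real.rpow_le_rpow (abs_nonneg _) ?_ (by linarith)
      rwa [abs_of_pos ht₁0]
    norm_num at h1 h3
    linarith
  -- at a small fixed `t`, `|c n| t / 2` is at most the distance of the exponential to `1`
  rw [Metric.tendsto_atTop]
  intro ε hε
  have hlt : Tendsto (fun t : ℝ => 2 * (K + 2 * T + 1) * t ^ (α - 1)) (𝓝[>] 0) (𝓝 0) := by
    simpa using hpow1.const_mul (2 * (K + 2 * T + 1))
  have hltT : Tendsto (fun t : ℝ => T * |t| ^ α) (𝓝[>] 0) (𝓝 0) := by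
    simpa using hpow.const_mul T
  obtain ⟨t, ⟨⟨htε, htT⟩, ht0⟩, ht1⟩ := (((((hlt.eventually (gt_mem_nhds hε)).and
    (hltT.eventually (gt_mem_nhds one_pos))).and self_mem_nhdsWithin)).and
      (nhdsWithin_le_nhds (gt_mem_nhds (show (0 : ℝ) < min 1 (1 / R) by positivity)))).exists
  have htα : 0 < t ^ α := by positivity
  obtain ⟨N, hN⟩ := Metric.tendsto_atTop.1 (hlim t) (t ^ α) htα
  refine ⟨max N 1, fun n hn => ?_⟩
  have hn1 : 1 ≤ n := (le_max_right _ _).trans hn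
  have h1 := htri n t
  have h2 := hz n hn1 t (by rw [abs_of_pos ht0]; exact ht1.le.trans (min_le_left _ _))
  have h3 := hN n ((le_max_left _ _).trans hn)
  rw [dist_eq_norm] at h3
  have h4 : ‖Complex.exp (-ω t) - 1‖ ≤ 2 * (T * |t| ^ α) := by
    have := Complex.norm_exp_sub_one_le (x := -ω t) (by rw [norm_neg]; exact (hω t).trans htT.le)
    rw [norm_neg] at this
    linarith [hω t]
  have h5 := norm_sub_le_norm_sub_add_norm_sub
    (z t n * Complex.exp (Complex.I * (c n * t : ℝ))) (Complex.exp (-ω t)) 1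
  have h6 : |c n * t| / 2 ≤ ‖Complex.exp (Complex.I * (c n * t : ℝ)) - 1‖ := by
    rw [Complex.norm_exp_I_mul_ofReal_sub_one, norm_mul, Real.norm_eq_abs, Real.norm_eq_abs, abs_two]
    have hct : |c n * t| ≤ 1 := by
      rw [abs_mul, abs_of_pos ht0]
      have := ht1.le.trans (min_le_right _ _)
      calc |c n| * t ≤ R * (1 / R) := by gcongr; exact hR n hn1
        _ = 1 := by field_simp
    have := Real.mul_abs_le_abs_sin (x := c n * t / 2) (by
      rw [abs_div, abs_two]; linarith [Real.pi_gt_three])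
    rw [abs_div, abs_two] at this
    have hpi : (1 : ℝ) / 2 ≤ 2 / Real.pi := by
      rw [div_le_div_iff₀ (by norm_num) Real.pi_pos]; linarith [Real.pi_lt_four]
    have h7 : 1 / 2 * (|c n * t| / 2) ≤ 2 / Real.pi * (|c n * t| / 2) := by gcongr
    linarith
  rw [abs_of_pos ht0] at h2 h4
  rw [abs_mul, abs_of_pos ht0] at h6
  have h8 : |c n| * t ≤ 2 * (K + 2 * T + 1) * t ^ α := by linarith
  rw [Real.dist_eq, sub_zero]
  refine lt_of_le_of_lt ?_ htε
  rw [Real.rpow_sub_one ht0.ne', mul_div_assoc', le_div_iff₀ ht0]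
  exact h8

/-- The smallness assumptions keep all logarithms on the principal branch. -/
lemma tendsto_nat_mul_of_tendsto_one_add_pow {w : ℕ → ℂ} {ζ : ℂ} (hζ : ‖ζ‖ ≤ 1 / 4)
    (hw : ∀ n : ℕ, 1 ≤ n → n * ‖w n‖ ≤ 1 / 2)
    (hlim : Tendsto (fun n : ℕ => (1 + w n) ^ n) atTop (𝓝 (Complex.exp ζ))) :
    Tendsto (fun n : ℕ => (n : ℂ) * w n) atTop (𝓝 ζ) := by
  have hsmall : ∀ n : ℕ, 1 ≤ n → ‖w n‖ ≤ 1 / 2 := fun n hn => by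
    have h1 : (1 : ℝ) ≤ n := by exact_mod_cast hn
    nlinarith [hw n hn, norm_nonneg (w n)]
  have herr : ∀ n : ℕ, 1 ≤ n → ‖(n : ℂ) * Complex.log (1 + w n) - n * w n‖ ≤ 1 / 4 / n := by
    intro n hn
    have h1 : (0 : ℝ) < n := by exact_mod_cast hn
    have h2 := hsmall n hn
    have h3 := Complex.norm_log_one_add_sub_self_le (z := w n) (by linarith)
    have h4 : (1 - ‖w n‖)⁻¹ ≤ 2 := by
      rw [inv_le_comm₀ (by linarith) (by norm_num)]; linarith
    rw [← mul_sub, norm_mul, Complex.norm_natCast, le_div_iff₀ h1]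
    have h5 : ‖w n‖ ^ 2 * (1 - ‖w n‖)⁻¹ / 2 ≤ ‖w n‖ ^ 2 := by
      nlinarith [sq_nonneg ‖w n‖]
    have h6 := hw n hn
    calc _ ≤ n * ‖w n‖ ^ 2 * n := by gcongr; exact h3.trans h5
      _ = (n * ‖w n‖) * (n * ‖w n‖) := by ring
      _ ≤ 1 / 2 * (1 / 2) := by gcongr
      _ = _ := by norm_num
  have hlog : ∀ n : ℕ, 1 ≤ n →
      Complex.log ((1 + w n) ^ n) = n * Complex.log (1 + w n) := by
    intro n hn
    have h1 : (1 : ℝ) ≤ n := by exact_mod_cast hn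
    have hne : 1 + w n ≠ 0 := by
      intro h0
      have : w n = -1 := by linear_combination h0
      have h2 := hsmall n hn
      rw [this] at h2; norm_num at h2
    have hn1 : ‖(n : ℂ) * Complex.log (1 + w n)‖ ≤ 1 := by
      have h2 := herr n hn
      have h3 : (1 : ℝ) / 4 / n ≤ 1 / 4 := div_le_self (by norm_num) h1
      have h4 := norm_le_norm_add_norm_sub' ((n : ℂ) * Complex.log (1 + w n)) (n * w n)
      have h5 : ‖(n : ℂ) * w n‖ ≤ 1 / 2 := by
        rw [norm_mul, Complex.norm_natCast]; exact hw n hn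
      linarith
    have him := abs_le.1 ((Complex.abs_im_le_norm _).trans hn1)
    rw [← Complex.log_exp (x := (n : ℂ) * Complex.log (1 + w n)) (by linarith [Real.pi_gt_three])
      (by linarith [Real.pi_gt_three]), Complex.exp_nat_mul, Complex.exp_log hne]
  have hslit : Complex.exp ζ ∈ Complex.slitPlane := by
    have h1 := Complex.norm_exp_sub_one_le (x := ζ) (by linarith)
    have h2 := Complex.mem_slitPlane_of_norm_lt_one (z := Complex.exp ζ - 1) (by linarith)
    simpa using h2
  have hlim2 := hlim.clog hslit
  have him := abs_le.1 ((Complex.abs_im_le_norm ζ).trans hζ)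
  rw [Complex.log_exp (by linarith [Real.pi_gt_three]) (by linarith [Real.pi_gt_three])] at hlim2
  have hd : Tendsto (fun n : ℕ => (n : ℂ) * Complex.log (1 + w n) - n * w n) atTop (𝓝 0) := by
    refine squeeze_zero_norm' ((eventually_ge_atTop 1).mono herr) ?_
    exact tendsto_const_div_atTop_nhds_zero_nat _
  have := (hlim2.congr' ((eventually_ge_atTop 1).mono hlog)).sub hd
  simpa using this

end TruncSqBound

end

section

/-! ### The stable expansion of `ψ_G` at `0` -/

lemma stableExponent_mul {α σ b s t : ℝ} (hs : 0 < s) :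
    stableExponent α σ b (s * t) = ((s ^ α : ℝ) : ℂ) * stableExponent α σ b t := by
  have hsign : Real.sign (s * t) = Real.sign t := by
    rcases lt_trichotomy t 0 with ht | rfl | ht
    · rw [Real.sign_of_neg ht, Real.sign_of_neg (mul_neg_of_pos_of_neg hs ht)]
    · rw [mul_zero]
    · rw [Real.sign_of_pos ht, Real.sign_of_pos (mul_pos hs ht)]
  rw [stableExponent, stableExponent, abs_mul, abs_of_pos hs, Real.mul_rpow hs.le (abs_nonneg t),
    hsign]
  push_cast
  ring

lemma centeredCharFun_pow_mul_exp (G : Measure ℝ) {n : ℕ} {a t s : ℝ} :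
    centeredCharFun G (t / s) ^ n *
        Complex.exp (Complex.I * (((a + n * (∫ x, x ∂G) / s) * t : ℝ) : ℂ)) =
      charFun G (t / s) ^ n * Complex.exp (a * t * Complex.I) := by
  rw [centeredCharFun, mul_pow, ← Complex.exp_nat_mul, mul_comm (Complex.exp _) (charFun G _ ^ n),
    mul_assoc, ← Complex.exp_add]
  congr 2
  push_cast
  ring

variable {α σ b C : ℝ} {G : Measure ℝ} [IsProbabilityMeasure G]

/-- Along the sequence `t n^{-1/α}`, for small `t`, the centred characteristic function has the
stable expansion. -/
lemma exists_tendsto_centeredCharFun (hα : 1 < α) (hα2 : α ≤ 2) (hσ : 0 < σ)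
    (hb : b ∈ Icc (-1 : ℝ) 1) (hG : NormalDomainOfAttraction α σ b G) (h : TruncSqBound α C G) :
    ∃ t₁ : ℝ, 0 < t₁ ∧ ∀ t, |t| ≤ t₁ →
      Tendsto (fun n : ℕ => (n : ℂ) * (centeredCharFun G (t / (n : ℝ) ^ (1 / α)) - 1)) atTop
        (𝓝 (-stableExponent α σ b t)) := by
  obtain ⟨a, t₀, ht₀, hbd, hlim⟩ := hG.exists_charFun hα hσ hb
  obtain ⟨K, hK, hKbd⟩ := h.exists_norm_centeredCharFun_sub_one_le hα hα2
  set T : ℝ := σ ^ α * (1 + |Real.tan (Real.pi * α / 2)|) with hTdef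
  have hT : 0 < T := by positivity
  have hω : ∀ t, ‖stableExponent α σ b t‖ ≤ T * |t| ^ α := fun t => norm_stableExponent_le hσ hb
  have hw : ∀ n : ℕ, 1 ≤ n → ∀ t, |t| ≤ 1 →
      n * ‖centeredCharFun G (t / (n : ℝ) ^ (1 / α)) - 1‖ ≤ K * |t| ^ α := by
    intro n hn t ht
    obtain ⟨h1, h2⟩ := abs_div_rpow_inv hα hn t
    rw [← h2]
    calc _ ≤ n * (K * |t / (n : ℝ) ^ (1 / α)| ^ α) := by
          gcongr; exact hKbd _ (h1.trans ht)
      _ = _ := by ring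
  set c : ℕ → ℝ := fun n => a n + n * (∫ x, x ∂G) / (n : ℝ) ^ (1 / α) with hc
  have hc0 : Tendsto c atTop (𝓝 0) := by
    refine tendsto_zero_of_centering (z := fun t n => centeredCharFun G (t / (n : ℝ) ^ (1 / α)) ^ n)
      hα hK ht₀ hω (fun n hn t ht => ?_) (fun n t ht => ?_) (fun t => ?_)
    · exact (norm_pow_sub_one_le (norm_centeredCharFun_le_one G _) n).trans (hw n hn t ht)
    · rw [hc, centeredCharFun_pow_mul_exp]; exact hbd n t ht
    · simp only [hc, centeredCharFun_pow_mul_exp]; exact hlim t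
  have hlim2 : ∀ t, Tendsto (fun n : ℕ => centeredCharFun G (t / (n : ℝ) ^ (1 / α)) ^ n) atTop
      (𝓝 (Complex.exp (-stableExponent α σ b t))) := by
    intro t
    have h1 : Tendsto (fun n => Complex.exp (-(Complex.I * ((c n * t : ℝ) : ℂ)))) atTop (𝓝 1) := by
      have h2 : Continuous fun x : ℝ => Complex.exp (-(Complex.I * ((x * t : ℝ) : ℂ))) := by fun_prop
      simpa [Function.comp_def] using (h2.tendsto 0).comp hc0
    have h3 := (hlim t).mul h1
    rw [mul_one] at h3
    refine h3.congr fun n => ?_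
    rw [← centeredCharFun_pow_mul_exp, mul_assoc, ← Complex.exp_add]
    simp [hc]
  have hpow : Tendsto (fun t : ℝ => (2 * K + 4 * T) * |t| ^ α) (𝓝[>] 0) (𝓝 0) := by
    have : ContinuousAt (fun t : ℝ => (2 * K + 4 * T) * |t| ^ α) 0 :=
      continuousAt_const.mul (continuous_abs.continuousAt.rpow_const (Or.inr (by linarith)))
    simpa [Real.zero_rpow (by linarith : α ≠ 0)] using this.tendsto.mono_left nhdsWithin_le_nhds
  obtain ⟨t₁, ⟨ht₁, ht₁0⟩, ht₁1⟩ := (((hpow.eventually (gt_mem_nhds one_pos)).and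
    self_mem_nhdsWithin).and (nhdsWithin_le_nhds (gt_mem_nhds one_pos))).exists
  refine ⟨t₁, ht₁0, fun t ht => ?_⟩
  have hle : |t| ^ α ≤ |t₁| ^ α := by
    have : |t| ≤ |t₁| := ht.trans (le_abs_self t₁)
    gcongr
  have hp1 : K * |t| ^ α ≤ K * |t₁| ^ α := by gcongr
  have hp2 : T * |t| ^ α ≤ T * |t₁| ^ α := by gcongr
  have hp3 : 0 ≤ T * |t₁| ^ α := by positivity
  have hp4 : 0 ≤ K * |t₁| ^ α := by positivity
  refine tendsto_nat_mul_of_tendsto_one_add_pow ?_ (fun n hn => ?_) ?_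
  · rw [norm_neg]
    exact (hω t).trans (by linarith)
  · exact (hw n hn t (ht.trans ht₁1.le)).trans (by linarith)
  · simpa using hlim2 t

/-- Passing from the centred characteristic function to `ψ_G` costs `O(|u|^{1+α} + u² (E X)²)`; for
`α = 2` the last term is not `o(|u|^α)` unless the mean is `0`. -/
lemma exists_tendsto_nat_mul_psiG (hα : 1 < α) (hα2 : α ≤ 2) (hσ : 0 < σ)
    (hb : b ∈ Icc (-1 : ℝ) 1) (hG : NormalDomainOfAttraction α σ b G) (h : TruncSqBound α C G)
    (hmean : α = 2 → ∫ x, x ∂G = 0) :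
    ∃ t₁ : ℝ, 0 < t₁ ∧ ∀ t, |t| ≤ t₁ →
      Tendsto (fun n : ℕ => (n : ℂ) * psiG G (t / (n : ℝ) ^ (1 / α))) atTop
        (𝓝 (-stableExponent α σ b t)) := by
  obtain ⟨t₁, ht₁, hlim⟩ := exists_tendsto_centeredCharFun hα hα2 hσ hb hG h
  refine ⟨t₁, ht₁, fun t ht => ?_⟩
  set m : ℝ := ∫ x, x ∂G with hm
  have hC := h.1
  have herr : ∀ u : ℝ, ‖psiG G u - (centeredCharFun G u - 1)‖ ≤
      |u * m| * (2 * C * |u| ^ α) + 2 * (u * m) ^ 2 := by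
    intro u
    rw [h.centeredCharFun_sub_one, ← hm]
    set e := Complex.exp (-((u * m : ℝ) : ℂ) * Complex.I) with he
    have he1 : ‖e‖ = 1 := by rw [he, ← Complex.ofReal_neg, Complex.norm_exp_ofReal_mul_I]
    have he2 : ‖1 - e‖ ≤ |u * m| := by
      rw [norm_sub_rev, he, ← Complex.ofReal_neg, mul_comm]
      refine Real.norm_exp_I_mul_ofReal_sub_one_le.trans ?_
      rw [Real.norm_eq_abs, abs_neg]
    have : psiG G u - e * (psiG G u - psi (u * m)) = (1 - e) * psiG G u + e * psi (u * m) := by ring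
    rw [this]
    refine (norm_add_le _ _).trans ?_
    rw [norm_mul, norm_mul, he1, one_mul]
    gcongr
    · exact h.norm_psiG_le u
    · exact norm_psi_le_two_mul_sq _
  have hinv : Tendsto (fun n : ℕ => t / (n : ℝ) ^ (1 / α)) atTop (𝓝 0) :=
    tendsto_const_nhds.div_atTop
      ((tendsto_rpow_atTop (by positivity)).comp tendsto_natCast_atTop_atTop)
  have hd : Tendsto (fun n : ℕ => (n : ℂ) * psiG G (t / (n : ℝ) ^ (1 / α)) -
      n * (centeredCharFun G (t / (n : ℝ) ^ (1 / α)) - 1)) atTop (𝓝 0) := by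
    have hsq : Tendsto (fun n : ℕ => 2 * m ^ 2 * (|t| ^ α *
        |t / (n : ℝ) ^ (1 / α)| ^ (2 - α))) atTop (𝓝 0) := by
      rcases hα2.lt_or_eq with hlt | heq
      · have : ContinuousAt (fun x : ℝ => 2 * m ^ 2 * (|t| ^ α * |x| ^ (2 - α))) 0 :=
          continuousAt_const.mul (continuousAt_const.mul
            (continuous_abs.continuousAt.rpow_const (Or.inr (by linarith))))
        have h2 := this.tendsto.comp hinv
        simpa [Real.zero_rpow (by linarith : 2 - α ≠ 0), Function.comp_def] using h2
      · simp [hmean heq]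
    have hlin : Tendsto (fun n : ℕ => |t / (n : ℝ) ^ (1 / α) * m| * (2 * C * |t| ^ α)) atTop
        (𝓝 0) := by
      simpa using ((hinv.mul_const m).abs.mul_const (2 * C * |t| ^ α))
    have hsum := hlin.add hsq
    rw [add_zero] at hsum
    refine squeeze_zero_norm' ?_ hsum
    filter_upwards [eventually_ge_atTop 1] with n hn
    obtain ⟨-, h2⟩ := abs_div_rpow_inv hα hn t
    set u := t / (n : ℝ) ^ (1 / α)
    rw [← mul_sub, norm_mul, Complex.norm_natCast, ← h2]
    have hu2 : u ^ 2 = |u| ^ α * |u| ^ (2 - α) := by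
      rcases eq_or_ne u 0 with h0 | h0
      · rw [h0]; simp [Real.zero_rpow (by linarith : α ≠ 0)]
      · rw [← Real.rpow_add (abs_pos.2 h0), ← sq_abs, ← Real.rpow_two]; congr 1; ring
    calc _ ≤ n * (|u * m| * (2 * C * |u| ^ α) + 2 * (u * m) ^ 2) := by gcongr; exact herr u
      _ = |u * m| * (2 * C * (n * |u| ^ α)) + 2 * m ^ 2 * (n * u ^ 2) := by ring
      _ = |u * m| * (2 * C * (n * |u| ^ α)) +
          2 * m ^ 2 * (n * |u| ^ α * |u| ^ (2 - α)) := by rw [hu2]; ring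
  simpa using hd.add (hlim t ht)

/-- `w^α ψ_G(v / w)` converges to minus the stable exponent as `w → ∞` through the reals: the
integers `n = ⌊w^α⌋` suffice by the Lipschitz bound for `ψ_G`. -/
lemma tendsto_rpow_mul_psiG_div (hα : 1 < α) (hα2 : α ≤ 2) (hσ : 0 < σ)
    (hb : b ∈ Icc (-1 : ℝ) 1) (hG : NormalDomainOfAttraction α σ b G) (h : TruncSqBound α C G)
    (hmean : α = 2 → ∫ x, x ∂G = 0) (v : ℝ) :
    Tendsto (fun w : ℝ => ((w ^ α : ℝ) : ℂ) * psiG G (v / w)) atTop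
      (𝓝 (-stableExponent α σ b v)) := by
  obtain ⟨t₁, ht₁, hlim⟩ := exists_tendsto_nat_mul_psiG hα hα2 hσ hb hG h hmean
  have hC := h.1
  have hα0 : 0 < α := by linarith
  have key : ∀ t, |t| ≤ t₁ → Tendsto (fun w : ℝ => ((w ^ α : ℝ) : ℂ) * psiG G (t / w)) atTop
      (𝓝 (-stableExponent α σ b t)) := by
    intro t ht
    have hwα : Tendsto (fun w : ℝ => w ^ α) atTop atTop := tendsto_rpow_atTop hα0
    have hfl : Tendsto (fun w : ℝ => ⌊w ^ α⌋₊) atTop atTop := tendsto_nat_floor_atTop.comp hwα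
    have hratio : Tendsto (fun w : ℝ => ((⌊w ^ α⌋₊ : ℝ) / w ^ α) ^ (1 / α)) atTop (𝓝 1) := by
      have h1 : Tendsto (fun w : ℝ => (⌊w ^ α⌋₊ : ℝ) / w ^ α) atTop (𝓝 1) := by
        exact (tendsto_nat_floor_div_atTop (R := ℝ)).comp hwα
      simpa using h1.rpow_const (p := 1 / α) (Or.inl one_ne_zero)
    have hE1 : Tendsto (fun w : ℝ => 2 * C * |t / w| ^ α +
        2 * C * |t| ^ α * (1 - ((⌊w ^ α⌋₊ : ℝ) / w ^ α) ^ (1 / α))) atTop (𝓝 0) := by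
      have h1 : Tendsto (fun w : ℝ => 2 * C * |t / w| ^ α) atTop (𝓝 0) := by
        have h2 : Tendsto (fun w : ℝ => t / w) atTop (𝓝 0) :=
          tendsto_const_nhds.div_atTop tendsto_id
        have h3 := (h2.abs.rpow_const (p := α) (Or.inr hα0.le)).const_mul (2 * C)
        simpa [Real.zero_rpow hα0.ne'] using h3
      have h4 := (tendsto_const_nhds (x := (1 : ℝ))).sub hratio
      simpa using h1.add (h4.const_mul (2 * C * |t| ^ α))
    have hd : Tendsto (fun w : ℝ => ((w ^ α : ℝ) : ℂ) * psiG G (t / w) -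
        (⌊w ^ α⌋₊ : ℂ) * psiG G (t / (⌊w ^ α⌋₊ : ℝ) ^ (1 / α))) atTop (𝓝 0) := by
      refine squeeze_zero_norm' ?_ hE1
      filter_upwards [eventually_ge_atTop 1] with w hw
      have hw0 : 0 < w := by linarith
      have hwα1 : 1 ≤ w ^ α := Real.one_le_rpow hw hα0.le
      have hwα0 : 0 < w ^ α := by linarith
      set n := ⌊w ^ α⌋₊
      have hn1 : 1 ≤ n := Nat.le_floor (by simpa using hwα1)
      have hn0 : (0 : ℝ) < n := by exact_mod_cast hn1
      have hnw : (n : ℝ) ≤ w ^ α := Nat.floor_le hwα0.le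
      have hnw' : w ^ α ≤ n + 1 := (Nat.lt_floor_add_one _).le
      have hdiv : ((n : ℝ) / w ^ α) ^ (1 / α) = (n : ℝ) ^ (1 / α) / w := by
        rw [Real.div_rpow hn0.le hwα0.le, one_div, Real.rpow_rpow_inv hw0.le hα0.ne']
      rw [hdiv]
      set s := (n : ℝ) ^ (1 / α) with hs
      have hs0 : 0 < s := by positivity
      have hsn : s ^ α = n := by rw [hs, one_div, Real.rpow_inv_rpow hn0.le hα0.ne']
      have hsw : s ≤ w := by
        rw [← Real.rpow_le_rpow_iff hs0.le hw0.le hα0, hsn]; exact hnw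
      have hsplit : ((w ^ α : ℝ) : ℂ) * psiG G (t / w) - (n : ℂ) * psiG G (t / s) =
          ((w ^ α - n : ℝ) : ℂ) * psiG G (t / w) + (n : ℂ) * (psiG G (t / w) - psiG G (t / s)) := by
        push_cast; ring
      rw [hsplit]
      refine (norm_add_le _ _).trans (add_le_add ?_ ?_)
      · rw [norm_mul, Complex.norm_real, Real.norm_of_nonneg (by linarith)]
        calc _ ≤ 1 * ‖psiG G (t / w)‖ := by gcongr; linarith
          _ ≤ _ := by rw [one_mul]; exact h.norm_psiG_le _
      · rcases eq_or_ne t 0 with rfl | ht0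
        · simp [Real.zero_rpow hα0.ne']
        have ht0' : 0 < |t| := abs_pos.2 ht0
        have hle := h.norm_psiG_sub_le_of_abs_le (u := t / w) (v := t / s) (w := |t| / s)
          (by positivity) (by rw [abs_div, abs_of_pos hw0]; gcongr)
          (by rw [abs_div, abs_of_pos hs0])
        have habs : |t / w - t / s| = |t| / s * (1 - s / w) := by
          rw [show t / w - t / s = -(t / s * (1 - s / w)) by field_simp; ring, abs_neg, abs_mul,
            abs_div, abs_of_pos hs0, abs_of_nonneg (a := 1 - s / w)]
          have := (div_le_one hw0).2 hsw
          linarith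
        rw [habs] at hle
        rw [norm_mul, Complex.norm_natCast]
        calc (n : ℝ) * ‖psiG G (t / w) - psiG G (t / s)‖
            ≤ n * (2 * C * (|t| / s) ^ (α - 1) * (|t| / s * (1 - s / w))) := by gcongr
          _ = 2 * C * (n * ((|t| / s) ^ (α - 1) * (|t| / s))) * (1 - s / w) := by ring
          _ = _ := by
            rw [Real.rpow_sub_one (by positivity), div_mul_cancel₀ _ (by positivity),
              Real.div_rpow ht0'.le hs0.le, hsn]
            field_simp
    simpa using hd.add ((hlim t ht).comp hfl)
  -- rescaling reduces a general `v` to a small one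
  set s : ℝ := (|v| + 1) / t₁ with hs
  have hs0 : 0 < s := by positivity
  have hvs : |v / s| ≤ t₁ := by
    rw [abs_div, abs_of_pos hs0, hs, div_div_eq_mul_div, div_le_iff₀ (by positivity)]
    nlinarith [abs_nonneg v]
  have h1 := ((key (v / s) hvs).comp (tendsto_id.atTop_div_const hs0)).const_mul
    (((s ^ α : ℝ)) : ℂ)
  have h2 : ((s ^ α : ℝ) : ℂ) * -stableExponent α σ b (v / s) = -stableExponent α σ b v := by
    rw [mul_neg, ← stableExponent_mul hs0, mul_div_cancel₀ _ hs0.ne']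
  rw [h2] at h1
  refine h1.congr' ?_
  filter_upwards [eventually_gt_atTop 0] with w hw
  simp only [Function.comp, id]
  rw [← mul_assoc, ← Complex.ofReal_mul, ← Real.mul_rpow hs0.le (by positivity),
    mul_div_cancel₀ _ hs0.ne', div_div_div_cancel_right₀ hs0.ne']

/-- A law in the normal domain of attraction of a stable law is not the Dirac mass at `0`. -/
lemma NormalDomainOfAttraction.measure_ne_zero_ne_zero (hα : 1 < α) (hσ : 0 < σ)
    (hb : b ∈ Icc (-1 : ℝ) 1) (hG : NormalDomainOfAttraction α σ b G) : G {x | x ≠ 0} ≠ 0 := by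
  intro h0
  obtain ⟨a, -, -, -, hlim⟩ := hG.exists_charFun hα hσ hb
  have h1 : ∀ u, charFun G u = 1 := by
    intro u
    have hae : ∀ᵐ x ∂G, x = 0 := h0
    rw [charFun_apply_real, integral_congr_ae (g := fun _ => 1) (hae.mono fun x hx => by simp [hx])]
    simp
  have h2 := (hlim 1).norm
  simp only [h1, one_pow, one_mul] at h2
  have h3 : ∀ n : ℕ, ‖Complex.exp (a n * (1 : ℝ) * Complex.I)‖ = 1 := fun n => by
    rw [← Complex.ofReal_mul, Complex.norm_exp_ofReal_mul_I]
  simp only [h3] at h2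
  have h4 := tendsto_nhds_unique h2 tendsto_const_nhds
  rw [Complex.norm_exp, Real.exp_eq_one_iff] at h4
  have h5 : (-stableExponent α σ b 1).re = -σ ^ α := by
    rw [stableExponent, Complex.neg_re, Complex.re_ofReal_mul, Complex.sub_re,
      Complex.re_mul_ofReal]
    simp
  rw [h5, neg_eq_zero] at h4
  exact (Real.rpow_pos_of_pos hσ α).ne' h4

end

section

variable {d : ℕ}

/-! ### Signed measures of balls -/

lemma measurable_measure_closedBall (ν : Measure (Space d)) [IsFiniteMeasure ν] :
    Measurable fun z : Space d × ℝ => ν (Metric.closedBall z.1 z.2) := by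
  have hs : MeasurableSet {w : (Space d × ℝ) × Space d | dist w.2 w.1.1 ≤ w.1.2} :=
    measurableSet_le (by fun_prop) (by fun_prop)
  exact measurable_measure_prodMk_left hs

lemma signedMeasure_apply_eq (μ : SignedMeasure (Space d)) {s : Set (Space d)}
    (hs : MeasurableSet s) :
    μ s = μ.toJordanDecomposition.posPart.real s - μ.toJordanDecomposition.negPart.real s :=
  μ.apply_eq_posPart_real_sub_negPart_real hs

lemma measurable_signedMeasure_closedBall (μ : SignedMeasure (Space d)) :
    Measurable fun z : Space d × ℝ => μ (Metric.closedBall z.1 z.2) := by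
  simp_rw [signedMeasure_apply_eq μ Metric.isClosed_closedBall.measurableSet]
  exact (measurable_measure_closedBall _).ennreal_toReal.sub
    (measurable_measure_closedBall _).ennreal_toReal

instance (μ : SignedMeasure (Space d)) : IsFiniteMeasure μ.totalVariation := by
  unfold SignedMeasure.totalVariation; infer_instance

lemma abs_signedMeasure_apply_le (μ : SignedMeasure (Space d)) {s : Set (Space d)}
    (hs : MeasurableSet s) : |μ s| ≤ μ.totalVariation.real s := by
  rw [signedMeasure_apply_eq μ hs, SignedMeasure.totalVariation, measureReal_add_apply]
  refine (abs_sub _ _).trans (le_of_eq ?_)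
  rw [abs_of_nonneg measureReal_nonneg, abs_of_nonneg measureReal_nonneg]

lemma totalVariation_singleton (μ : SignedMeasure (Space d)) {z : Space d} (hz : μ {z} = 0) :
    μ.totalVariation {z} = 0 := by
  obtain ⟨S, hS, h1, h2⟩ := μ.toJordanDecomposition.mutuallySingular
  have h3 := signedMeasure_apply_eq μ (measurableSet_singleton z)
  rw [hz] at h3
  rw [SignedMeasure.totalVariation, Measure.add_apply]
  by_cases hzS : z ∈ S
  · have h4 : μ.toJordanDecomposition.posPart {z} = 0 :=
      measure_mono_null (singleton_subset_iff.2 hzS) h1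
    have h5 : μ.toJordanDecomposition.negPart.real {z} = 0 := by
      have : μ.toJordanDecomposition.posPart.real {z} = 0 := by simp [Measure.real, h4]
      linarith
    rw [h4, (measureReal_eq_zero_iff).1 h5, add_zero]
  · have h4 : μ.toJordanDecomposition.negPart {z} = 0 :=
      measure_mono_null (singleton_subset_iff.2 hzS) h2
    have h5 : μ.toJordanDecomposition.posPart.real {z} = 0 := by
      have : μ.toJordanDecomposition.negPart.real {z} = 0 := by simp [Measure.real, h4]
      linarith
    rw [h4, (measureReal_eq_zero_iff).1 h5, add_zero]

lemma volume_closedBall_eq (x : Space d) {r : ℝ} (hr : 0 ≤ r) :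
    volume (Metric.closedBall x r) = ENNReal.ofReal (unitBallVol d * r ^ d) := by
  rw [Measure.addHaar_closedBall' _ _ hr, unitBallVol, mul_comm,
    ENNReal.ofReal_mul measureReal_nonneg,
    ofReal_measureReal (isCompact_closedBall _ _).measure_lt_top.ne]
  simp

lemma unitBallVol_pos (d : ℕ) : 0 < unitBallVol d :=
  ENNReal.toReal_pos (Metric.measure_closedBall_pos _ _ one_pos).ne'
    (isCompact_closedBall _ _).measure_lt_top.ne

/-- A measure of the class `M_{α,β}` has no atoms: near an atom `z` the integral of
`|μ(B(x,r))|^α` would be at least of order `r^d`, while it is at most of order `r^q`, `q > d`. -/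
lemma MClass.apply_singleton {α β : ℝ} {μ : SignedMeasure (Space d)} (hα : 1 < α)
    (hβ : (d : ℝ) < β) (hμ : MClass α β μ) (z : Space d) : μ {z} = 0 := by
  obtain ⟨p, q, C, hp, hpβ, hβq, hq, hC, hbd⟩ := hμ
  by_contra hz
  have ha : 0 < |μ {z}| := abs_pos.2 hz
  set ν := μ.totalVariation
  have hν : Tendsto (fun r : ℝ => ν.real (Metric.closedBall z (2 * r) \ {z})) (𝓝[>] 0) (𝓝 0) := by
    have h1 : Tendsto (fun r : ℝ => ν (Metric.closedBall z (2 * r) \ {z})) (𝓝[>] 0)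
        (𝓝 (ν (⋂ r > (0 : ℝ), Metric.closedBall z (2 * r) \ {z}))) := by
      refine tendsto_measure_biInter_gt (fun r _ => ?_) (fun i j _ hij => ?_) ⟨1, one_pos, ?_⟩
      · exact (Metric.isClosed_closedBall.measurableSet.diff
          (measurableSet_singleton z)).nullMeasurableSet
      · exact sdiff_subset_sdiff_left (Metric.closedBall_subset_closedBall (by linarith))
      · exact measure_ne_top _ _
    have h2 : (⋂ r > (0 : ℝ), Metric.closedBall z (2 * r) \ {z}) = ∅ := by
      ext x
      simp only [mem_iInter, Set.mem_sdiff, Metric.mem_closedBall, mem_singleton_iff, mem_empty_iff_false,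
        iff_false]
      intro h
      have hx : x ≠ z := (h 1 one_pos).2
      have hd : 0 < dist x z := dist_pos.2 hx
      have := (h (dist x z / 4) (by positivity)).1
      linarith
    rw [h2, measure_empty] at h1
    exact (ENNReal.tendsto_toReal ENNReal.zero_ne_top).comp h1
  have hr : Tendsto (fun r : ℝ => C * r ^ (q - d)) (𝓝[>] 0) (𝓝 0) := by
    have : ContinuousAt (fun r : ℝ => C * r ^ (q - d)) 0 :=
      continuousAt_const.mul (Real.continuousAt_rpow_const _ _ (Or.inr (by linarith)))
    have h0 : q - d ≠ 0 := by linarith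
    simpa [Real.zero_rpow h0] using this.tendsto.mono_left nhdsWithin_le_nhds
  have hv := unitBallVol_pos d
  have hc0 : 0 < (|μ {z}| / 2) ^ α * unitBallVol d := by positivity
  obtain ⟨r, ⟨hr1, hr2⟩, hr0⟩ := (((hν.eventually (gt_mem_nhds (half_pos ha))).and
    (hr.eventually (gt_mem_nhds hc0))).and self_mem_nhdsWithin).exists
  have hlow : ∀ x ∈ Metric.closedBall z r, |μ {z}| / 2 ≤ |μ (Metric.closedBall x r)| := by
    intro x hx
    have hzx : {z} ⊆ Metric.closedBall x r := by
      rw [singleton_subset_iff, Metric.mem_closedBall, dist_comm]; exact hx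
    have h1 := VectorMeasure.of_add_of_sdiff (v := μ) (measurableSet_singleton z)
      (Metric.isClosed_closedBall.measurableSet (α := Space d)) hzx
    have h2 : |μ (Metric.closedBall x r \ {z})| ≤ ν.real (Metric.closedBall z (2 * r) \ {z}) := by
      refine (abs_signedMeasure_apply_le μ (Metric.isClosed_closedBall.measurableSet.diff
        (measurableSet_singleton z))).trans ?_
      refine measureReal_mono (sdiff_subset_sdiff_left (Metric.closedBall_subset_closedBall' ?_))
      rw [Metric.mem_closedBall] at hx; linarith
    rw [← h1]
    have h3 := abs_sub_abs_le_abs_sub (μ {z}) (-μ (Metric.closedBall x r \ {z}))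
    rw [abs_neg, sub_neg_eq_add] at h3
    linarith
  have h1 := hbd r hr0
  have h2 : ENNReal.ofReal ((|μ {z}| / 2) ^ α * (unitBallVol d * r ^ d)) ≤
      ENNReal.ofReal (C * min (r ^ p) (r ^ q)) := by
    refine le_trans ?_ h1
    rw [ENNReal.ofReal_mul (by positivity), ← volume_closedBall_eq z hr0.le, ← setLIntegral_const]
    refine (setLIntegral_mono' Metric.isClosed_closedBall.measurableSet fun x hx => ?_).trans
      (setLIntegral_le_lintegral _ _)
    apply ENNReal.ofReal_le_ofReal
    have := hlow x hx
    gcongr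
  rw [ENNReal.ofReal_le_ofReal_iff (by positivity)] at h2
  have h3 : C * min (r ^ p) (r ^ q) ≤ C * r ^ (q - d) * r ^ d := by
    rw [mul_assoc, ← Real.rpow_natCast, ← Real.rpow_add hr0, sub_add_cancel]
    gcongr; exact min_le_right _ _
  have h4 : 0 < r ^ d := by positivity
  have h5 : (|μ {z}| / 2) ^ α * unitBallVol d * r ^ d ≤ C * r ^ (q - d) * r ^ d := by linarith
  exact absurd (le_of_mul_le_mul_right h5 h4) (not_le.2 hr2)

/-- For a finite measure without atoms, the spheres around almost every centre are null, for all
radii at once. Indeed `ν(S(x,r))²` is at most the `ν ⊗ ν`-measure of the pairs equidistant from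
`x`, and for distinct `z`, `z'` the equidistant `x` form a hyperplane. -/
lemma ae_forall_measure_sphere_eq_zero (ν : Measure (Space d)) [IsFiniteMeasure ν]
    (hν : ∀ z, ν {z} = 0) : ∀ᵐ x : Space d, ∀ r : ℝ, ν (Metric.sphere x r) = 0 := by
  set E : Set (Space d × (Space d × Space d)) := {w | dist w.2.1 w.1 = dist w.2.2 w.1} with hE
  have hEm : MeasurableSet E := measurableSet_eq_fun (by fun_prop) (by fun_prop)
  have hdiag : ∀ᵐ w ∂(ν.prod ν), w.1 ≠ w.2 := by
    have hm : MeasurableSet {w : Space d × Space d | w.1 = w.2} :=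
      measurableSet_eq_fun measurable_fst measurable_snd
    have h0 : ν.prod ν {w : Space d × Space d | w.1 = w.2} = 0 := by
      rw [Measure.measure_prod_null hm]
      refine ae_of_all _ fun z => ?_
      have : Prod.mk z ⁻¹' {w : Space d × Space d | w.1 = w.2} = {z} := by
        ext y; simp [eq_comm]
      change ν (Prod.mk z ⁻¹' {w : Space d × Space d | w.1 = w.2}) = 0
      rw [this]; exact hν z
    rw [ae_iff]; simpa using h0
  have h0 : (volume : Measure (Space d)).prod (ν.prod ν) E = 0 := by
    rw [Measure.prod_apply_symm hEm, lintegral_eq_zero_iff (measurable_measure_prodMk_right hEm)]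
    filter_upwards [hdiag] with w hw
    have : (fun x => (x, w)) ⁻¹' E = (AffineSubspace.perpBisector w.1 w.2 : Set (Space d)) := by
      ext x
      simp [hE, AffineSubspace.mem_perpBisector_iff_dist_eq, dist_comm x]
    rw [this]
    refine Measure.addHaar_affineSubspace volume _ ?_
    intro htop
    exact hw (AffineSubspace.perpBisector_eq_top.1 htop)
  rw [Measure.measure_prod_null hEm] at h0
  filter_upwards [h0] with x hx r
  have h1 : ν.prod ν (Metric.sphere x r ×ˢ Metric.sphere x r) = 0 := by
    refine measure_mono_null (fun w hw => ?_) hx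
    simp only [mem_prod, Metric.mem_sphere] at hw
    simp [hE, hw.1, hw.2]
  rw [Measure.prod_prod] at h1
  exact mul_self_eq_zero.1 h1

lemma continuous_measureReal_closedBall (ν : Measure (Space d)) [IsFiniteMeasure ν] {x : Space d}
    (hx : ∀ r, ν (Metric.sphere x r) = 0) :
    Continuous fun r : ℝ => ν.real (Metric.closedBall x r) := by
  have heq : (fun r : ℝ => ν.real (Metric.closedBall x r)) =
      fun r => ∫ y, (Metric.closedBall x r).indicator (fun _ => (1 : ℝ)) y ∂ν := by
    funext r
    rw [integral_indicator_const _ Metric.isClosed_closedBall.measurableSet]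
    simp
  rw [heq, continuous_iff_continuousAt]
  intro r₀
  refine continuousAt_of_dominated (bound := fun _ => 1) (Eventually.of_forall fun r => ?_)
    (Eventually.of_forall fun r => ae_of_all _ fun y => ?_) (integrable_const _) ?_
  · exact (measurable_const.indicator Metric.isClosed_closedBall.measurableSet).aestronglyMeasurable
  · by_cases hy : y ∈ Metric.closedBall x r <;> simp [hy]
  · have hae : ∀ᵐ y ∂ν, y ∉ Metric.sphere x r₀ :=
      measure_eq_zero_iff_ae_notMem.1 (hx r₀)
    filter_upwards [hae] with y hy
    rw [Metric.mem_sphere] at hy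
    rcases lt_or_gt_of_ne hy with h | h
    · refine continuousAt_const.congr (f := fun _ => (1 : ℝ)) ?_
      filter_upwards [lt_mem_nhds h] with r hr
      rw [indicator_of_mem (Metric.mem_closedBall.2 hr.le)]
    · refine continuousAt_const.congr (f := fun _ => (0 : ℝ)) ?_
      filter_upwards [gt_mem_nhds h] with r hr
      rw [indicator_of_notMem (by rw [Metric.mem_closedBall]; exact not_le.2 hr)]

/-- If `μ(B(x,r))` avoids a punctured neighbourhood of `0` for almost all `x` in a set and almost all
radii, it vanishes there: `r ↦ μ(B(x,r))` is continuous and vanishes at `r = 0`. -/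
lemma ae_apply_closedBall_eq_zero_of_gap (μ : SignedMeasure (Space d)) (hμ : ∀ z, μ {z} = 0)
    {P : Space d → Prop} {δ : ℝ} (hδ : 0 < δ)
    (h : ∀ᵐ z ∂dxdr d, P z.1 → ¬ (0 < |μ (Metric.closedBall z.1 z.2)| ∧
      |μ (Metric.closedBall z.1 z.2)| < δ)) :
    ∀ᵐ x : Space d, P x → ∀ r, 0 < r → μ (Metric.closedBall x r) = 0 := by
  have hsph := ae_forall_measure_sphere_eq_zero μ.totalVariation
    fun z => totalVariation_singleton μ (hμ z)
  filter_upwards [hsph, Measure.ae_ae_of_ae_prod h] with x hx hgap hP r hr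
  have hcont : Continuous fun r : ℝ => |μ (Metric.closedBall x r)| := by
    simp_rw [signedMeasure_apply_eq μ Metric.isClosed_closedBall.measurableSet]
    refine ((continuous_measureReal_closedBall _ fun r => ?_).sub
      (continuous_measureReal_closedBall _ fun r => ?_)).abs
    · exact (add_eq_zero.1 (by simpa [SignedMeasure.totalVariation] using hx r)).1
    · exact (add_eq_zero.1 (by simpa [SignedMeasure.totalVariation] using hx r)).2
  have hopen : ∀ s, 0 < s → ¬ (0 < |μ (Metric.closedBall x s)| ∧ |μ (Metric.closedBall x s)| < δ) := by
    by_contra! hcon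
    obtain ⟨s, hs, hs1, hs2⟩ := hcon
    have hO : IsOpen {s : ℝ | 0 < s ∧ 0 < |μ (Metric.closedBall x s)| ∧
        |μ (Metric.closedBall x s)| < δ} :=
      (isOpen_lt continuous_const continuous_id).inter
        ((isOpen_lt continuous_const hcont).inter (isOpen_lt hcont continuous_const))
    have hpos := hO.measure_pos volume ⟨s, hs, hs1, hs2⟩
    rw [ae_restrict_iff' measurableSet_Ioi] at hgap
    refine hpos.ne' (measure_mono_null (fun t ht => ?_) hgap)
    simp only [mem_compl_iff]
    exact fun hc => hc ht.1 hP ht.2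
  by_contra hne
  have hpos : 0 < |μ (Metric.closedBall x r)| := abs_pos.2 hne
  have hge : δ ≤ |μ (Metric.closedBall x r)| := by
    by_contra! hlt
    exact hopen r hr ⟨hpos, hlt⟩
  have h0 : |μ (Metric.closedBall x 0)| = 0 := by simp [hμ x]
  obtain ⟨s, hs, hs2⟩ := intermediate_value_Icc hr.le hcont.continuousOn
    (show δ / 2 ∈ Icc (|μ (Metric.closedBall x 0)|) (|μ (Metric.closedBall x r)|) from
      ⟨by rw [h0]; positivity, by linarith⟩)
  simp only at hs2
  have hs0 : 0 < s := by
    rcases hs.1.lt_or_eq with h | h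
    · exact h
    · rw [← h, h0] at hs2; linarith
  exact hopen s hs0 ⟨by rw [hs2]; positivity, by rw [hs2]; linarith⟩

/-! ### Integrability on `ℝ^d × (0, ∞)` -/

lemma lintegral_min_rpow_lt_top {p q β C : ℝ} (hpβ : p < β) (hβq : β < q) (hC : 0 ≤ C) :
    ∫⁻ r in Ioi (0 : ℝ), ENNReal.ofReal (C * min (r ^ p) (r ^ q) * r ^ (-β - 1)) < ⊤ := by
  rw [← Ioc_union_Ioi_eq_Ioi (zero_le_one (α := ℝ)), lintegral_union measurableSet_Ioi
    (Ioc_disjoint_Ioi le_rfl)]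
  refine ENNReal.add_lt_top.2 ⟨?_, ?_⟩
  · have hi : IntegrableOn (fun r : ℝ => C * r ^ (q - β - 1)) (Ioc 0 1) :=
      ((intervalIntegrable_iff_integrableOn_Ioc_of_le zero_le_one).1
        (intervalIntegral.intervalIntegrable_rpow' (by linarith))).const_mul C
    refine (setLIntegral_mono' measurableSet_Ioc fun r hr => ?_).trans_lt
      hi.lintegral_lt_top
    have hr0 := hr.1
    apply ENNReal.ofReal_le_ofReal
    rw [mul_assoc, show q - β - 1 = q + (-β - 1) by ring, Real.rpow_add hr0]
    gcongr
    exact min_le_right _ _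
  · have hi : IntegrableOn (fun r : ℝ => C * r ^ (p - β - 1)) (Ioi 1) :=
      (integrableOn_Ioi_rpow_of_lt (by linarith) one_pos).const_mul C
    refine (setLIntegral_mono' measurableSet_Ioi fun r hr => ?_).trans_lt
      hi.lintegral_lt_top
    have hr0 : 0 < r := one_pos.trans hr
    apply ENNReal.ofReal_le_ofReal
    rw [mul_assoc, show p - β - 1 = p + (-β - 1) by ring, Real.rpow_add hr0]
    gcongr
    exact min_le_left _ _

lemma integrable_dxdr_of_lintegral_le {E : Type*} [NormedAddCommGroup E] {g : Space d × ℝ → E}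
    {p q β C : ℝ} (hg : AEStronglyMeasurable g (dxdr d)) (hpβ : p < β) (hβq : β < q) (hC : 0 ≤ C)
    (h : ∀ r : ℝ, 0 < r → ∫⁻ x, ‖g (x, r)‖ₑ ≤
      ENNReal.ofReal (C * min (r ^ p) (r ^ q) * r ^ (-β - 1))) :
    Integrable g (dxdr d) := by
  refine ⟨hg, ?_⟩
  rw [HasFiniteIntegral, dxdr, lintegral_prod_symm _ hg.enorm]
  exact (setLIntegral_mono' measurableSet_Ioi fun r hr => h r hr).trans_lt
    (lintegral_min_rpow_lt_top hpβ hβq hC)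

lemma ae_dxdr_pos (d : ℕ) : ∀ᵐ z ∂dxdr d, 0 < z.2 := by
  have : ∀ᵐ r ∂(volume.restrict (Ioi (0 : ℝ))), 0 < r := ae_restrict_mem measurableSet_Ioi
  exact Measure.quasiMeasurePreserving_snd.ae this

lemma MClass.integrable {α β : ℝ} {μ : SignedMeasure (Space d)} (hμ : MClass α β μ) :
    Integrable (fun z : Space d × ℝ => |μ (Metric.closedBall z.1 z.2)| ^ α * z.2 ^ (-β - 1))
      (dxdr d) := by
  obtain ⟨p, q, C, hp, hpβ, hβq, hq, hC, hbd⟩ := hμ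
  refine integrable_dxdr_of_lintegral_le (p := p) (q := q) (C := C) ?_ hpβ hβq hC.le fun r hr => ?_
  · exact (((measurable_signedMeasure_closedBall μ).norm.pow_const α).mul
      (measurable_snd.pow_const _)).aestronglyMeasurable
  · have hr' : 0 ≤ r ^ (-β - 1) := by positivity
    have : ∀ x, ‖|μ (Metric.closedBall x r)| ^ α * r ^ (-β - 1)‖ₑ =
        ENNReal.ofReal (|μ (Metric.closedBall x r)| ^ α) * ENNReal.ofReal (r ^ (-β - 1)) := by
      intro x
      rw [Real.enorm_eq_ofReal (by positivity), ENNReal.ofReal_mul (by positivity)]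
    simp_rw [this]
    rw [lintegral_mul_const' _ _ (by simp), ENNReal.ofReal_mul (by positivity)]
    gcongr
    exact hbd r hr

end

section

variable {d : ℕ}

/-! ### Rescaled radii and kernels -/

/-- The hypotheses on the density `f` of the radii used for the scaling limits. -/
structure RadiusDensity (β Cβ C₀ : ℝ) (f : ℝ → ℝ) : Prop where
  measurable : Measurable f
  nonneg : ∀ r, 0 < r → 0 ≤ f r
  equiv : f ~[atTop] fun r => Cβ / r ^ (β + 1)
  le : ∀ r, 0 < r → f r ≤ C₀ / r ^ (β + 1)
  pos : 0 < Cβ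
  pos' : 0 < C₀

/-- The rescaled radius density `ρ^{-β} f(r/ρ)/ρ`, which converges to `C_β r^{-β-1}`. -/
noncomputable def radiusScale (β : ℝ) (f : ℝ → ℝ) (ρ r : ℝ) : ℝ := f (r / ρ) / ρ / ρ ^ β

section radiusScale

variable {β Cβ C₀ : ℝ} {f : ℝ → ℝ}

lemma measurable_radiusScale (hf : RadiusDensity β Cβ C₀ f) (ρ : ℝ) :
    Measurable (radiusScale β f ρ) :=
  ((hf.measurable.comp (measurable_id.div_const ρ)).div_const ρ).div_const (ρ ^ β)

lemma radiusScale_nonneg (hf : RadiusDensity β Cβ C₀ f) {ρ r : ℝ} (hρ : 0 < ρ) (hr : 0 < r) :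
    0 ≤ radiusScale β f ρ r := by
  have := hf.nonneg (r / ρ) (by positivity)
  unfold radiusScale; positivity

lemma div_rpow_add_one_eq {ρ r c : ℝ} (hρ : 0 < ρ) (hr : 0 < r) :
    c / (r / ρ) ^ (β + 1) / ρ / ρ ^ β = c * r ^ (-β - 1) := by
  rw [Real.div_rpow hr.le hρ.le, Real.rpow_add_one hρ.ne', show -β - 1 = -(β + 1) by ring,
    Real.rpow_neg hr.le]
  have h1 : 0 < ρ ^ β := by positivity
  have h2 : 0 < r ^ (β + 1) := by positivity
  field_simp

lemma radiusScale_le (hf : RadiusDensity β Cβ C₀ f) {ρ r : ℝ} (hρ : 0 < ρ) (hr : 0 < r) :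
    radiusScale β f ρ r ≤ C₀ * r ^ (-β - 1) := by
  rw [← div_rpow_add_one_eq (c := C₀) hρ hr, radiusScale]
  gcongr
  exact hf.le _ (by positivity)

lemma tendsto_radiusScale (hf : RadiusDensity β Cβ C₀ f) {r : ℝ} (hr : 0 < r) :
    Tendsto (fun ρ => radiusScale β f ρ r) (𝓝[>] 0) (𝓝 (Cβ * r ^ (-β - 1))) := by
  have h1 : Tendsto (fun ρ : ℝ => r / ρ) (𝓝[>] 0) atTop := by
    simpa [div_eq_mul_inv] using tendsto_inv_nhdsGT_zero.const_mul_atTop hr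
  have h2 := hf.equiv.comp_tendsto h1
  have h3 : (fun ρ => radiusScale β f ρ r) ~[𝓝[>] 0] fun _ => Cβ * r ^ (-β - 1) := by
    have h4 := (h2.div (IsEquivalent.refl (u := fun ρ : ℝ => ρ))).div
      (IsEquivalent.refl (u := fun ρ : ℝ => ρ ^ β))
    refine (h4.congr_left (Eventually.of_forall fun ρ => rfl)).congr_right ?_
    filter_upwards [self_mem_nhdsWithin] with ρ hρ
    exact div_rpow_add_one_eq hρ hr
  exact h3.tendsto_const

end radiusScale

/-- The hypotheses on the section `x ↦ k_ρ(x, y)` of the rescaled kernels at a fixed `y`. -/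
structure KernelFamily (k : Space d → ℝ) (κ : ℝ → Space d → ℝ) (lam : ℝ → ℝ) (C₁ K : ℝ) :
    Prop where
  measurable : Measurable k
  nonneg : ∀ x, 0 ≤ k x
  le : ∀ x, k x ≤ K
  lam_pos : ∀ ρ ∈ Ioo (0 : ℝ) 1, 0 < lam ρ
  scaled_measurable : ∀ ρ ∈ Ioo (0 : ℝ) 1, Measurable (κ ρ)
  scaled_nonneg : ∀ ρ ∈ Ioo (0 : ℝ) 1, ∀ x, 0 ≤ κ ρ x
  equiv : ∀ x, (fun ρ => κ ρ x) ~[𝓝[>] (0 : ℝ)] fun ρ => lam ρ * k x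
  scaled_le : ∀ ρ ∈ Ioo (0 : ℝ) 1, ∀ x, κ ρ x ≤ C₁ * lam ρ * k x

lemma Ioo_mem_nhdsGT_zero : Ioo (0 : ℝ) 1 ∈ 𝓝[>] (0 : ℝ) := Ioo_mem_nhdsGT one_pos

section KernelFamily

variable {k : Space d → ℝ} {κ : ℝ → Space d → ℝ} {lam : ℝ → ℝ} {C₁ K : ℝ}

lemma KernelFamily.scaled_eq_zero (hk : KernelFamily k κ lam C₁ K) {ρ : ℝ} (hρ : ρ ∈ Ioo (0 : ℝ) 1)
    {x : Space d} (hx : k x = 0) : κ ρ x = 0 :=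
  le_antisymm (by simpa [hx] using hk.scaled_le ρ hρ x) (hk.scaled_nonneg ρ hρ x)

lemma KernelFamily.bound_nonneg (hk : KernelFamily k κ lam C₁ K) : 0 ≤ K :=
  (hk.nonneg 0).trans (hk.le 0)

lemma KernelFamily.div_nonneg (hk : KernelFamily k κ lam C₁ K) {ρ : ℝ} (hρ : ρ ∈ Ioo (0 : ℝ) 1)
    (x : Space d) : 0 ≤ κ ρ x / lam ρ :=
  _root_.div_nonneg (hk.scaled_nonneg ρ hρ x) (hk.lam_pos ρ hρ).le

lemma KernelFamily.div_le (hk : KernelFamily k κ lam C₁ K) {ρ : ℝ} (hρ : ρ ∈ Ioo (0 : ℝ) 1)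
    (x : Space d) : κ ρ x / lam ρ ≤ |C₁| * K := by
  rw [div_le_iff₀ (hk.lam_pos ρ hρ)]
  refine (hk.scaled_le ρ hρ x).trans ?_
  have h1 := hk.lam_pos ρ hρ
  calc C₁ * lam ρ * k x ≤ |C₁| * lam ρ * K := by
        have := hk.nonneg x
        gcongr
        · exact le_abs_self _
        · exact hk.le x
    _ = _ := by ring

lemma KernelFamily.tendsto_div (hk : KernelFamily k κ lam C₁ K) (x : Space d) :
    Tendsto (fun ρ => κ ρ x / lam ρ) (𝓝[>] 0) (𝓝 (k x)) := by
  have h1 := (hk.equiv x).div (IsEquivalent.refl (u := lam))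
  have h2 : (fun ρ => κ ρ x / lam ρ) ~[𝓝[>] 0] fun _ => k x := by
    refine (h1.congr_left (Eventually.of_forall fun ρ => rfl)).congr_right ?_
    filter_upwards [Ioo_mem_nhdsGT_zero] with ρ hρ
    have := (hk.lam_pos ρ hρ).ne'
    simp only [Pi.div_apply]
    field_simp
  exact h2.tendsto_const

end KernelFamily

/-- A function with a normalized limit `J` is equivalent to `w * J`; for `J = 0` this means that it
vanishes eventually. -/
lemma isEquivalent_of_tendsto_mul {l : Filter ℝ} {c w : ℝ → ℂ} {I : ℝ → ℂ} {J : ℂ}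
    (hcw : ∀ᶠ ρ in l, w ρ * c ρ = 1) (h : Tendsto (fun ρ => c ρ * I ρ) l (𝓝 J))
    (h0 : J ≠ 0 ∨ ∀ᶠ ρ in l, I ρ = 0) : I ~[l] fun ρ => w ρ * J := by
  by_cases hJ : J = 0
  · have hI : I =ᶠ[l] fun _ => 0 := h0.resolve_left (not_not.2 hJ)
    rw [hJ]
    refine (IsEquivalent.refl (u := fun _ => (0 : ℂ))).congr_left hI.symm |>.congr_right ?_
    exact Eventually.of_forall fun ρ => by simp
  · have h1 := (isEquivalent_const_iff_tendsto hJ).2 h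
    have h2 := (IsEquivalent.refl (u := w) (l := l)).mul h1
    refine h2.congr_left ?_
    filter_upwards [hcw] with ρ hρ
    simp only [Pi.mul_apply]
    rw [← mul_assoc, hρ, one_mul]

/-! ### Scaling limits for measures of the class `M_{α,β}` -/

section MClass

variable {α β Cβ C₀ C₁ K A : ℝ} {f : ℝ → ℝ} {k : Space d → ℝ} {κ : ℝ → Space d → ℝ} {lam : ℝ → ℝ}
  {μ : SignedMeasure (Space d)}

/-- A kernel, radius and ball-measure integrand is integrable when it is of order
`|μ(B(x,r))|^α r^{-β-1}`. -/
lemma integrable_of_le_rpow (hμ : MClass α β μ) {Φ : ℝ → ℂ} (hΦ : Measurable Φ)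
    (hA : ∀ v, ‖Φ v‖ ≤ A * |v| ^ α) {κ₀ : Space d → ℝ} (hκm : Measurable κ₀)
    (hκ0 : ∀ x, 0 ≤ κ₀ x) {B : ℝ} (hκB : ∀ x, κ₀ x ≤ B) {R : ℝ → ℝ} (hRm : Measurable R)
    (hR0 : ∀ r, 0 < r → 0 ≤ R r) {D : ℝ} (hRD : ∀ r, 0 < r → R r ≤ D * r ^ (-β - 1)) :
    Integrable (fun z : Space d × ℝ =>
      Φ (μ (Metric.closedBall z.1 z.2)) * ((κ₀ z.1 * R z.2 : ℝ) : ℂ)) (dxdr d) := by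
  refine (hμ.integrable.const_mul (A * B * D)).mono' ?_ ?_
  · exact ((hΦ.comp (measurable_signedMeasure_closedBall μ)).mul
      (Complex.measurable_ofReal.comp
        ((hκm.comp measurable_fst).mul (hRm.comp measurable_snd)))).aestronglyMeasurable
  · filter_upwards [ae_dxdr_pos d] with z hz
    have hRn := hR0 z.2 hz
    have hκn := hκ0 z.1
    rw [norm_mul, Complex.norm_real, Real.norm_of_nonneg (mul_nonneg hκn hRn)]
    calc _ ≤ (A * |μ (Metric.closedBall z.1 z.2)| ^ α) * (B * (D * z.2 ^ (-β - 1))) := by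
          have h1 := hA (μ (Metric.closedBall z.1 z.2))
          have h0 := (norm_nonneg _).trans h1
          have hB := hκn.trans (hκB z.1)
          gcongr
          · exact hκB z.1
          · exact hRD z.2 hz
      _ = _ := by ring

lemma integrable_scaled (hf : RadiusDensity β Cβ C₀ f) (hk : KernelFamily k κ lam C₁ K)
    (hμ : MClass α β μ) {Φ : ℝ → ℂ} (hΦ : Measurable Φ) (hA : ∀ v, ‖Φ v‖ ≤ A * |v| ^ α)
    {ρ : ℝ} (hρ : ρ ∈ Ioo (0 : ℝ) 1) :
    Integrable (fun z : Space d × ℝ => Φ (μ (Metric.closedBall z.1 z.2)) *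
      ((κ ρ z.1 / lam ρ * radiusScale β f ρ z.2 : ℝ) : ℂ)) (dxdr d) :=
  integrable_of_le_rpow hμ hΦ hA ((hk.scaled_measurable ρ hρ).div_const _) (hk.div_nonneg hρ)
    (hk.div_le hρ) (measurable_radiusScale hf ρ) (fun _ hr => radiusScale_nonneg hf hρ.1 hr)
    (fun _ hr => radiusScale_le hf hρ.1 hr)

lemma integrable_limit (hCβ : 0 < Cβ) (hk : KernelFamily k κ lam C₁ K)
    (hμ : MClass α β μ) {Φ : ℝ → ℂ} (hΦ : Measurable Φ) (hA : ∀ v, ‖Φ v‖ ≤ A * |v| ^ α) :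
    Integrable (fun z : Space d × ℝ => Φ (μ (Metric.closedBall z.1 z.2)) *
      ((k z.1 * (Cβ * z.2 ^ (-β - 1)) : ℝ) : ℂ)) (dxdr d) :=
  integrable_of_le_rpow hμ hΦ hA hk.measurable hk.nonneg hk.le (by fun_prop)
    (fun _ hr => by positivity) (fun _ _ => le_rfl)

/-- Dominated convergence on `ℝ^d × (0, ∞)`, with dominating function a multiple of
`|μ(B(x,r))|^α r^{-β-1}`. -/
lemma tendsto_integral_scaled (hf : RadiusDensity β Cβ C₀ f) (hk : KernelFamily k κ lam C₁ K)
    (hμ : MClass α β μ) {Φ : ℝ → ℝ → ℂ} {Φ₀ : ℝ → ℂ}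
    (hΦ : ∀ ρ ∈ Ioo (0 : ℝ) 1, Measurable (Φ ρ))
    (hA : ∀ ρ ∈ Ioo (0 : ℝ) 1, ∀ v, ‖Φ ρ v‖ ≤ A * |v| ^ α)
    (hlim : ∀ v, Tendsto (fun ρ => Φ ρ v) (𝓝[>] 0) (𝓝 (Φ₀ v))) :
    Tendsto (fun ρ => ∫ z, Φ ρ (μ (Metric.closedBall z.1 z.2)) *
      ((κ ρ z.1 / lam ρ * radiusScale β f ρ z.2 : ℝ) : ℂ) ∂dxdr d) (𝓝[>] 0)
      (𝓝 (∫ z, Φ₀ (μ (Metric.closedBall z.1 z.2)) *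
        ((k z.1 * (Cβ * z.2 ^ (-β - 1)) : ℝ) : ℂ) ∂dxdr d)) := by
  refine tendsto_integral_filter_of_dominated_convergence
    (fun z => A * (|C₁| * K) * C₀ * (|μ (Metric.closedBall z.1 z.2)| ^ α * z.2 ^ (-β - 1)))
    ?_ ?_ (hμ.integrable.const_mul _) ?_
  · filter_upwards [Ioo_mem_nhdsGT_zero] with ρ hρ
    exact (integrable_scaled hf hk hμ (hΦ ρ hρ) (hA ρ hρ) hρ).aestronglyMeasurable
  · filter_upwards [Ioo_mem_nhdsGT_zero] with ρ hρ
    filter_upwards [ae_dxdr_pos d] with z hz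
    have hRn := radiusScale_nonneg hf hρ.1 hz
    have hκn := hk.div_nonneg hρ z.1
    rw [norm_mul, Complex.norm_real, Real.norm_of_nonneg (mul_nonneg hκn hRn)]
    calc _ ≤ (A * |μ (Metric.closedBall z.1 z.2)| ^ α) *
          ((|C₁| * K) * (C₀ * z.2 ^ (-β - 1))) := by
          have h1 := hA ρ hρ (μ (Metric.closedBall z.1 z.2))
          have h0 := (norm_nonneg _).trans h1
          have hB := hk.bound_nonneg
          gcongr
          · exact hk.div_le hρ z.1
          · exact radiusScale_le hf hρ.1 hz
      _ = _ := by ring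
  · filter_upwards [ae_dxdr_pos d] with z hz
    exact (hlim _).mul ((Complex.continuous_ofReal.tendsto _).comp
      ((hk.tendsto_div z.1).mul (tendsto_radiusScale hf hz)))

end MClass

/-- Multiplying the integrand at scale `ρ` by `c / (lam ρ * ρ ^ β)` expresses it through
`radiusScale`. -/
lemma mul_scaledIntegrand {G : Measure ℝ} {μ : SignedMeasure (Space d)}
    {κ : Space d → Space d → ℝ} {f : ℝ → ℝ} {β ρ n θ l c : ℝ} {y : Space d} (z : Space d × ℝ) :
    ((c / (l * ρ ^ β) : ℝ) : ℂ) * scaledIntegrand G μ κ f ρ n θ y z =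
      ((c : ℂ) * psiG G (θ * μ (Metric.closedBall z.1 z.2) / n)) *
        ((κ z.1 y / l * radiusScale β f ρ z.2 : ℝ) : ℂ) := by
  rw [scaledIntegrand, radiusScale]
  push_cast
  ring

lemma integral_scaledIntegrand_eq_zero {G : Measure ℝ} {μ : SignedMeasure (Space d)}
    {k : Space d → Space d → ℝ} {kρ : ℝ → Space d → Space d → ℝ} {lam : ℝ → ℝ} {C₁ K : ℝ}
    {f : ℝ → ℝ} {ρ n θ : ℝ} {y : Space d}
    (hk : KernelFamily (fun x => k x y) (fun ρ x => kρ ρ x y) lam C₁ K) (hρ : ρ ∈ Ioo (0 : ℝ) 1)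
    (h : ∀ᵐ z ∂dxdr d, θ * μ (Metric.closedBall z.1 z.2) = 0 ∨ k z.1 y = 0) :
    ∫ z, scaledIntegrand G μ (kρ ρ) f ρ n θ y z ∂dxdr d = 0 := by
  refine integral_eq_zero_of_ae ?_
  filter_upwards [h] with z hz
  rcases hz with hz | hz
  · simp [scaledIntegrand, hz]
  · have h0 : kρ ρ z.1 y = 0 := hk.scaled_eq_zero hρ hz
    simp [scaledIntegrand, h0]

lemma integrable_scaledIntegrand {α β Cβ C₀ C : ℝ} {G : Measure ℝ} [IsProbabilityMeasure G]
    (hT : TruncSqBound α C G)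
    {μ : SignedMeasure (Space d)} (hμ : MClass α β μ)
    {k : Space d → Space d → ℝ} {kρ : ℝ → Space d → Space d → ℝ} {lam : ℝ → ℝ} {C₁ K : ℝ}
    {f : ℝ → ℝ} {ρ n θ : ℝ} {y : Space d} (hf : RadiusDensity β Cβ C₀ f)
    (hk : KernelFamily (fun x => k x y) (fun ρ x => kρ ρ x y) lam C₁ K) (hρ : ρ ∈ Ioo (0 : ℝ) 1) :
    Integrable (scaledIntegrand G μ (kρ ρ) f ρ n θ y) (dxdr d) := by
  have h1 := integrable_scaled (A := 2 * C * |θ / n| ^ α) hf hk hμ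
    (Φ := fun v => psiG G (θ * v / n)) (hT.continuous_psiG.comp (by fun_prop)).measurable
    (fun v => by
      refine (hT.norm_psiG_le _).trans (le_of_eq ?_)
      rw [show θ * v / n = θ / n * v by ring, abs_mul, Real.mul_rpow (abs_nonneg _) (abs_nonneg _),
        mul_assoc (2 * C)]) hρ
  refine (h1.const_mul (((lam ρ * ρ ^ β : ℝ)) : ℂ)).congr (ae_of_all _ fun z => ?_)
  have h2 := mul_scaledIntegrand (G := G) (μ := μ) (κ := kρ ρ) (f := f) (β := β) (ρ := ρ) (n := n)
    (θ := θ) (l := lam ρ) (c := 1) (y := y) z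
  simp only [Complex.ofReal_one, one_mul] at h2
  simp only
  rw [← h2, ← mul_assoc, ← Complex.ofReal_mul]
  have := (hk.lam_pos ρ hρ).ne'
  have := (Real.rpow_pos_of_pos hρ.1 β).ne'
  rw [mul_one_div_cancel (by positivity), Complex.ofReal_one, one_mul]

end

section

variable {d : ℕ} {α σ b β Cβ C₀ C₁ K C : ℝ} {G : Measure ℝ} [IsProbabilityMeasure G]
  {f : ℝ → ℝ} {k : Space d → Space d → ℝ} {kρ : ℝ → Space d → Space d → ℝ} {lam : ℝ → ℝ}
  {μ : SignedMeasure (Space d)} {y : Space d}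

/-! ### The limit when `n(ρ) → ∞` -/

lemma measurable_real_sign : Measurable Real.sign := by
  unfold Real.sign
  exact Measurable.ite measurableSet_Iio measurable_const
    (Measurable.ite measurableSet_Ioi measurable_const measurable_const)

omit [IsProbabilityMeasure G] in
lemma integrable_stableIntegrand (hb : b ∈ Icc (-1 : ℝ) 1) (hCβ : 0 < Cβ)
    (hk : KernelFamily (fun x => k x y) (fun ρ x => kρ ρ x y) lam C₁ K) (hμ : MClass α β μ)
    (θ : ℝ) : Integrable (stableIntegrand α β b Cβ μ k θ y) (dxdr d) := by
  have h := integrable_limit (A := 1 + |Real.tan (Real.pi * α / 2)|) hCβ hk hμ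
    (Φ := fun v => ((|v| ^ α : ℝ) : ℂ) *
      (1 - Complex.I * ((Real.sign (θ * v) * Real.tan (Real.pi * α / 2) * b : ℝ) : ℂ)))
    ?_ (fun v => ?_)
  · exact h
  · have h1 : Measurable fun v : ℝ => Real.sign (θ * v) * Real.tan (Real.pi * α / 2) * b :=
      ((measurable_real_sign.comp (measurable_const_mul θ)).mul_const _).mul_const _
    have h2 : Measurable fun v : ℝ => |v| ^ α := measurable_norm.pow_const α
    exact (Complex.measurable_ofReal.comp h2).mul
      (measurable_const.sub ((Complex.measurable_ofReal.comp h1).const_mul _))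
  · have h0 : 0 ≤ |v| ^ α := by positivity
    rw [norm_mul, Complex.norm_real, Real.norm_of_nonneg h0, mul_comm]
    gcongr
    refine (norm_sub_le _ _).trans ?_
    rw [norm_one, norm_mul, Complex.norm_I, one_mul, Complex.norm_real, Real.norm_eq_abs, abs_mul,
      abs_mul]
    have h1 : |b| ≤ 1 := abs_le.2 hb
    have h2 : |Real.sign (θ * v)| ≤ 1 := by
      rcases Real.sign_apply_eq (θ * v) with h | h | h <;> simp [h]
    have h3 : |Real.sign (θ * v)| * |b| ≤ 1 := mul_le_one₀ h2 (abs_nonneg _) h1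
    nlinarith [abs_nonneg (Real.tan (Real.pi * α / 2))]

/-- The integral of the stable integrand vanishes only if its real part, which is nonnegative,
vanishes almost everywhere. -/
lemma ae_eq_zero_of_integral_stableIntegrand_eq_zero (hα : 1 < α) (hb : b ∈ Icc (-1 : ℝ) 1)
    (hCβ : 0 < Cβ)
    (hk : KernelFamily (fun x => k x y) (fun ρ x => kρ ρ x y) lam C₁ K) (hμ : MClass α β μ) {θ : ℝ}
    (h0 : ∫ z, stableIntegrand α β b Cβ μ k θ y z ∂dxdr d = 0) :
    ∀ᵐ z ∂dxdr d, μ (Metric.closedBall z.1 z.2) = 0 ∨ k z.1 y = 0 := by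
  have hint := integrable_stableIntegrand hb hCβ hk hμ θ
  have hre : ∀ z, (stableIntegrand α β b Cβ μ k θ y z).re =
      |μ (Metric.closedBall z.1 z.2)| ^ α * (k z.1 y * (Cβ * z.2 ^ (-β - 1))) := by
    intro z
    rw [stableIntegrand, Complex.re_mul_ofReal, Complex.re_ofReal_mul, Complex.sub_re,
      Complex.re_mul_ofReal]
    simp
  have h1 : ∫ z, (stableIntegrand α β b Cβ μ k θ y z).re ∂dxdr d = 0 := by
    have h2 := integral_re hint
    rw [h0] at h2
    simpa using h2
  rw [integral_eq_zero_iff_of_nonneg_ae] at h1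
  · filter_upwards [h1, ae_dxdr_pos d] with z hz hz0
    rw [hre] at hz
    have hr : 0 < z.2 ^ (-β - 1) := by positivity
    rcases mul_eq_zero.1 hz with h | h
    · left
      exact abs_eq_zero.1 ((Real.rpow_eq_zero (abs_nonneg _) (by linarith)).1 h)
    · right
      exact (mul_eq_zero.1 h).resolve_right (by positivity)
  · filter_upwards [ae_dxdr_pos d] with z hz0
    rw [hre]
    have := hk.nonneg z.1
    simp only [Pi.zero_apply]
    positivity
  · exact hint.re

omit [IsProbabilityMeasure G] in
lemma integral_neg_stableExponent (θ : ℝ) :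
    ∫ z, -stableExponent α σ b (θ * μ (Metric.closedBall z.1 z.2)) *
      ((k z.1 y * (Cβ * z.2 ^ (-β - 1)) : ℝ) : ℂ) ∂dxdr d =
    -((σ ^ α * |θ| ^ α : ℝ) : ℂ) * ∫ z, stableIntegrand α β b Cβ μ k θ y z ∂dxdr d := by
  rw [← integral_const_mul]
  congr with z
  rw [stableExponent, stableIntegrand, abs_mul, Real.mul_rpow (abs_nonneg _) (abs_nonneg _)]
  push_cast
  ring

lemma isEquivalent_integral_scaledIntegrand_atTop (hα : 1 < α) (hα2 : α ≤ 2) (hσ : 0 < σ)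
    (hb : b ∈ Icc (-1 : ℝ) 1) (hG : NormalDomainOfAttraction α σ b G) (hT : TruncSqBound α C G)
    (hf : RadiusDensity β Cβ C₀ f)
    (hk : KernelFamily (fun x => k x y) (fun ρ x => kρ ρ x y) lam C₁ K)
    (hmean : α = 2 → ∫ m, m ∂G = 0) {n : ℝ → ℝ} (hn0 : ∀ ρ ∈ Ioo (0 : ℝ) 1, 0 < n ρ)
    (hn : Tendsto n (𝓝[>] 0) atTop) (hμ : MClass α β μ) (θ : ℝ) :
    (fun ρ => ∫ z, scaledIntegrand G μ (kρ ρ) f ρ (n ρ) θ y z ∂dxdr d) ~[𝓝[>] (0 : ℝ)]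
      (fun ρ => -((σ ^ α * |θ| ^ α * (lam ρ * ρ ^ β / n ρ ^ α) : ℝ) : ℂ) *
        ∫ z, stableIntegrand α β b Cβ μ k θ y z ∂dxdr d) := by
  have hlim := tendsto_integral_scaled (A := 2 * C * |θ| ^ α) hf hk hμ
    (Φ := fun ρ v => ((n ρ ^ α : ℝ) : ℂ) * psiG G (θ * v / n ρ))
    (Φ₀ := fun v => -stableExponent α σ b (θ * v))
    (fun ρ _ => (continuous_const.mul (hT.continuous_psiG.comp (by fun_prop))).measurable)
    (fun ρ hρ v => by
      have hnρ := hn0 ρ hρ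
      rw [norm_mul, Complex.norm_real, Real.norm_of_nonneg (by positivity)]
      calc _ ≤ n ρ ^ α * (2 * C * |θ * v / n ρ| ^ α) := by gcongr; exact hT.norm_psiG_le _
        _ = _ := by
          rw [abs_div, abs_of_pos hnρ, Real.div_rpow (abs_nonneg _) hnρ.le, abs_mul,
            Real.mul_rpow (abs_nonneg _) (abs_nonneg _)]
          field_simp)
    (fun v => (tendsto_rpow_mul_psiG_div hα hα2 hσ hb hG hT hmean (θ * v)).comp hn)
  rw [integral_neg_stableExponent] at hlim
  have h2 := isEquivalent_of_tendsto_mul (c := fun ρ => ((n ρ ^ α / (lam ρ * ρ ^ β) : ℝ) : ℂ))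
    (w := fun ρ => ((lam ρ * ρ ^ β / n ρ ^ α : ℝ) : ℂ))
    (I := fun ρ => ∫ z, scaledIntegrand G μ (kρ ρ) f ρ (n ρ) θ y z ∂dxdr d) ?_
    (hlim.congr fun ρ => ?_) ?_
  · refine h2.congr_right (Eventually.of_forall fun ρ => ?_)
    push_cast; ring
  · filter_upwards [Ioo_mem_nhdsGT_zero] with ρ hρ
    have h1 := hk.lam_pos ρ hρ
    have h3 := Real.rpow_pos_of_pos hρ.1 β
    have h4 := Real.rpow_pos_of_pos (hn0 ρ hρ) α
    rw [← Complex.ofReal_mul, ← Complex.ofReal_one]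
    congr 1
    field_simp
  · rw [← integral_const_mul]
    simp_rw [mul_scaledIntegrand]
  · rw [or_iff_not_imp_left, not_not]
    intro hJ
    filter_upwards [Ioo_mem_nhdsGT_zero] with ρ hρ
    refine integral_scaledIntegrand_eq_zero hk hρ ?_
    rcases mul_eq_zero.1 hJ with h | h
    · have hθ : θ = 0 := by
        have h5 := Real.rpow_pos_of_pos hσ α
        rw [neg_eq_zero, Complex.ofReal_eq_zero, mul_eq_zero, or_iff_right h5.ne',
          Real.rpow_eq_zero (abs_nonneg _) (by linarith), abs_eq_zero] at h
        exact h
      simp [hθ]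
    · filter_upwards [ae_eq_zero_of_integral_stableIntegrand_eq_zero hα hb hf.pos hk hμ h] with z hz
      rcases hz with hz | hz
      · left; rw [hz, mul_zero]
      · right; exact hz

/-! ### The limit when `n(ρ) = 1` -/

lemma integrable_poissonIntegrand (hT : TruncSqBound α C G) (hCβ : 0 < Cβ)
    (hk : KernelFamily (fun x => k x y) (fun ρ x => kρ ρ x y) lam C₁ K) (hμ : MClass α β μ)
    (θ : ℝ) : Integrable (poissonIntegrand β Cβ G μ k θ y) (dxdr d) :=
  integrable_limit (A := 2 * C * |θ| ^ α) hCβ hk hμ (Φ := fun v => psiG G (θ * v))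
    (hT.continuous_psiG.comp (by fun_prop)).measurable (fun v => by
      refine (hT.norm_psiG_le _).trans (le_of_eq ?_)
      rw [abs_mul, Real.mul_rpow (abs_nonneg _) (abs_nonneg _), mul_assoc (2 * C)])

omit [IsProbabilityMeasure G] in
/-- An integral of `ψ_G(g)` against a nonnegative weight can vanish only if, almost everywhere, the
weight vanishes or `g` is a zero of the nonpositive function `Re ψ_G`. -/
lemma TruncSqBound.ae_of_integral_eq_zero (hT : TruncSqBound α C G) {g W : Space d × ℝ → ℝ}
    (hW : ∀ᵐ z ∂dxdr d, 0 ≤ W z)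
    (hint : Integrable (fun z => psiG G (g z) * (W z : ℂ)) (dxdr d))
    (h0 : ∫ z, psiG G (g z) * (W z : ℂ) ∂dxdr d = 0) :
    ∀ᵐ z ∂dxdr d, (psiG G (g z)).re = 0 ∨ W z = 0 := by
  have h1 : ∫ z, -(psiG G (g z) * (W z : ℂ)).re ∂dxdr d = 0 := by
    have h2 := integral_re hint
    rw [h0] at h2
    rw [integral_neg, neg_eq_zero]
    simpa using h2
  rw [integral_eq_zero_iff_of_nonneg_ae] at h1
  · filter_upwards [h1] with z hz
    rw [Complex.re_mul_ofReal] at hz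
    exact mul_eq_zero.1 (neg_eq_zero.1 hz)
  · filter_upwards [hW] with z hz
    rw [Complex.re_mul_ofReal]
    simp only [Pi.zero_apply]
    nlinarith [hT.psiG_re_nonpos (g z)]
  · exact hint.re.neg

lemma isEquivalent_integral_scaledIntegrand_one (hα : 1 < α) (hσ : 0 < σ)
    (hb : b ∈ Icc (-1 : ℝ) 1) (hβ : (d : ℝ) < β) (hG : NormalDomainOfAttraction α σ b G)
    (hT : TruncSqBound α C G) (hf : RadiusDensity β Cβ C₀ f)
    (hk : KernelFamily (fun x => k x y) (fun ρ x => kρ ρ x y) lam C₁ K)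
    (hμ : MClass α β μ) (θ : ℝ) :
    (fun ρ => ∫ z, scaledIntegrand G μ (kρ ρ) f ρ 1 θ y z ∂dxdr d) ~[𝓝[>] (0 : ℝ)]
      (fun ρ => ((lam ρ * ρ ^ β : ℝ) : ℂ) * ∫ z, poissonIntegrand β Cβ G μ k θ y z ∂dxdr d) := by
  have hlim := tendsto_integral_scaled (A := 2 * C * |θ| ^ α) hf hk hμ
    (Φ := fun _ v => psiG G (θ * v)) (Φ₀ := fun v => psiG G (θ * v))
    (fun ρ _ => (hT.continuous_psiG.comp (by fun_prop)).measurable)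
    (fun ρ hρ v => by
      refine (hT.norm_psiG_le _).trans (le_of_eq ?_)
      rw [abs_mul, Real.mul_rpow (abs_nonneg _) (abs_nonneg _), mul_assoc (2 * C)])
    (fun v => tendsto_const_nhds)
  refine isEquivalent_of_tendsto_mul (c := fun ρ => ((1 / (lam ρ * ρ ^ β) : ℝ) : ℂ)) ?_
    (hlim.congr fun ρ => ?_) ?_
  · filter_upwards [Ioo_mem_nhdsGT_zero] with ρ hρ
    have h1 := hk.lam_pos ρ hρ
    have h3 := Real.rpow_pos_of_pos hρ.1 β
    rw [← Complex.ofReal_mul, ← Complex.ofReal_one]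
    congr 1
    field_simp
  · rw [← integral_const_mul]
    simp_rw [mul_scaledIntegrand]
    simp
  · rw [or_iff_not_imp_left, not_not]
    intro h0
    filter_upwards [Ioo_mem_nhdsGT_zero] with ρ hρ
    refine integral_scaledIntegrand_eq_zero hk hρ ?_
    rcases eq_or_ne θ 0 with rfl | hθ
    · simp
    obtain ⟨δ, hδ, hneg⟩ := hT.exists_psiG_re_neg (hG.measure_ne_zero_ne_zero hα hσ hb)
    have hθ' : 0 < |θ| := abs_pos.2 hθ
    have hae := hT.ae_of_integral_eq_zero
      (g := fun z : Space d × ℝ => θ * μ (Metric.closedBall z.1 z.2))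
      (W := fun z => k z.1 y * (Cβ * z.2 ^ (-β - 1))) ?_
      (integrable_poissonIntegrand hT hf.pos hk hμ θ) h0
    · have hgap := ae_apply_closedBall_eq_zero_of_gap μ (fun z => hμ.apply_singleton hα hβ z)
        (P := fun x => k x y ≠ 0) (δ := δ / |θ|) (by positivity) ?_
      · have hgap' : ∀ᵐ z ∂dxdr d, k z.1 y ≠ 0 → ∀ r, 0 < r → μ (Metric.closedBall z.1 r) = 0 :=
          Measure.quasiMeasurePreserving_fst.ae hgap
        filter_upwards [hgap', ae_dxdr_pos d] with z hz hz0
        by_cases hkz : k z.1 y = 0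
        · right; exact hkz
        · left; rw [hz hkz z.2 hz0, mul_zero]
      · filter_upwards [hae, ae_dxdr_pos d] with z hz hz0 hkz hcon
        have hW : k z.1 y * (Cβ * z.2 ^ (-β - 1)) ≠ 0 := by
          have := hf.pos
          exact mul_ne_zero hkz (by positivity)
        refine (hneg (θ * μ (Metric.closedBall z.1 z.2))
          (mul_ne_zero hθ (abs_pos.1 hcon.1)) ?_).ne (hz.resolve_right hW)
        rw [abs_mul, mul_comm]
        exact (lt_div_iff₀ hθ').1 hcon.2
    · filter_upwards [ae_dxdr_pos d] with z hz0
      have h2 := hk.nonneg z.1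
      have h3 := hf.pos
      positivity

end

section

variable {d : ℕ}

/-! ### Ball averages of an integrable function -/

lemma preimage_add_left_closedBall (x : Space d) (r : ℝ) :
    (fun z => x + z) ⁻¹' Metric.closedBall x r = Metric.closedBall 0 r := by
  ext z; simp [Metric.mem_closedBall, dist_eq_norm]

lemma setLIntegral_closedBall_eq (g : Space d → ENNReal) (x : Space d) (r : ℝ) :
    ∫⁻ y in Metric.closedBall x r, g y = ∫⁻ z in Metric.closedBall 0 r, g (x + z) := by
  rw [← preimage_add_left_closedBall x r]
  exact ((measurePreserving_add_left volume x).setLIntegral_comp_preimage_emb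
    (measurableEmbedding_addLeft x) g _).symm

lemma setIntegral_closedBall_eq (g : Space d → ℝ) (x : Space d) (r : ℝ) :
    ∫ y in Metric.closedBall x r, g y = ∫ z in Metric.closedBall 0 r, g (x + z) := by
  rw [← preimage_add_left_closedBall x r]
  exact ((measurePreserving_add_left volume x).setIntegral_preimage_emb
    (measurableEmbedding_addLeft x) g _).symm

lemma lintegral_setLIntegral_closedBall {g : Space d → ENNReal} (hg : Measurable g) (r : ℝ) :
    ∫⁻ x, ∫⁻ y in Metric.closedBall x r, g y =
      volume (Metric.closedBall (0 : Space d) r) * ∫⁻ y, g y := by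
  simp_rw [setLIntegral_closedBall_eq g _ r]
  rw [lintegral_lintegral_swap]
  · simp_rw [lintegral_add_right_eq_self g]
    rw [setLIntegral_const, mul_comm]
  · exact (hg.comp (measurable_fst.add measurable_snd)).aemeasurable

lemma lintegral_enorm_setIntegral_closedBall_le {φ : Space d → ℝ} (hφ : Measurable φ) (r : ℝ) :
    ∫⁻ x, ‖∫ y in Metric.closedBall x r, φ y‖ₑ ≤
      volume (Metric.closedBall (0 : Space d) r) * ∫⁻ y, ‖φ y‖ₑ := by
  rw [← lintegral_setLIntegral_closedBall hφ.enorm]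
  exact lintegral_mono fun x => enorm_integral_le_lintegral_enorm _

/-- Hölder's inequality on each ball, then Tonelli's theorem. -/
lemma lintegral_enorm_rpow_setIntegral_closedBall_le {α : ℝ} (hα : 1 < α) {φ : Space d → ℝ}
    (hφ : Measurable φ) {r : ℝ} (hr : 0 < r) :
    ∫⁻ x, ‖∫ y in Metric.closedBall x r, φ y‖ₑ ^ α ≤
      volume (Metric.closedBall (0 : Space d) r) ^ α * ∫⁻ y, ‖φ y‖ₑ ^ α := by
  have hα0 : 0 < α := by linarith
  set V := volume (Metric.closedBall (0 : Space d) r) with hV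
  have hV0 : V ≠ 0 := (Metric.measure_closedBall_pos _ _ hr).ne'
  have hVt : V ≠ ⊤ := (isCompact_closedBall _ _).measure_lt_top.ne
  have hpt : ∀ x, ‖∫ y in Metric.closedBall x r, φ y‖ₑ ^ α ≤
      V ^ (α - 1) * ∫⁻ y in Metric.closedBall x r, ‖φ y‖ₑ ^ α := by
    intro x
    have h1 := eLpNorm_le_eLpNorm_mul_rpow_measure_univ (p := 1) (q := ENNReal.ofReal α)
      (μ := volume.restrict (Metric.closedBall x r)) (f := φ)
      (by rw [← ENNReal.ofReal_one]; exact ENNReal.ofReal_le_ofReal hα.le)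
      hφ.aestronglyMeasurable
    rw [eLpNorm_one_eq_lintegral_enorm, eLpNorm_eq_lintegral_rpow_enorm_toReal
      (by simpa using hα0) ENNReal.ofReal_ne_top, ENNReal.toReal_ofReal hα0.le,
      Measure.restrict_apply_univ, Measure.addHaar_closedBall_center, ← hV] at h1
    have h2 := (enorm_integral_le_lintegral_enorm (μ := volume.restrict (Metric.closedBall x r))
      φ).trans h1
    calc _ ≤ _ := ENNReal.rpow_le_rpow h2 hα0.le
      _ = _ := by
        rw [ENNReal.mul_rpow_of_nonneg _ _ hα0.le, ← ENNReal.rpow_mul, ← ENNReal.rpow_mul,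
          one_div_mul_cancel hα0.ne', ENNReal.rpow_one, mul_comm]
        congr 2
        simp only [ENNReal.toReal_one]
        field_simp
  calc _ ≤ ∫⁻ x, V ^ (α - 1) * ∫⁻ y in Metric.closedBall x r, ‖φ y‖ₑ ^ α := lintegral_mono hpt
    _ = V ^ (α - 1) * (V * ∫⁻ y, ‖φ y‖ₑ ^ α) := by
        rw [lintegral_const_mul' _ _ (ENNReal.rpow_ne_top_of_ne_zero hV0 hVt),
          lintegral_setLIntegral_closedBall (hφ.enorm.pow_const α)]
    _ = _ := by
        rw [← mul_assoc]
        congr 1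
        nth_rewrite 2 [← ENNReal.rpow_one V]
        rw [← ENNReal.rpow_add _ _ hV0 hVt, sub_add_cancel]

/-- Continuity of translations in `L¹`. -/
lemma tendsto_lintegral_translation_sub {φ : Space d → ℝ} (hφ : Integrable φ) :
    Tendsto (fun z : Space d => ∫⁻ x, ‖φ (x + z) - φ x‖ₑ) (𝓝 0) (𝓝 0) := by
  have hL : MemLp φ 1 volume := memLp_one_iff_integrable.2 hφ
  have : Fact ((1 : ENNReal) ≠ ⊤) := ⟨ENNReal.one_ne_top⟩
  have hc : Continuous fun z : Space d =>
      edist (DomAddAct.mk z +ᵥ hL.toLp φ) (hL.toLp φ) :=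
    ((DomAddAct.continuous_mk.vadd continuous_const).edist continuous_const)
  have h0 := hc.tendsto 0
  have heq : ∀ z : Space d, edist (DomAddAct.mk z +ᵥ hL.toLp φ) (hL.toLp φ) =
      ∫⁻ x, ‖φ (x + z) - φ x‖ₑ := by
    intro z
    rw [DomAddAct.mk_vadd_toLp, Lp.edist_toLp_toLp, eLpNorm_one_eq_lintegral_enorm]
    simp [add_comm]
  simp_rw [heq] at h0
  simpa using h0

/-- The ball averages of an integrable function converge to it in `L¹`. -/
lemma tendsto_integral_ball_average_sub {φ : Space d → ℝ} (hφm : Measurable φ)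
    (hφ : Integrable φ) :
    Tendsto (fun r : ℝ => ∫ x, |(∫ y in Metric.closedBall x r, φ y) / (unitBallVol d * r ^ d) - φ x|)
      (𝓝[>] 0) (𝓝 0) := by
  rw [Metric.tendsto_nhds]
  intro ε hε
  have h1 := (tendsto_lintegral_translation_sub hφ).eventually
    (gt_mem_nhds (show (0 : ENNReal) < ENNReal.ofReal (ε / 2) by simpa using hε))
  obtain ⟨δ, hδ, hball⟩ := Metric.eventually_nhds_iff.1 h1
  filter_upwards [self_mem_nhdsWithin, nhdsWithin_le_nhds (gt_mem_nhds hδ)] with r hr hrδ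
  rw [mem_Ioi] at hr
  have hv := unitBallVol_pos d
  have hV0 : 0 < unitBallVol d * r ^ d := by positivity
  set V := unitBallVol d * r ^ d with hV
  have hvol : volume (Metric.closedBall (0 : Space d) r) = ENNReal.ofReal V :=
    volume_closedBall_eq 0 hr.le
  have hpt : ∀ x, ‖(∫ y in Metric.closedBall x r, φ y) / V - φ x‖ₑ ≤
      (ENNReal.ofReal V)⁻¹ * ∫⁻ z in Metric.closedBall 0 r, ‖φ (x + z) - φ x‖ₑ := by
    intro x
    have hi : IntegrableOn (fun z => φ (x + z)) (Metric.closedBall 0 r) :=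
      (hφ.comp_add_left x).integrableOn
    have hc : IntegrableOn (fun _ : Space d => φ x) (Metric.closedBall 0 r) :=
      integrableOn_const (isCompact_closedBall _ _).measure_lt_top.ne
    have hreal : volume.real (Metric.closedBall (0 : Space d) r) = V := by
      rw [Measure.real, hvol, ENNReal.toReal_ofReal hV0.le]
    have : (∫ y in Metric.closedBall x r, φ y) / V - φ x =
        V⁻¹ * ∫ z in Metric.closedBall 0 r, (φ (x + z) - φ x) := by
      rw [integral_sub hi hc, setIntegral_const, hreal, setIntegral_closedBall_eq, smul_eq_mul]
      field_simp
    rw [this, enorm_mul, Real.enorm_eq_ofReal (inv_nonneg.2 hV0.le), ENNReal.ofReal_inv_of_pos hV0]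
    gcongr
    exact enorm_integral_le_lintegral_enorm _
  have hle : ∫⁻ x, ‖(∫ y in Metric.closedBall x r, φ y) / V - φ x‖ₑ ≤ ENNReal.ofReal (ε / 2) := by
    have hVi : (ENNReal.ofReal V)⁻¹ ≠ ⊤ := by simpa using hV0
    calc _ ≤ ∫⁻ x, (ENNReal.ofReal V)⁻¹ * ∫⁻ z in Metric.closedBall 0 r, ‖φ (x + z) - φ x‖ₑ :=
          lintegral_mono hpt
      _ = (ENNReal.ofReal V)⁻¹ * ∫⁻ z in Metric.closedBall 0 r, ∫⁻ x, ‖φ (x + z) - φ x‖ₑ := by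
          rw [lintegral_const_mul' _ _ hVi, lintegral_lintegral_swap]
          exact ((hφm.comp (measurable_fst.add measurable_snd)).sub
            (hφm.comp measurable_fst)).enorm.aemeasurable
      _ ≤ (ENNReal.ofReal V)⁻¹ * ∫⁻ _ in Metric.closedBall (0 : Space d) r,
            ENNReal.ofReal (ε / 2) := by
          refine mul_le_mul' le_rfl ?_
          refine setLIntegral_mono' measurableSet_closedBall fun z hz => ?_
          exact (hball ((Metric.mem_closedBall.1 hz).trans_lt hrδ)).le
      _ = ENNReal.ofReal (ε / 2) := by
          rw [setLIntegral_const, hvol, mul_comm (ENNReal.ofReal (ε / 2)), ← mul_assoc,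
            ENNReal.inv_mul_cancel (by simpa using hV0) ENNReal.ofReal_ne_top, one_mul]
  rw [Real.dist_eq, sub_zero, abs_of_nonneg (integral_nonneg fun x => abs_nonneg _)]
  by_cases hi : Integrable (fun x => |(∫ y in Metric.closedBall x r, φ y) / V - φ x|)
  · rw [integral_eq_lintegral_of_nonneg_ae (ae_of_all _ fun x => abs_nonneg _)
      hi.aestronglyMeasurable]
    have h2 : ∀ x, ENNReal.ofReal |(∫ y in Metric.closedBall x r, φ y) / V - φ x| =
        ‖(∫ y in Metric.closedBall x r, φ y) / V - φ x‖ₑ := fun x => (Real.enorm_eq_ofReal_abs _).symm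
    simp_rw [h2]
    exact (ENNReal.toReal_le_of_le_ofReal (by positivity) hle).trans_lt (by linarith)
  · -- not a case that occurs, but the value `0` of the integral makes it harmless
    rw [integral_undef hi]; exact hε

end

section

variable {d : ℕ} {α β Cβ C₀ C₁ K C σ b : ℝ} {G : Measure ℝ} [IsProbabilityMeasure G]
  {f : ℝ → ℝ} {φ : Space d → ℝ} {y : Space d}
  {k : Space d → Space d → ℝ} {kρ : ℝ → Space d → Space d → ℝ} {lam : ℝ → ℝ}

/-! ### Signed measures with a density in `L¹ ∩ L^α` -/

/-- A measurable function in `L¹ ∩ L^α`. -/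
structure IsDensity (α : ℝ) (φ : Space d → ℝ) : Prop where
  measurable : Measurable φ
  integrable : Integrable φ
  integrable_rpow : Integrable fun x => |φ x| ^ α

lemma lintegral_enorm_eq (hφ : IsDensity α φ) :
    ∫⁻ x, ‖φ x‖ₑ = ENNReal.ofReal (∫ x, |φ x|) := by
  rw [ofReal_integral_eq_lintegral_ofReal hφ.integrable.abs (ae_of_all _ fun x => abs_nonneg _)]
  simp_rw [Real.enorm_eq_ofReal_abs]

lemma enorm_rpow_eq_ofReal (hα : 0 < α) (u : ℝ) : ‖u‖ₑ ^ α = ENNReal.ofReal (|u| ^ α) := by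
  rw [Real.enorm_eq_ofReal_abs, ENNReal.ofReal_rpow_of_nonneg (abs_nonneg _) hα.le]

lemma lintegral_enorm_rpow_eq (hα : 0 < α) (hφ : IsDensity α φ) :
    ∫⁻ x, ‖φ x‖ₑ ^ α = ENNReal.ofReal (∫ x, |φ x| ^ α) := by
  rw [ofReal_integral_eq_lintegral_ofReal hφ.integrable_rpow (ae_of_all _ fun x => by positivity)]
  simp_rw [enorm_rpow_eq_ofReal hα]

lemma lintegral_ball_le (hφ : IsDensity α φ) {r : ℝ} (hr : 0 < r) :
    ∫⁻ x, ENNReal.ofReal |∫ y in Metric.closedBall x r, φ y| ≤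
      ENNReal.ofReal (unitBallVol d * r ^ d * ∫ x, |φ x|) := by
  have h := lintegral_enorm_setIntegral_closedBall_le hφ.measurable r
  have hv := unitBallVol_pos d
  rw [volume_closedBall_eq _ hr.le, lintegral_enorm_eq hφ, ← ENNReal.ofReal_mul (by positivity)]
    at h
  simpa only [Real.enorm_eq_ofReal_abs] using h

lemma lintegral_ball_rpow_le (hα : 1 < α) (hφ : IsDensity α φ) {r : ℝ} (hr : 0 < r) :
    ∫⁻ x, ENNReal.ofReal (|∫ y in Metric.closedBall x r, φ y| ^ α) ≤
      ENNReal.ofReal ((unitBallVol d * r ^ d) ^ α * ∫ x, |φ x| ^ α) := by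
  have hα0 : 0 < α := by linarith
  have h := lintegral_enorm_rpow_setIntegral_closedBall_le hα hφ.measurable hr
  have hv := unitBallVol_pos d
  rw [volume_closedBall_eq _ hr.le, lintegral_enorm_rpow_eq hα0 hφ,
    ENNReal.ofReal_rpow_of_nonneg (by positivity) hα0.le, ← ENNReal.ofReal_mul (by positivity)] at h
  simpa only [enorm_rpow_eq_ofReal hα0] using h

lemma withDensity_apply_closedBall (hφ : IsDensity α φ) (x : Space d) (r : ℝ) :
    (volume.withDensityᵥ φ) (Metric.closedBall x r) = ∫ y in Metric.closedBall x r, φ y :=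
  withDensityᵥ_apply hφ.integrable measurableSet_closedBall

lemma rpow_mul_natCast_eq {r : ℝ} (hr : 0 < r) : (r ^ d) ^ α = r ^ (α * d) := by
  rw [← Real.rpow_natCast, ← Real.rpow_mul hr.le, mul_comm]

/-- The exponents are `p = d`, from `‖μ(B(x,·))‖_∞ ≤ ‖φ‖_1` and the `L¹` bound, and `q = α d`, from
the `L^α` bound. -/
lemma IsDensity.mClass (hd : 1 ≤ d) (hα : 1 < α) (hα2 : α ≤ 2) (hβ : (d : ℝ) < β)
    (hβα : β < α * d) (hφ : IsDensity α φ) : MClass α β (volume.withDensityᵥ φ) := by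
  have hv := unitBallVol_pos d
  have hd0 : (0 : ℝ) < d := by exact_mod_cast hd
  set N := ∫ x, |φ x| with hN
  set A := ∫ x, |φ x| ^ α with hA
  have hN0 : 0 ≤ N := integral_nonneg fun x => abs_nonneg _
  have hA0 : 0 ≤ A := integral_nonneg fun x => by positivity
  refine ⟨d, α * d, N ^ (α - 1) * (unitBallVol d * N) + unitBallVol d ^ α * A + 1, hd0, hβ, hβα,
    by gcongr, by positivity, fun r hr => ?_⟩
  simp_rw [withDensity_apply_closedBall hφ]
  have h1 : ∫⁻ x, ENNReal.ofReal (|∫ y in Metric.closedBall x r, φ y| ^ α) ≤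
      ENNReal.ofReal (N ^ (α - 1) * (unitBallVol d * r ^ d * N)) := by
    calc _ ≤ ∫⁻ x, ENNReal.ofReal (N ^ (α - 1)) *
          ENNReal.ofReal |∫ y in Metric.closedBall x r, φ y| := by
          refine lintegral_mono fun x => ?_
          rw [← ENNReal.ofReal_mul (by positivity)]
          apply ENNReal.ofReal_le_ofReal
          set u := ∫ y in Metric.closedBall x r, φ y with hu
          have huN : |u| ≤ N := by
            refine (abs_integral_le_integral_abs).trans ?_
            exact setIntegral_le_integral hφ.integrable.abs (ae_of_all _ fun x => abs_nonneg _)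
          calc |u| ^ α = |u| ^ (α - 1) * |u| := by
                rw [← Real.rpow_add_one' (abs_nonneg _) (by linarith), sub_add_cancel]
            _ ≤ _ := by
                gcongr
      _ = ENNReal.ofReal (N ^ (α - 1)) *
          ∫⁻ x, ENNReal.ofReal |∫ y in Metric.closedBall x r, φ y| :=
          lintegral_const_mul' _ _ (by simp)
      _ ≤ _ := by
          rw [ENNReal.ofReal_mul (by positivity)]
          gcongr
          exact lintegral_ball_le hφ hr
  have h2 := lintegral_ball_rpow_le hα hφ hr
  rw [mul_min_of_nonneg _ _ (by positivity), ENNReal.ofReal_min]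
  refine le_min (h1.trans (ENNReal.ofReal_le_ofReal ?_)) (h2.trans (ENNReal.ofReal_le_ofReal ?_))
  · rw [Real.rpow_natCast]
    have h3 : 0 ≤ (unitBallVol d ^ α * A + 1) * r ^ d := by positivity
    linarith
  · rw [Real.mul_rpow hv.le (by positivity), rpow_mul_natCast_eq hr, ← hA]
    have h3 : 0 ≤ (N ^ (α - 1) * (unitBallVol d * N) + 1) * r ^ (α * d) := by positivity
    linarith

/-! ### The limit when `n(ρ) → 0` -/

/-- Interpolation between the linear and the `α`-homogeneous bounds for `ψ_G`; the resulting
function of `s` is integrable against `s^{-β-1} ds` because `d < β < α d`. -/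
lemma TruncSqBound.lintegral_psiG_le (hT : TruncSqBound α C G)
    {g : Space d → ℝ} {s N A θ : ℝ} (hs : 0 < s)
    (h1 : ∫⁻ x, ENNReal.ofReal |g x| ≤ ENNReal.ofReal (s ^ d * N))
    (h2 : ∫⁻ x, ENNReal.ofReal (|g x| ^ α) ≤ ENNReal.ofReal (s ^ (α * d) * A))
    (hN : 0 ≤ N) (hA : 0 ≤ A) :
    ∫⁻ x, ‖psiG G (θ * g x)‖ₑ ≤
      ENNReal.ofReal ((2 * (∫ x, |x| ∂G) * |θ| * N + 2 * C * |θ| ^ α * A) *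
        min (s ^ (d : ℝ)) (s ^ (α * d))) := by
  have hE : 0 ≤ ∫ x, |x| ∂G := integral_nonneg fun x => abs_nonneg _
  have hC := hT.1
  have b1 : ∫⁻ x, ‖psiG G (θ * g x)‖ₑ ≤
      ENNReal.ofReal (2 * (∫ x, |x| ∂G) * |θ| * (s ^ d * N)) := by
    calc _ ≤ ∫⁻ x, ENNReal.ofReal (2 * (∫ x, |x| ∂G) * |θ|) * ENNReal.ofReal |g x| := by
          refine lintegral_mono fun x => ?_
          rw [← ENNReal.ofReal_mul (by positivity), ← ofReal_norm]
          apply ENNReal.ofReal_le_ofReal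
          rw [mul_assoc _ |θ|, ← abs_mul]
          exact hT.norm_psiG_le_linear _
      _ = ENNReal.ofReal (2 * (∫ x, |x| ∂G) * |θ|) * ∫⁻ x, ENNReal.ofReal |g x| :=
          lintegral_const_mul' _ _ (by simp)
      _ ≤ _ := by
        rw [ENNReal.ofReal_mul (p := 2 * (∫ x, |x| ∂G) * |θ|) (by positivity)]; gcongr
  have b2 : ∫⁻ x, ‖psiG G (θ * g x)‖ₑ ≤
      ENNReal.ofReal (2 * C * |θ| ^ α * (s ^ (α * d) * A)) := by
    calc _ ≤ ∫⁻ x, ENNReal.ofReal (2 * C * |θ| ^ α) * ENNReal.ofReal (|g x| ^ α) := by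
          refine lintegral_mono fun x => ?_
          rw [← ENNReal.ofReal_mul (by positivity), ← ofReal_norm]
          apply ENNReal.ofReal_le_ofReal
          rw [mul_assoc _ (|θ| ^ α), ← Real.mul_rpow (abs_nonneg _) (abs_nonneg _), ← abs_mul]
          exact hT.norm_psiG_le _
      _ = ENNReal.ofReal (2 * C * |θ| ^ α) * ∫⁻ x, ENNReal.ofReal (|g x| ^ α) :=
          lintegral_const_mul' _ _ (by simp)
      _ ≤ _ := by rw [ENNReal.ofReal_mul (p := 2 * C * |θ| ^ α) (by positivity)]; gcongr
  rw [mul_min_of_nonneg _ _ (by positivity), ENNReal.ofReal_min]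
  refine le_min (b1.trans (ENNReal.ofReal_le_ofReal ?_)) (b2.trans (ENNReal.ofReal_le_ofReal ?_))
  · rw [Real.rpow_natCast]
    have h3 : 0 ≤ 2 * C * |θ| ^ α * A * s ^ d := by positivity
    linarith
  · have h3 : 0 ≤ 2 * (∫ x, |x| ∂G) * |θ| * N * s ^ (α * d) := by positivity
    linarith

lemma lintegral_mul_pow_le (hφ : IsDensity α φ) {s : ℝ} (hs : 0 < s) :
    ∫⁻ x, ENNReal.ofReal |φ x * s ^ d| ≤ ENNReal.ofReal (s ^ d * ∫ x, |φ x|) := by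
  rw [ENNReal.ofReal_mul (by positivity), ← lintegral_enorm_eq hφ,
    ← lintegral_const_mul' _ _ (by simp)]
  refine lintegral_mono fun x => le_of_eq ?_
  rw [Real.enorm_eq_ofReal_abs, ← ENNReal.ofReal_mul (by positivity), abs_mul,
    abs_of_pos (pow_pos hs d), mul_comm]

lemma lintegral_mul_pow_rpow_le (hα : 1 < α) (hφ : IsDensity α φ) {s : ℝ} (hs : 0 < s) :
    ∫⁻ x, ENNReal.ofReal (|φ x * s ^ d| ^ α) ≤
      ENNReal.ofReal (s ^ (α * d) * ∫ x, |φ x| ^ α) := by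
  have hα0 : 0 < α := by linarith
  rw [ENNReal.ofReal_mul (by positivity), ← lintegral_enorm_rpow_eq hα0 hφ,
    ← lintegral_const_mul' _ _ (by simp)]
  refine lintegral_mono fun x => le_of_eq ?_
  rw [enorm_rpow_eq_ofReal hα0, ← ENNReal.ofReal_mul (by positivity), abs_mul,
    abs_of_pos (pow_pos hs d), Real.mul_rpow (abs_nonneg _) (by positivity), rpow_mul_natCast_eq hs,
    mul_comm]

/-- The radius at which a ball has volume `n`, so that `r = ballRadius d n * s` gives
`|B(x,r)| = n s^d`. -/
noncomputable def ballRadius (d : ℕ) (n : ℝ) : ℝ := (n / unitBallVol d) ^ (1 / (d : ℝ))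

lemma ballRadius_pos (d : ℕ) {n : ℝ} (hn : 0 < n) : 0 < ballRadius d n := by
  have := unitBallVol_pos d
  unfold ballRadius; positivity

lemma unitBallVol_mul_ballRadius_pow (hd : 1 ≤ d) {n : ℝ} (hn : 0 < n) (s : ℝ) :
    unitBallVol d * (ballRadius d n * s) ^ d = n * s ^ d := by
  have hv := unitBallVol_pos d
  rw [ballRadius, mul_pow, ← Real.rpow_natCast (_ ^ _) d, ← Real.rpow_mul (by positivity),
    one_div_mul_cancel (by positivity), Real.rpow_one]
  field_simp

lemma lintegral_scaled_ball_le (hd : 1 ≤ d) (hφ : IsDensity α φ) {n s : ℝ} (hn : 0 < n)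
    (hs : 0 < s) :
    ∫⁻ x, ENNReal.ofReal |(∫ y in Metric.closedBall x (ballRadius d n * s), φ y) / n| ≤
      ENNReal.ofReal (s ^ d * ∫ x, |φ x|) := by
  have hr : 0 < ballRadius d n * s := mul_pos (ballRadius_pos d hn) hs
  have h := lintegral_ball_le hφ hr
  rw [unitBallVol_mul_ballRadius_pow hd hn] at h
  calc _ = ∫⁻ x, ENNReal.ofReal n⁻¹ *
        ENNReal.ofReal |∫ y in Metric.closedBall x (ballRadius d n * s), φ y| := by
        refine lintegral_congr fun x => ?_
        rw [← ENNReal.ofReal_mul (by positivity), abs_div, abs_of_pos hn, div_eq_inv_mul]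
    _ = ENNReal.ofReal n⁻¹ * ∫⁻ x,
        ENNReal.ofReal |∫ y in Metric.closedBall x (ballRadius d n * s), φ y| :=
        lintegral_const_mul' _ _ (by simp)
    _ ≤ ENNReal.ofReal n⁻¹ * ENNReal.ofReal (n * s ^ d * ∫ x, |φ x|) := by gcongr
    _ = _ := by
        rw [← ENNReal.ofReal_mul (by positivity)]
        congr 1
        field_simp

lemma lintegral_scaled_ball_rpow_le (hd : 1 ≤ d) (hα : 1 < α) (hφ : IsDensity α φ) {n s : ℝ}
    (hn : 0 < n) (hs : 0 < s) :
    ∫⁻ x, ENNReal.ofReal (|(∫ y in Metric.closedBall x (ballRadius d n * s), φ y) / n| ^ α) ≤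
      ENNReal.ofReal (s ^ (α * d) * ∫ x, |φ x| ^ α) := by
  have hr : 0 < ballRadius d n * s := mul_pos (ballRadius_pos d hn) hs
  have h := lintegral_ball_rpow_le hα hφ hr
  rw [unitBallVol_mul_ballRadius_pow hd hn] at h
  have hnα : 0 < n ^ α := by positivity
  calc _ = ∫⁻ x, ENNReal.ofReal (n ^ α)⁻¹ *
        ENNReal.ofReal (|∫ y in Metric.closedBall x (ballRadius d n * s), φ y| ^ α) := by
        refine lintegral_congr fun x => ?_
        rw [← ENNReal.ofReal_mul (by positivity), abs_div, abs_of_pos hn,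
          Real.div_rpow (abs_nonneg _) hn.le, div_eq_inv_mul]
    _ = ENNReal.ofReal (n ^ α)⁻¹ * ∫⁻ x,
        ENNReal.ofReal (|∫ y in Metric.closedBall x (ballRadius d n * s), φ y| ^ α) :=
        lintegral_const_mul' _ _ (by simp)
    _ ≤ ENNReal.ofReal (n ^ α)⁻¹ * ENNReal.ofReal ((n * s ^ d) ^ α * ∫ x, |φ x| ^ α) := by gcongr
    _ = _ := by
        rw [← ENNReal.ofReal_mul (by positivity), Real.mul_rpow hn.le (by positivity),
          rpow_mul_natCast_eq hs]
        congr 1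
        field_simp

omit [IsProbabilityMeasure G] in
lemma lintegral_psiG_mul_le {g : Space d → ℝ} {θ B D : ℝ} {κ₀ : Space d → ℝ}
    (hκ0 : ∀ x, 0 ≤ κ₀ x) (hκB : ∀ x, κ₀ x ≤ B)
    (h : ∫⁻ x, ‖psiG G (θ * g x)‖ₑ ≤ ENNReal.ofReal D) :
    ∫⁻ x, ‖psiG G (θ * g x) * (κ₀ x : ℂ)‖ₑ ≤ ENNReal.ofReal (B * D) := by
  have hB : 0 ≤ B := (hκ0 0).trans (hκB 0)
  calc _ ≤ ∫⁻ x, ENNReal.ofReal B * ‖psiG G (θ * g x)‖ₑ := by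
        refine lintegral_mono fun x => ?_
        rw [enorm_mul, mul_comm, ← ofReal_norm (κ₀ x : ℂ), Complex.norm_real,
          Real.norm_of_nonneg (hκ0 x)]
        gcongr
        exact hκB x
    _ = ENNReal.ofReal B * ∫⁻ x, ‖psiG G (θ * g x)‖ₑ := lintegral_const_mul' _ _ (by simp)
    _ ≤ _ := by rw [ENNReal.ofReal_mul hB]; gcongr

lemma integrable_smallBallIntegrand (hα : 1 < α) (hβ : (d : ℝ) < β)
    (hβα : β < α * d) (hT : TruncSqBound α C G) (hφ : IsDensity α φ) (hCβ : 0 < Cβ)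
    (hk : KernelFamily (fun x => k x y) (fun ρ x => kρ ρ x y) lam C₁ K) (θ : ℝ) :
    Integrable (smallBallIntegrand β Cβ G φ k θ y) (dxdr d) := by
  have hE : 0 ≤ ∫ x, |x| ∂G := integral_nonneg fun x => abs_nonneg _
  have hN0 : 0 ≤ ∫ x, |φ x| := integral_nonneg fun x => abs_nonneg _
  have hA0 : 0 ≤ ∫ x, |φ x| ^ α := integral_nonneg fun x => by positivity
  have hC := hT.1
  have hK := hk.bound_nonneg
  have hv := unitBallVol_pos d
  set D := 2 * (∫ x, |x| ∂G) * |θ| * (∫ x, |φ x|) + 2 * C * |θ| ^ α * ∫ x, |φ x| ^ α with hD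
  have hD0 : 0 ≤ D := by positivity
  refine integrable_dxdr_of_lintegral_le (p := d) (q := α * d)
    (C := K * D * (unitBallVol d ^ (β / d) * Cβ)) ?_ hβ hβα (by positivity) fun s hs => ?_
  · refine Measurable.aestronglyMeasurable ?_
    unfold smallBallIntegrand
    refine (hT.continuous_psiG.measurable.comp ?_).mul (Complex.measurable_ofReal.comp ?_)
    · exact ((hφ.measurable.comp measurable_fst).const_mul θ).mul (measurable_snd.pow_const d)
    · exact (hk.measurable.comp measurable_fst).mul
        (((measurable_snd.pow_const _).const_mul Cβ).const_mul _)
  · have h1 := lintegral_psiG_mul_le hk.nonneg hk.le (hT.lintegral_psiG_le (θ := θ) hs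
      (lintegral_mul_pow_le hφ hs) (lintegral_mul_pow_rpow_le hα hφ hs) hN0 hA0)
    rw [← hD] at h1
    have hw : 0 ≤ unitBallVol d ^ (β / d) * (Cβ * s ^ (-β - 1)) := by positivity
    have hpt : ∀ x, ‖smallBallIntegrand β Cβ G φ k θ y (x, s)‖ₑ =
        ‖psiG G (θ * (φ x * s ^ d)) * (k x y : ℂ)‖ₑ *
          ENNReal.ofReal (unitBallVol d ^ (β / d) * (Cβ * s ^ (-β - 1))) := by
      intro x
      have hwe : ENNReal.ofReal (unitBallVol d ^ (β / d) * (Cβ * s ^ (-β - 1))) =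
          ‖((unitBallVol d ^ (β / d) * (Cβ * s ^ (-β - 1)) : ℝ) : ℂ)‖ₑ := by
        rw [← ofReal_norm, Complex.norm_real, Real.norm_of_nonneg hw]
      rw [smallBallIntegrand, hwe, ← enorm_mul]
      congr 1
      push_cast
      ring_nf
    simp_rw [hpt]
    rw [lintegral_mul_const' _ _ (by simp)]
    calc _ ≤ ENNReal.ofReal (K * (D * min (s ^ (d : ℝ)) (s ^ (α * d)))) *
          ENNReal.ofReal (unitBallVol d ^ (β / d) * (Cβ * s ^ (-β - 1))) := by gcongr
      _ = _ := by
          rw [← ENNReal.ofReal_mul (by positivity)]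
          congr 1; ring

end

section

variable {d : ℕ} {α β Cβ C₀ C₁ K C σ b : ℝ} {G : Measure ℝ} [IsProbabilityMeasure G]
  {f : ℝ → ℝ} {φ : Space d → ℝ} {y : Space d}
  {k : Space d → Space d → ℝ} {kρ : ℝ → Space d → Space d → ℝ} {lam : ℝ → ℝ}

/-- The normalized integral `μ(B(x, r)) / n` for `μ = φ dx`, over the ball of volume `n s^d`. -/
noncomputable def scaledBall (φ : Space d → ℝ) (n s : ℝ) (x : Space d) : ℝ :=
  (∫ y in Metric.closedBall x (ballRadius d n * s), φ y) / n

lemma measurable_scaledBall (hφ : IsDensity α φ) (n : ℝ) :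
    Measurable fun z : Space d × ℝ => scaledBall φ n z.2 z.1 := by
  have h := (measurable_signedMeasure_closedBall (volume.withDensityᵥ φ)).comp
    (measurable_fst.prodMk (measurable_snd.const_mul (ballRadius d n)) :
      Measurable fun z : Space d × ℝ => (z.1, ballRadius d n * z.2))
  refine Measurable.div_const ?_ n
  simpa only [Function.comp_def, withDensity_apply_closedBall hφ] using h

lemma integrable_of_lintegral_abs_le {g : Space d → ℝ} (hg : Measurable g) {a : ℝ}
    (h : ∫⁻ x, ENNReal.ofReal |g x| ≤ ENNReal.ofReal a) : Integrable g := by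
  refine ⟨hg.aestronglyMeasurable, ?_⟩
  rw [HasFiniteIntegral]
  simp_rw [Real.enorm_eq_ofReal_abs]
  exact h.trans_lt ENNReal.ofReal_lt_top

lemma measurable_scaledBall_section (hφ : IsDensity α φ) (n s : ℝ) :
    Measurable (scaledBall φ n s) := by
  have h1 : Measurable fun x : Space d => (x, s) := measurable_id.prodMk measurable_const
  have h2 := (measurable_scaledBall hφ n).comp h1
  simpa only [Function.comp_def] using h2

lemma integrable_scaledBall (hd : 1 ≤ d) (hφ : IsDensity α φ) {n s : ℝ} (hn : 0 < n)
    (hs : 0 < s) : Integrable (scaledBall φ n s) := by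
  have h := lintegral_scaled_ball_le hd hφ hn hs
  refine integrable_of_lintegral_abs_le (measurable_scaledBall_section hφ n s)
    (a := s ^ d * ∫ x, |φ x|) ?_
  unfold scaledBall
  exact h

lemma tendsto_ballRadius (hd : 1 ≤ d) {n : ℝ → ℝ} (hn0 : ∀ ρ ∈ Ioo (0 : ℝ) 1, 0 < n ρ)
    (hn : Tendsto n (𝓝[>] 0) (𝓝 0)) :
    Tendsto (fun ρ => ballRadius d (n ρ)) (𝓝[>] 0) (𝓝[>] 0) := by
  refine tendsto_nhdsWithin_iff.2 ⟨?_, ?_⟩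
  · have hd0 : (0 : ℝ) < d := by exact_mod_cast hd
    have h1 := (hn.div_const (unitBallVol d)).rpow_const (p := 1 / (d : ℝ)) (Or.inr (by positivity))
    rwa [zero_div, Real.zero_rpow (by positivity)] at h1
  · filter_upwards [Ioo_mem_nhdsGT_zero] with ρ hρ
    exact ballRadius_pos d (hn0 ρ hρ)

/-- The normalized ball integrals converge in `L¹` to `φ s^d`. -/
lemma tendsto_integral_scaledBall_sub (hd : 1 ≤ d) (hφ : IsDensity α φ) {n : ℝ → ℝ}
    (hn0 : ∀ ρ ∈ Ioo (0 : ℝ) 1, 0 < n ρ) (hn : Tendsto n (𝓝[>] 0) (𝓝 0)) {s : ℝ} (hs : 0 < s) :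
    Tendsto (fun ρ => ∫ x, |scaledBall φ (n ρ) s x - φ x * s ^ d|) (𝓝[>] 0) (𝓝 0) := by
  have hr : Tendsto (fun ρ => ballRadius d (n ρ) * s) (𝓝[>] 0) (𝓝[>] 0) := by
    have h := tendsto_ballRadius hd hn0 hn
    refine tendsto_nhdsWithin_iff.2 ⟨?_, ?_⟩
    · simpa using (tendsto_nhdsWithin_iff.1 h).1.mul_const s
    · filter_upwards [(tendsto_nhdsWithin_iff.1 h).2] with ρ hρ
      exact mul_pos hρ hs
  have h1 := ((tendsto_integral_ball_average_sub hφ.measurable hφ.integrable).comp hr).const_mul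
    (s ^ d)
  rw [mul_zero] at h1
  refine h1.congr' ?_
  filter_upwards [Ioo_mem_nhdsGT_zero] with ρ hρ
  have hnρ := hn0 ρ hρ
  simp only [Function.comp]
  rw [← integral_const_mul]
  congr with x
  rw [unitBallVol_mul_ballRadius_pow hd hnρ, scaledBall]
  rw [← abs_of_pos (pow_pos hs d), ← abs_mul, abs_of_pos (pow_pos hs d)]
  congr 1
  field_simp

/-- The integral over `x` at a fixed radius: `ψ_G` is Lipschitz, so the `L¹` convergence of the ball
integrals allows replacing them by `φ s^d`, and the kernels are bounded. -/
lemma tendsto_integral_psiG_scaledBall (hd : 1 ≤ d) (hT : TruncSqBound α C G)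
    (hφ : IsDensity α φ) (hk : KernelFamily (fun x => k x y) (fun ρ x => kρ ρ x y) lam C₁ K)
    {n : ℝ → ℝ} (hn0 : ∀ ρ ∈ Ioo (0 : ℝ) 1, 0 < n ρ) (hn : Tendsto n (𝓝[>] 0) (𝓝 0)) (θ : ℝ)
    {s : ℝ} (hs : 0 < s) :
    Tendsto (fun ρ => ∫ x, psiG G (θ * scaledBall φ (n ρ) s x) * ((kρ ρ x y / lam ρ : ℝ) : ℂ))
      (𝓝[>] 0) (𝓝 (∫ x, psiG G (θ * (φ x * s ^ d)) * ((k x y : ℝ) : ℂ))) := by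
  set E := 2 * ∫ x, |x| ∂G with hE
  have hE0 : 0 ≤ E := mul_nonneg (by norm_num) (integral_nonneg fun x => abs_nonneg _)
  have hK := hk.bound_nonneg
  have hφs : Integrable fun x => φ x * s ^ d := hφ.integrable.mul_const _
  have hψφ : Measurable fun x => psiG G (θ * (φ x * s ^ d)) :=
    hT.continuous_psiG.measurable.comp ((hφ.measurable.mul_const _).const_mul θ)
  have hκn : ∀ ρ ∈ Ioo (0 : ℝ) 1, ∀ x, ‖((kρ ρ x y / lam ρ : ℝ) : ℂ)‖ ≤ |C₁| * K := by
    intro ρ hρ x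
    rw [Complex.norm_real, Real.norm_of_nonneg (hk.div_nonneg hρ x)]
    exact hk.div_le hρ x
  have hκm : ∀ ρ ∈ Ioo (0 : ℝ) 1, Measurable fun x => ((kρ ρ x y / lam ρ : ℝ) : ℂ) := fun ρ hρ =>
    Complex.measurable_ofReal.comp ((hk.scaled_measurable ρ hρ).div_const _)
  have hbd : ∀ ρ ∈ Ioo (0 : ℝ) 1, ∀ x,
      ‖psiG G (θ * (φ x * s ^ d)) * ((kρ ρ x y / lam ρ : ℝ) : ℂ)‖ ≤
        E * |θ| * (|C₁| * K) * |φ x * s ^ d| := by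
    intro ρ hρ x
    rw [norm_mul]
    calc _ ≤ (E * |θ * (φ x * s ^ d)|) * (|C₁| * K) := by
          gcongr
          · exact hT.norm_psiG_le_linear _
          · exact hκn ρ hρ x
      _ = _ := by rw [abs_mul]; ring
  have hmain : Tendsto (fun ρ => ∫ x, psiG G (θ * (φ x * s ^ d)) *
      ((kρ ρ x y / lam ρ : ℝ) : ℂ)) (𝓝[>] 0)
      (𝓝 (∫ x, psiG G (θ * (φ x * s ^ d)) * ((k x y : ℝ) : ℂ))) := by
    refine tendsto_integral_filter_of_dominated_convergence
      (fun x => E * |θ| * (|C₁| * K) * |φ x * s ^ d|) ?_ ?_ (hφs.abs.const_mul _) ?_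
    · filter_upwards [Ioo_mem_nhdsGT_zero] with ρ hρ
      exact (hψφ.mul (hκm ρ hρ)).aestronglyMeasurable
    · filter_upwards [Ioo_mem_nhdsGT_zero] with ρ hρ
      exact ae_of_all _ (hbd ρ hρ)
    · exact ae_of_all _ fun x => tendsto_const_nhds.mul
        ((Complex.continuous_ofReal.tendsto _).comp (hk.tendsto_div x))
  have hdiff : Tendsto (fun ρ =>
      (∫ x, psiG G (θ * scaledBall φ (n ρ) s x) * ((kρ ρ x y / lam ρ : ℝ) : ℂ)) -
        ∫ x, psiG G (θ * (φ x * s ^ d)) * ((kρ ρ x y / lam ρ : ℝ) : ℂ)) (𝓝[>] 0) (𝓝 0) := by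
    have h0 := (tendsto_integral_scaledBall_sub hd hφ hn0 hn hs).const_mul (E * |θ| * (|C₁| * K))
    rw [mul_zero] at h0
    refine squeeze_zero_norm' ?_ h0
    filter_upwards [Ioo_mem_nhdsGT_zero] with ρ hρ
    have hsb := integrable_scaledBall hd hφ (hn0 ρ hρ) hs
    have hi1 : Integrable fun x =>
        psiG G (θ * scaledBall φ (n ρ) s x) * ((kρ ρ x y / lam ρ : ℝ) : ℂ) := by
      refine (hsb.abs.const_mul (E * |θ| * (|C₁| * K))).mono' ?_ (ae_of_all _ fun x => ?_)
      · exact ((hT.continuous_psiG.measurable.comp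
          ((measurable_scaledBall_section hφ (n ρ) s).const_mul θ)).mul
            (hκm ρ hρ)).aestronglyMeasurable
      · rw [norm_mul]
        calc _ ≤ (E * |θ * scaledBall φ (n ρ) s x|) * (|C₁| * K) := by
              gcongr
              · exact hT.norm_psiG_le_linear _
              · exact hκn ρ hρ x
          _ = _ := by rw [abs_mul]; ring
    have hi2 : Integrable fun x =>
        psiG G (θ * (φ x * s ^ d)) * ((kρ ρ x y / lam ρ : ℝ) : ℂ) :=
      (hφs.abs.const_mul (E * |θ| * (|C₁| * K))).mono' (hψφ.mul (hκm ρ hρ)).aestronglyMeasurable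
        (ae_of_all _ (hbd ρ hρ))
    rw [← integral_sub hi1 hi2, ← integral_const_mul]
    refine norm_integral_le_of_norm_le ((hsb.sub hφs).abs.const_mul _) (ae_of_all _ fun x => ?_)
    rw [← sub_mul, norm_mul]
    calc _ ≤ (E * |θ * scaledBall φ (n ρ) s x - θ * (φ x * s ^ d)|) * (|C₁| * K) := by
          gcongr
          · exact hT.norm_psiG_sub_le _ _
          · exact hκn ρ hρ x
      _ = _ := by rw [← mul_sub, abs_mul]; ring
  simpa using hdiff.add hmain

lemma ballRadius_mul_radiusScale {n ρ s : ℝ} (hn : 0 < n) (hρ : 0 < ρ) :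
    ballRadius d n * (n ^ (β / d) * radiusScale β f ρ (ballRadius d n * s)) =
      unitBallVol d ^ (β / d) * radiusScale β f (ρ / ballRadius d n) s := by
  have hv := unitBallVol_pos d
  have hκ := ballRadius_pos d hn
  have hpow : n ^ (β / d) = unitBallVol d ^ (β / d) * ballRadius d n ^ β := by
    rw [ballRadius, ← Real.rpow_mul (by positivity), one_div_mul_eq_div,
      ← Real.mul_rpow hv.le (by positivity), mul_div_cancel₀ _ hv.ne']
  rw [hpow, radiusScale, radiusScale, Real.div_rpow hρ.le hκ.le,
    show s / (ρ / ballRadius d n) = ballRadius d n * s / ρ by field_simp]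
  have h1 := Real.rpow_pos_of_pos hρ β
  have h2 := Real.rpow_pos_of_pos hκ β
  field_simp

/-- Fubini's theorem and the substitution `r = ballRadius d n * s`. -/
lemma mul_integral_scaledIntegrand_eq (hd : 1 ≤ d) (hα : 1 < α) (hα2 : α ≤ 2)
    (hβ : (d : ℝ) < β) (hβα : β < α * d) (hT : TruncSqBound α C G) (hφ : IsDensity α φ)
    (hf : RadiusDensity β Cβ C₀ f)
    (hk : KernelFamily (fun x => k x y) (fun ρ x => kρ ρ x y) lam C₁ K)
    {n ρ : ℝ} (hn : 0 < n) (hρ : ρ ∈ Ioo (0 : ℝ) 1) (θ : ℝ) :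
    ((n ^ (β / d) / (lam ρ * ρ ^ β) : ℝ) : ℂ) *
        ∫ z, scaledIntegrand G (volume.withDensityᵥ φ) (kρ ρ) f ρ n θ y z ∂dxdr d =
      ∫ s in Ioi (0 : ℝ),
        (∫ x, psiG G (θ * scaledBall φ n s x) * ((kρ ρ x y / lam ρ : ℝ) : ℂ)) *
          ((unitBallVol d ^ (β / d) * radiusScale β f (ρ / ballRadius d n) s : ℝ) : ℂ) := by
  have hint := (integrable_scaledIntegrand (n := n) (θ := θ) hT
    (hφ.mClass hd hα hα2 hβ hβα) hf hk hρ).const_mul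
      ((n ^ (β / d) / (lam ρ * ρ ^ β) : ℝ) : ℂ)
  have hκ := ballRadius_pos d hn
  rw [← integral_const_mul, dxdr, integral_prod_symm _ hint]
  simp_rw [mul_scaledIntegrand, withDensity_apply_closedBall hφ]
  have hsub := integral_comp_mul_left_Ioi (fun r => ∫ x, (((n ^ (β / d) : ℝ) : ℂ) *
    psiG G (θ * (∫ y in Metric.closedBall x r, φ y) / n)) *
      ((kρ ρ x y / lam ρ * radiusScale β f ρ r : ℝ) : ℂ)) 0 hκ
  rw [mul_zero, eq_inv_smul_iff₀ hκ.ne'] at hsub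
  rw [← hsub, ← integral_smul]
  congr with s
  rw [← integral_smul, ← integral_mul_const]
  congr with x
  rw [← ballRadius_mul_radiusScale hn hρ.1, scaledBall, mul_div_assoc θ, Complex.real_smul]
  push_cast
  ring

lemma tendsto_div_ballRadius (hd : 1 ≤ d) {n : ℝ → ℝ} (hn0 : ∀ ρ ∈ Ioo (0 : ℝ) 1, 0 < n ρ)
    (hn : (fun ρ : ℝ => ρ ^ d) =o[𝓝[>] 0] n) :
    Tendsto (fun ρ => ρ / ballRadius d (n ρ)) (𝓝[>] 0) (𝓝[>] 0) := by
  have hd0 : (0 : ℝ) < d := by exact_mod_cast hd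
  have hv := unitBallVol_pos d
  refine tendsto_nhdsWithin_iff.2 ⟨?_, ?_⟩
  · have h1 := (hn.tendsto_div_nhds_zero.mul_const (unitBallVol d)).rpow_const (p := 1 / (d : ℝ))
      (Or.inr (by positivity))
    rw [zero_mul, Real.zero_rpow (by positivity)] at h1
    refine h1.congr' ?_
    filter_upwards [Ioo_mem_nhdsGT_zero] with ρ hρ
    have hnρ := hn0 ρ hρ
    have hρ0 := hρ.1
    rw [ballRadius, show ρ ^ d / n ρ * unitBallVol d = ρ ^ d / (n ρ / unitBallVol d) by field_simp,
      Real.div_rpow (by positivity) (by positivity), one_div,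
      Real.pow_rpow_inv_natCast hρ0.le (by omega)]
  · filter_upwards [Ioo_mem_nhdsGT_zero] with ρ hρ
    exact div_pos hρ.1 (ballRadius_pos d (hn0 ρ hρ))

/-- Dominated convergence in the rescaled radius `s`, with majorant
`min (s^d) (s^{α d}) s^{-β-1}`. -/
lemma tendsto_mul_integral_scaledIntegrand_zero (hd : 1 ≤ d) (hα : 1 < α) (hα2 : α ≤ 2)
    (hβ : (d : ℝ) < β) (hβα : β < α * d) (hT : TruncSqBound α C G) (hφ : IsDensity α φ)
    (hf : RadiusDensity β Cβ C₀ f)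
    (hk : KernelFamily (fun x => k x y) (fun ρ x => kρ ρ x y) lam C₁ K)
    {n : ℝ → ℝ} (hn0 : ∀ ρ ∈ Ioo (0 : ℝ) 1, 0 < n ρ) (hn : Tendsto n (𝓝[>] 0) (𝓝 0))
    (hρn : (fun ρ : ℝ => ρ ^ d) =o[𝓝[>] 0] n) (θ : ℝ) :
    Tendsto (fun ρ => ((n ρ ^ (β / d) / (lam ρ * ρ ^ β) : ℝ) : ℂ) *
        ∫ z, scaledIntegrand G (volume.withDensityᵥ φ) (kρ ρ) f ρ (n ρ) θ y z ∂dxdr d)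
      (𝓝[>] 0) (𝓝 (∫ z, smallBallIntegrand β Cβ G φ k θ y z ∂dxdr d)) := by
  have hE : 0 ≤ ∫ x, |x| ∂G := integral_nonneg fun x => abs_nonneg _
  have hN0 : 0 ≤ ∫ x, |φ x| := integral_nonneg fun x => abs_nonneg _
  have hA0 : 0 ≤ ∫ x, |φ x| ^ α := integral_nonneg fun x => by positivity
  have hC := hT.1
  have hK := hk.bound_nonneg
  have hv := unitBallVol_pos d
  have hC₀ := hf.pos'
  set D := 2 * (∫ x, |x| ∂G) * |θ| * (∫ x, |φ x|) + 2 * C * |θ| ^ α * ∫ x, |φ x| ^ α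
  have hD0 : 0 ≤ D := by positivity
  have hlim : ∫ z, smallBallIntegrand β Cβ G φ k θ y z ∂dxdr d = ∫ s in Ioi (0 : ℝ),
      (∫ x, psiG G (θ * (φ x * s ^ d)) * ((k x y : ℝ) : ℂ)) *
        ((unitBallVol d ^ (β / d) * (Cβ * s ^ (-β - 1)) : ℝ) : ℂ) := by
    have hint := integrable_smallBallIntegrand hα hβ hβα hT hφ hf.pos hk θ
    rw [dxdr, integral_prod_symm _ hint]
    congr with s
    rw [← integral_mul_const]
    congr with x
    rw [smallBallIntegrand]
    push_cast
    ring_nf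
  rw [hlim]
  have heq : (fun ρ => ∫ s in Ioi (0 : ℝ),
      (∫ x, psiG G (θ * scaledBall φ (n ρ) s x) * ((kρ ρ x y / lam ρ : ℝ) : ℂ)) *
        ((unitBallVol d ^ (β / d) * radiusScale β f (ρ / ballRadius d (n ρ)) s : ℝ) : ℂ))
      =ᶠ[𝓝[>] 0] fun ρ => ((n ρ ^ (β / d) / (lam ρ * ρ ^ β) : ℝ) : ℂ) *
        ∫ z, scaledIntegrand G (volume.withDensityᵥ φ) (kρ ρ) f ρ (n ρ) θ y z ∂dxdr d := by
    filter_upwards [Ioo_mem_nhdsGT_zero] with ρ hρ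
    exact (mul_integral_scaledIntegrand_eq hd hα hα2 hβ hβα hT hφ hf hk (hn0 ρ hρ) hρ θ).symm
  refine Tendsto.congr' heq ?_
  refine tendsto_integral_filter_of_dominated_convergence
    (fun s => |C₁| * K * D * (unitBallVol d ^ (β / d) * C₀) *
      min (s ^ (d : ℝ)) (s ^ (α * d)) * s ^ (-β - 1)) ?_ ?_ ?_ ?_
  · filter_upwards [Ioo_mem_nhdsGT_zero] with ρ hρ
    refine AEStronglyMeasurable.mul ?_ ?_
    · refine (StronglyMeasurable.integral_prod_left (μ := volume)
        (f := fun x s => psiG G (θ * scaledBall φ (n ρ) s x) *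
          ((kρ ρ x y / lam ρ : ℝ) : ℂ)) ?_).aestronglyMeasurable
      refine Measurable.stronglyMeasurable ?_
      exact (hT.continuous_psiG.measurable.comp ((measurable_scaledBall hφ (n ρ)).const_mul θ)).mul
        (Complex.measurable_ofReal.comp
          (((hk.scaled_measurable ρ hρ).comp measurable_fst).div_const _))
    · exact (Complex.measurable_ofReal.comp
        ((measurable_radiusScale hf _).const_mul _)).aestronglyMeasurable
  · filter_upwards [Ioo_mem_nhdsGT_zero] with ρ hρ
    filter_upwards [ae_restrict_mem measurableSet_Ioi] with s hs
    rw [mem_Ioi] at hs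
    have hnρ := hn0 ρ hρ
    have hρκ := div_pos hρ.1 (ballRadius_pos d hnρ)
    have h1 := lintegral_psiG_mul_le (hk.div_nonneg hρ) (hk.div_le hρ)
      (hT.lintegral_psiG_le (θ := θ) hs (lintegral_scaled_ball_le hd hφ hnρ hs)
        (lintegral_scaled_ball_rpow_le hd hα hφ hnρ hs) hN0 hA0)
    have h2 : ‖∫ x, psiG G (θ * scaledBall φ (n ρ) s x) * ((kρ ρ x y / lam ρ : ℝ) : ℂ)‖ ≤
        |C₁| * K * (D * min (s ^ (d : ℝ)) (s ^ (α * d))) := by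
      refine (norm_integral_le_lintegral_norm _).trans ?_
      simp_rw [ofReal_norm]
      exact ENNReal.toReal_le_of_le_ofReal (by positivity) h1
    have h3 := radiusScale_nonneg hf hρκ hs
    rw [norm_mul, Complex.norm_real, Real.norm_of_nonneg (by positivity)]
    calc _ ≤ |C₁| * K * (D * min (s ^ (d : ℝ)) (s ^ (α * d))) *
          (unitBallVol d ^ (β / d) * (C₀ * s ^ (-β - 1))) := by
          gcongr
          exact radiusScale_le hf hρκ hs
      _ = _ := by ring
  · refine ⟨Measurable.aestronglyMeasurable (by fun_prop), ?_⟩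
    rw [hasFiniteIntegral_iff_ofReal]
    · exact lintegral_min_rpow_lt_top hβ hβα (by positivity)
    · filter_upwards [ae_restrict_mem measurableSet_Ioi] with s hs
      rw [mem_Ioi] at hs
      simp only [Pi.zero_apply]
      positivity
  · filter_upwards [ae_restrict_mem measurableSet_Ioi] with s hs
    rw [mem_Ioi] at hs
    refine (tendsto_integral_psiG_scaledBall hd hT hφ hk hn0 hn θ hs).mul
      ((Complex.continuous_ofReal.tendsto _).comp ?_)
    exact ((tendsto_radiusScale hf hs).comp (tendsto_div_ballRadius hd hn0 hρn)).const_mul _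

/-- For a positive kernel, `J = 0` forces `θ φ = 0`: otherwise `θ φ(x) r^d` runs through a punctured
neighbourhood of `0`, where `Re ψ_G` is negative. -/
lemma ae_eq_zero_of_integral_smallBallIntegrand_eq_zero (hd : 1 ≤ d) (hα : 1 < α) (hσ : 0 < σ)
    (hb : b ∈ Icc (-1 : ℝ) 1) (hβ : (d : ℝ) < β) (hβα : β < α * d)
    (hG : NormalDomainOfAttraction α σ b G) (hT : TruncSqBound α C G) (hφ : IsDensity α φ)
    (hCβ : 0 < Cβ) (hk : KernelFamily (fun x => k x y) (fun ρ x => kρ ρ x y) lam C₁ K)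
    (hkpos : ∀ x, 0 < k x y) {θ : ℝ}
    (h0 : ∫ z, smallBallIntegrand β Cβ G φ k θ y z ∂dxdr d = 0) :
    ∀ᵐ x, θ * φ x = 0 := by
  have hv := unitBallVol_pos d
  obtain ⟨δ, hδ, hneg⟩ := hT.exists_psiG_re_neg (hG.measure_ne_zero_ne_zero hα hσ hb)
  have hpos : ∀ᵐ z ∂dxdr d,
      0 < k z.1 y * (unitBallVol d ^ (β / d) * (Cβ * z.2 ^ (-β - 1))) := by
    filter_upwards [ae_dxdr_pos d] with z hz
    have := hkpos z.1
    positivity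
  have hae := hT.ae_of_integral_eq_zero (g := fun z : Space d × ℝ => θ * φ z.1 * z.2 ^ d)
    (W := fun z => k z.1 y * (unitBallVol d ^ (β / d) * (Cβ * z.2 ^ (-β - 1))))
    (hpos.mono fun z hz => hz.le)
    (integrable_smallBallIntegrand hα hβ hβα hT hφ hCβ hk θ) h0
  have hae2 : ∀ᵐ z ∂dxdr d, (psiG G (θ * φ z.1 * z.2 ^ d)).re = 0 := by
    filter_upwards [hae, hpos] with z hz hz2
    exact hz.resolve_right hz2.ne'
  filter_upwards [Measure.ae_ae_of_ae_prod hae2] with x hx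
  by_contra hne
  have hlim : Tendsto (fun r : ℝ => |θ * φ x * r ^ d|) (𝓝[>] 0) (𝓝 0) := by
    have : Continuous fun r : ℝ => |θ * φ x * r ^ d| := by fun_prop
    have h := (this.tendsto 0).mono_left (nhdsWithin_le_nhds (s := Ioi (0 : ℝ)))
    simpa [(show d ≠ 0 by omega)] using h
  obtain ⟨ε, hε, hsub⟩ := mem_nhdsGT_iff_exists_Ioo_subset.1 (hlim.eventually (gt_mem_nhds hδ))
  rw [ae_restrict_iff' measurableSet_Ioi] at hx
  have hvol : 0 < volume (Ioo (0 : ℝ) ε) := by simpa using hε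
  refine hvol.ne' (measure_mono_null (fun r hr => ?_) hx)
  simp only [mem_compl_iff]
  intro hc
  exact (hneg _ (mul_ne_zero hne (pow_pos hr.1 d).ne') (hsub hr)).ne (hc hr.1)

end

section

variable {d : ℕ} {α β Cβ : ℝ} {G : Measure ℝ} {φ φ' : Space d → ℝ}

/-! ### Densities modulo null sets -/

lemma exists_isDensity_ae_eq (hα : 0 < α) (h1 : MemLp φ 1 volume)
    (hφα : MemLp φ (ENNReal.ofReal α) volume) :
    ∃ φ' : Space d → ℝ, φ =ᵐ[volume] φ' ∧ IsDensity α φ' := by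
  have hm := h1.1.aemeasurable
  refine ⟨hm.mk φ, hm.ae_eq_mk, hm.measurable_mk,
    (memLp_one_iff_integrable.1 h1).congr hm.ae_eq_mk, ?_⟩
  have h2 := hφα.integrable_norm_rpow (by simpa using hα) ENNReal.ofReal_ne_top
  rw [ENNReal.toReal_ofReal hα.le] at h2
  refine h2.congr (hm.ae_eq_mk.mono fun x hx => ?_)
  simp only [← hx, Real.norm_eq_abs]

lemma smallBallIntegrand_congr_ae {k : Space d → Space d → ℝ} {θ : ℝ} {y : Space d}
    (h : φ =ᵐ[volume] φ') :
    smallBallIntegrand β Cβ G φ k θ y =ᵐ[dxdr d] smallBallIntegrand β Cβ G φ' k θ y := by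
  have h2 : ∀ᵐ z ∂dxdr d, φ z.1 = φ' z.1 := Measure.quasiMeasurePreserving_fst.ae h
  filter_upwards [h2] with z hz
  rw [smallBallIntegrand, smallBallIntegrand, hz]

end

end CoxBalls

theorem mainTheorem5
    -- dimension, indices, and the law of the weights
    (d : ℕ) (hd : 1 ≤ d)
    (α σ b β : ℝ) (hα : 1 < α) (hα2 : α ≤ 2) (hσ : 0 < σ) (hb : b ∈ Icc (-1 : ℝ) 1)
    (hβ : (d : ℝ) < β) (hβα : β < α * d)
    (G : Measure ℝ) [IsProbabilityMeasure G]
    (hG : CoxBalls.NormalDomainOfAttraction α σ b G)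
    -- the density of the radii
    (f : ℝ → ℝ) (Cβ C₀ : ℝ) (hCβ : 0 < Cβ) (hC₀ : 0 < C₀)
    (hfm : Measurable f) (hf0 : ∀ r, 0 < r → 0 ≤ f r)
    (hf1 : ∫⁻ r in Ioi (0 : ℝ), ENNReal.ofReal (f r) = 1)
    (hf_equiv : f ~[atTop] fun r => Cβ / r ^ (β + 1))
    (hf_le : ∀ r, 0 < r → f r ≤ C₀ / r ^ (β + 1))
    -- the kernel `k`
    (k : CoxBalls.Space d → CoxBalls.Space d → ℝ)
    (hkm : Measurable (Function.uncurry k)) (hk0 : ∀ x y, 0 ≤ k x y)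
    (hk_bdd : ∃ K : ℝ, ∀ x y, k x y ≤ K)
    -- the rescaled kernels `k_ρ` and the intensities `lam ρ`
    (lam : ℝ → ℝ) (hlam : ∀ ρ ∈ Ioo (0 : ℝ) 1, 0 < lam ρ)
    (kρ : ℝ → CoxBalls.Space d → CoxBalls.Space d → ℝ) (C₁ : ℝ)
    (hkρm : ∀ ρ ∈ Ioo (0 : ℝ) 1, Measurable (Function.uncurry (kρ ρ)))
    (hkρ0 : ∀ ρ ∈ Ioo (0 : ℝ) 1, ∀ x y, 0 ≤ kρ ρ x y)
    (hkρ_equiv : ∀ x y, (fun ρ => kρ ρ x y) ~[𝓝[>] (0 : ℝ)] fun ρ => lam ρ * k x y)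
    (hkρ_le : ∀ ρ ∈ Ioo (0 : ℝ) 1, ∀ x y, kρ ρ x y ≤ C₁ * lam ρ * k x y) :
    -- (1) `n(ρ) → ∞`
    ((α = 2 → ∫ m, m ∂G = 0) →
      ∀ n : ℝ → ℝ, (∀ ρ ∈ Ioo (0 : ℝ) 1, 0 < n ρ) → Tendsto n (𝓝[>] 0) atTop →
      ∀ μ : SignedMeasure (CoxBalls.Space d), CoxBalls.MClass α β μ →
      ∀ (θ : ℝ) (y : CoxBalls.Space d),
        (∀ ρ ∈ Ioo (0 : ℝ) 1,
          Integrable (CoxBalls.scaledIntegrand G μ (kρ ρ) f ρ (n ρ) θ y) (CoxBalls.dxdr d)) ∧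
        Integrable (CoxBalls.stableIntegrand α β b Cβ μ k θ y) (CoxBalls.dxdr d) ∧
        (fun ρ => ∫ z, CoxBalls.scaledIntegrand G μ (kρ ρ) f ρ (n ρ) θ y z ∂(CoxBalls.dxdr d))
          ~[𝓝[>] (0 : ℝ)]
        (fun ρ => -((σ ^ α * |θ| ^ α * (lam ρ * ρ ^ β / n ρ ^ α) : ℝ) : ℂ) *
          ∫ z, CoxBalls.stableIntegrand α β b Cβ μ k θ y z ∂(CoxBalls.dxdr d))) ∧
    -- (2) `n(ρ) = 1`
    (∀ μ : SignedMeasure (CoxBalls.Space d), CoxBalls.MClass α β μ →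
      ∀ (θ : ℝ) (y : CoxBalls.Space d),
        (∀ ρ ∈ Ioo (0 : ℝ) 1,
          Integrable (CoxBalls.scaledIntegrand G μ (kρ ρ) f ρ 1 θ y) (CoxBalls.dxdr d)) ∧
        Integrable (CoxBalls.poissonIntegrand β Cβ G μ k θ y) (CoxBalls.dxdr d) ∧
        (fun ρ => ∫ z, CoxBalls.scaledIntegrand G μ (kρ ρ) f ρ 1 θ y z ∂(CoxBalls.dxdr d))
          ~[𝓝[>] (0 : ℝ)]
        (fun ρ => ((lam ρ * ρ ^ β : ℝ) : ℂ) *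
          ∫ z, CoxBalls.poissonIntegrand β Cβ G μ k θ y z ∂(CoxBalls.dxdr d))) ∧
    -- (3) `n(ρ) → 0` and `ρ^d = o(n(ρ))`
    (∀ n : ℝ → ℝ, (∀ ρ ∈ Ioo (0 : ℝ) 1, 0 < n ρ) → Tendsto n (𝓝[>] 0) (𝓝 0) →
      (fun ρ : ℝ => ρ ^ d) =o[𝓝[>] 0] n →
      ∀ φ : CoxBalls.Space d → ℝ, MemLp φ 1 volume → MemLp φ (ENNReal.ofReal α) volume →
      ∀ (θ : ℝ) (y : CoxBalls.Space d),
        (∀ ρ ∈ Ioo (0 : ℝ) 1,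
          Integrable (CoxBalls.scaledIntegrand G (volume.withDensityᵥ φ) (kρ ρ) f ρ (n ρ) θ y)
            (CoxBalls.dxdr d)) ∧
        Integrable (CoxBalls.smallBallIntegrand β Cβ G φ k θ y) (CoxBalls.dxdr d) ∧
        Tendsto (fun ρ => ((n ρ ^ (β / d) / (lam ρ * ρ ^ β) : ℝ) : ℂ) *
            ∫ z, CoxBalls.scaledIntegrand G (volume.withDensityᵥ φ) (kρ ρ) f ρ (n ρ) θ y z
              ∂(CoxBalls.dxdr d))
          (𝓝[>] 0)
          (𝓝 (∫ z, CoxBalls.smallBallIntegrand β Cβ G φ k θ y z ∂(CoxBalls.dxdr d))) ∧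
        ((∫ z, CoxBalls.smallBallIntegrand β Cβ G φ k θ y z ∂(CoxBalls.dxdr d) ≠ 0 ∨
            ∀ x, 0 < k x y) →
          (fun ρ => ∫ z, CoxBalls.scaledIntegrand G (volume.withDensityᵥ φ) (kρ ρ) f ρ (n ρ) θ y z
              ∂(CoxBalls.dxdr d))
            ~[𝓝[>] (0 : ℝ)]
          (fun ρ => ((lam ρ * ρ ^ β / n ρ ^ (β / d) : ℝ) : ℂ) *
            ∫ z, CoxBalls.smallBallIntegrand β Cβ G φ k θ y z ∂(CoxBalls.dxdr d)))) := by
  obtain ⟨C, hT⟩ : ∃ C, CoxBalls.TruncSqBound α C G :=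
    hG.exists_lintegral_truncSq_le hα hα2 hσ hb
  obtain ⟨K, hK⟩ := hk_bdd
  have hf : CoxBalls.RadiusDensity β Cβ C₀ f := ⟨hfm, hf0, hf_equiv, hf_le, hCβ, hC₀⟩
  have hk : ∀ y, CoxBalls.KernelFamily (fun x => k x y) (fun ρ x => kρ ρ x y) lam C₁ K :=
    fun y => ⟨hkm.of_uncurry_right, fun x => hk0 x y, fun x => hK x y, hlam,
      fun ρ hρ => (hkρm ρ hρ).of_uncurry_right, fun ρ hρ x => hkρ0 ρ hρ x y,
      fun x => hkρ_equiv x y, fun ρ hρ x => hkρ_le ρ hρ x y⟩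
  refine ⟨fun hmean n hn0 hn μ hμ θ y => ?_, fun μ hμ θ y => ?_,
    fun n hn0 hn hρn φ₀ hφ₁ hφα θ y => ?_⟩
  · exact ⟨fun ρ hρ => CoxBalls.integrable_scaledIntegrand hT hμ hf (hk y) hρ,
      CoxBalls.integrable_stableIntegrand hb hCβ (hk y) hμ θ,
      CoxBalls.isEquivalent_integral_scaledIntegrand_atTop hα hα2 hσ hb hG hT hf (hk y) hmean hn0
        hn hμ θ⟩
  · exact ⟨fun ρ hρ => CoxBalls.integrable_scaledIntegrand hT hμ hf (hk y) hρ,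
      CoxBalls.integrable_poissonIntegrand hT hCβ (hk y) hμ θ,
      CoxBalls.isEquivalent_integral_scaledIntegrand_one hα hσ hb hβ hG hT hf (hk y) hμ θ⟩
  · -- only the class of the density modulo null sets matters
    obtain ⟨φ, hae, hφ⟩ := CoxBalls.exists_isDensity_ae_eq (by linarith) hφ₁ hφα
    have hsmall := CoxBalls.smallBallIntegrand_congr_ae (β := β) (Cβ := Cβ) (G := G) (k := k)
      (θ := θ) (y := y) hae
    have hlim := CoxBalls.tendsto_mul_integral_scaledIntegrand_zero hd hα hα2 hβ hβα hT hφ hf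
      (hk y) hn0 hn hρn θ
    rw [WithDensityᵥEq.congr_ae hae, integral_congr_ae hsmall]
    refine ⟨fun ρ hρ => CoxBalls.integrable_scaledIntegrand hT (hφ.mClass hd hα hα2 hβ hβα) hf
      (hk y) hρ, (CoxBalls.integrable_smallBallIntegrand hα hβ hβα hT hφ hCβ (hk y) θ).congr
      hsmall.symm, hlim, fun hJ => ?_⟩
    refine CoxBalls.isEquivalent_of_tendsto_mul ?_ hlim ?_
    · filter_upwards [CoxBalls.Ioo_mem_nhdsGT_zero] with ρ hρ
      have h1 := hlam ρ hρ
      have h2 := Real.rpow_pos_of_pos hρ.1 β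
      have h3 := Real.rpow_pos_of_pos (hn0 ρ hρ) (β / d)
      rw [← Complex.ofReal_mul, ← Complex.ofReal_one]
      congr 1
      field_simp
    · refine or_iff_not_imp_left.2 fun h0 => ?_
      have hkpos := hJ.resolve_left h0
      filter_upwards [CoxBalls.Ioo_mem_nhdsGT_zero] with ρ hρ
      refine CoxBalls.integral_scaledIntegrand_eq_zero (hk y) hρ (ae_of_all _ fun z => Or.inl ?_)
      rw [CoxBalls.withDensity_apply_closedBall hφ, ← integral_const_mul]
      exact integral_eq_zero_of_ae (ae_restrict_of_ae
        (CoxBalls.ae_eq_zero_of_integral_smallBallIntegrand_eq_zero hd hα hσ hb hβ hβα hG hT hφ hCβ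
          (hk y) hkpos (not_not.1 h0)))
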